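/- **Conventions.** $|\cdot|$ is the Euclidean norm or the induced matrix norm. Classes $\mathcal K$ and $\mathcal{KL}$ are as usual ($\mathcal{KL}$: $\beta$ continuous on $\mathbb R_+^2$, $\beta(\cdot,t)\in\mathcal K$ for each $t\ge0$, $\beta(s,\cdot)$ nonincreasing with limit $0$ for each $s>0$). For $a,b\in(0,\infty]$, $\mathcal K^e$ on $(-a,b)$ is the class of continuous, strictly increasing $\alpha:(-a,b)\to\mathbb R$ with $\alpha(0)=0$. For $\gamma\in\mathcal K\cup\{0\}$ and nondecreasing $h$, $\gamma^{-1}(s)=\sup\{a\ge0:\gamma(a)\le s\}\in[0,\infty]$ and $h\circ\gamma^{-1}(s)=\sup\{h(a):a\ge 0,\ \gamma(a)\le s\}\in[0,\infty]$ (the ordinary values where the inverse is defined). The maximum over an empty set is $0$. **Plant.** Let $m\ge1$, $n_c\ge1$, and $$\dot x_i=f_i(z_i)+(g_i+\delta_i(z_i))x_{i+1},\quad i=1,\dots,m,\qquad x_{m+1}=u,$$ with $x_i\in\mathbb R^{n_i}$, $z_i=[x_1;\dots;x_i]$, constant matrices $g_i$ and locally Lipschitz $f_i,\delta_i$. There are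 constants $\underline g,\bar g,\bar\delta\ge0$ and $\bar f_{x_1},\dots,\bar f_{x_m}\in\mathcal K\cup\{0\}$ with $|f_i(z_i)|\le\sum_{j\le i}\bar f_{x_j}(|x_j|)$, $\lambda_{\min}^{1/2}(g_ig_i^T)\ge\underline g$, $|g_i|\le\bar g$, $|\delta_i(z_i)|\le\bar\delta$. **Certificates and nominal controller.** $\mathcal X\subseteq\mathbb R^{n_1}$ is nonempty and open, $V_j:\mathcal X\to\mathbb R_+$ ($j=1,\dots,n_c$) is $C^1$ with nowhere vanishing gradient, $v_j>0$, the sets $\{x\in\mathcal X:V_j(x)\ge v_j\}$ are pairwise disjoint, and $|\nabla V_j|\ge\eta>0$ on them. For $j\ne k$, every segment from a point $x\in\mathcal X$ with $V_j(x)\ge v_j$ to a point $y\in\mathcal X$ with $V_k(y)=v_k$ contains a point of $\{z\in\mathcal X:V_j(z)=v_j\}$ (this is automatic for segments contained in $\mathcal X$). $\rho_0:\mathbb R^{n_1}\to\mathbb R^{n_2}$ is $C^1$ with $|\rho_0|\le\bar\rho_0$, $\bar\rho_0>0$. Put $\breve V=\max_jV_j$ and $D_j(x)=\operatorname{sgn}(V_j(x)-v_j)\operatorname{dist}(x,\{V_j=v_j\})$.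 **Safety law $\rho_1$.** Assume $\underline g>\bar\delta$. Let $\underline\alpha_j,\bar\alpha_j$ be of class $\mathcal K^e$ on $(-p_j,q_j)\supseteq D_j(\mathcal X)$ with $\underline\alpha_j(D_j)\le V_j-v_j\le\bar\alpha_j(D_j)$ on $\mathcal X$, $\bar\alpha_j(s)\to\infty$ as $s\to q_j$, and $(-v_j,\infty)$ in the range of $\bar\alpha_j$. Let $\alpha\in\mathcal K^e$ on $\mathbb R$ satisfy $\alpha(s)+\frac{\underline g+\bar\delta}{\underline g-\bar\delta}\alpha(-s)\le0$ for $s\le0$, and put $\alpha_j=\alpha\circ\bar\alpha_j^{-1}$. Let $c_j>v_j$, $\theta>0$, $\gamma_{1,2}\in\mathcal K$ be such that $$\alpha_j\Big(\tfrac{c_j-v_j}{c_j}V_j(x)\Big)\ge\theta V_j(x)+\Big(1+\tfrac{\bar\delta}{\underline g}\Big)\gamma_{1,2}^{-1}(V_j(x))+\tfrac1{\underline g}\bar f_{x_1}(|x|)\quad\text{whenever }V_j(x)\ge c_j .$$ Let $a_j(x)^T=\frac{\partial V_j}{\partial x}g_1\big/\big|\frac{\partial V_j}{\partial x}g_1\big|$,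 $b_j(x)=-\alpha_j(V_j(x)-v_j)$, $\epsilon=\bar\delta/\underline g$, and $$\mathcal F_c(x)=\{u:\ a_j(x)^Tu+\epsilon|u|\le b_j(x),\ j=1,\dots,n_c\}.$$ Let $\rho_s(x)$ be the minimizer of $|u|^2$ subject to $a_j(x)^Tu\le b_j(x)/(1-\epsilon)$ for all $j$. Choose $\epsilon\le\bar c<1$, $k_\phi\ge0$, $c_A\in(0,1)$ with $c_A>\cos(\pi/2-\arccos\sqrt{1-\bar c^2})$, and unit vectors $l_1,\dots,l_{n_l}\in\mathbb R^{n_2}$, $n_l>n_2$, any $n_2$ of which are linearly independent, such that every unit vector $l_0$ is a nonnegative combination of the $l_i$ with $l_i^Tl_0\ge c_A$, of which there are at least $n_2$. With $\bar c_A=\cos(\arccos\sqrt{1-\bar c^2}+\arccos c_A)$ let $$[b_L(x)]_i=l_i^T\rho_s+\min_j\Big\{\max(l_i^Ta_j,\bar c_A)\frac{b_j-a_j^T\rho_s-\epsilon|\rho_s|}{1+\epsilon}+\max\big(k_\phi(\bar c_A-l_i^Ta_j),0\big)\Big\}$$ (all at $x$), and let $\rho_1(x)$ be the minimizer of $|u-\rho_0(x)|^2$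 subject to $l_i^Tu\le[b_L(x)]_i$, $i=1,\dots,n_l$. **Tracking laws.** For $i=2,\dots,m$ let $\rho_i(0)=0$ and $\rho_i(e)=-\frac{g_i^Te}{|g_i^Te|}\frac{\underline g}{\underline g-\bar\delta}\kappa_i(|e|)$ for $e\ne0$, with $\kappa_i:\mathbb R\to\mathbb R$ $C^1$, odd, strictly increasing and radially unbounded. The controller is $u=x^*_{m+1}$, where $x_2^*=\rho_1(x_1)$ and $x^*_{i+1}=\rho_i(x_i-x_i^*)$. Let * $\gamma_{x_2^*,V}\in\mathcal K$ with $|\rho_1(x)|\le\gamma_{x_2^*,V}(\breve V(x))+\bar\rho_0$ on $\mathcal X$; * $k_1>0$ such that every point of $\mathcal X$ has a neighbourhood in $\mathcal X$ on which $\rho_1$ is $k_1$-Lipschitz; * $c_{x_1}\ge0$ with $\bar f_{x_1}(|x|)\le c_{x_1}$ on $\mathcal X$; * $\gamma_{i,x_1},\gamma_{i,\rho_0},\gamma_{i,j}\in\mathcal K\cup\{0\}$ ($2\le i\le m$, $1\le j\le i+1$, $j\ne i$) and $k_i$ such that, for $i=2,\dots,m$, for all $s\ge0$ in the first inequality and all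 $s>0$ in the second, $$\kappa_i(s)\ge\theta s+\tfrac{\underline g+\bar\delta}{\underline g}\gamma_{i,i+1}^{-1}(s)+\tfrac1{\underline g}\Big(\alpha_{i,x_1}\circ\gamma_{i,x_1}^{-1}(s)+\alpha_{i,\rho_0}\circ\gamma_{i,\rho_0}^{-1}(s)+\sum_{j=1}^{i-1}\alpha_{i,j}\circ\gamma_{i,j}^{-1}(s)+\alpha_{i,i}(s)\Big),$$ $$k_i\ge\tfrac{\underline g}{\underline g-\bar\delta}\Big(\tfrac{\bar g}{\underline g}\tfrac{\kappa_i(s)}s+\kappa_i'(s)\Big),$$ where $\bar k_{p,i}=\prod_{j=p}^ik_j$ ($0$ if $p>i$), $\breve k_{p,i}=1+\sum_{j=p}^i\bar k_{j,i}$, and $\alpha_{i,x_1}(s)=\breve k_{1,i-1}s$, $\alpha_{i,\rho_0}(s)=\breve k_{2,i-1}\bar f_{x_2}(4s)+\bar k_{1,i-1}(\bar g+\bar\delta)s$, $\alpha_{i,1}=\alpha_{i,\rho_0}\circ\gamma_{x_2^*,V}$, $\alpha_{i,j}(s)=\breve k_{j,i-1}\bar f_{x_j}(2s)+\breve k_{j,i-1}\bar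 f_{x_{j+1}}\big(\tfrac{2\underline g\kappa_j(s)}{\underline g-\bar\delta}\big)+(\bar g+\bar\delta)\big(\bar k_{j,i-1}\tfrac{\underline g\kappa_j(s)}{\underline g-\bar\delta}+\bar k_{j-1,i-1}s\big)$ for $2\le j\le i-1$, $\alpha_{i,i}(s)=\bar f_{x_i}(2s)+k_{i-1}(\bar g+\bar\delta)s$. **Small-gain conditions.** For all $s>0$: $\gamma_{i,j}(s)<s$ for $i,j\in\{1,\dots,m\}$, $i\ne j$ (for the gains introduced above, $\gamma_{1,2}$ included), and $\gamma_{i,1}(s)<\gamma_{1,2}^{-1}(s)$ for $i=2,\dots,m$. **Theorem.** For every $x\in\mathcal X$ both QP problems have a unique solution and $\rho_s(x)\in\mathcal F_c(x)$, and functions $\gamma_{x_2^*,V}$ as above exist. Under all the conditions above, with $\gamma_{1,i}=\gamma_{1,2}\circ\cdots\circ\gamma_{i-1,i}$, $$\breve c=\max\Big\{c_1,\dots,c_{n_c},\ \gamma_{1,2}^{-1}\big(\max_{2\le i\le m}\gamma_{i,x_1}(c_{x_1})\big),\ \gamma_{1,2}^{-1}\big(\max_{2\le i\le m}\gamma_{i,\rho_0}(\bar\rho_0)\big)\Big\},$$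 $$\breve c_i=\max\Big\{3\gamma_{x_2^*,V}(\breve c),\ 3\gamma_{1,2}^{-1}(\breve c),\ 3\bar\rho_0,\ 2\max_{3\le j\le i}\big\{\tfrac{\underline g}{\underline g-\bar\delta}\kappa_{j-1}\circ\gamma_{1,j-1}^{-1}(\breve c),\ \gamma_{1,j}^{-1}(\breve c)\big\}\Big\},$$ there are $\breve\beta,\breve\beta_2,\dots,\breve\beta_m\in\mathcal{KL}$ such that for every Carathéodory solution of the closed loop, on any interval $\mathcal I\ni0$ of nonnegative times on which it exists (in particular on its right maximal interval; $x_1(t)\in\mathcal X$ there, $\rho_1$ being defined on $\mathcal X$), all $t\in\mathcal I$ and $i=2,\dots,m$, $$\breve V(x_1(t))\le\max\{\breve\beta(s_0,t),\breve c\},\qquad|x_i(t)|\le\max\{\breve\beta_i(s_0,t),\breve c_i\},$$ where $s_0=\max\{\breve V(x_1(0)),|\rho_0(x_1(0))|,|x_2(0)|,\dots,|x_m(0)|\}$. If $\gamma_{1,2}$ is unbounded, then $\breve c$ and all $\breve c_i$ are finite. -/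

import Mathlib

open Set Filter Topology MeasureTheory
open scoped ENNReal NNReal RealInnerProductSpace

noncomputable section

namespace CascadeSafety

/-- `ℝ^k` with the Euclidean norm. -/
abbrev Vec (k : ℕ) : Type := EuclideanSpace ℝ (Fin k)

/-! ### Comparison functions

Functions on `ℝ₊` are represented by functions on `ℝ`; only their values on `[0, ∞)` matter. -/

/-- Class `K`. -/
structure IsClassK (f : ℝ → ℝ) : Prop where
  continuousOn : ContinuousOn f (Ici 0)
  strictMonoOn : StrictMonoOn f (Ici 0)
  map_zero : f 0 = 0

/-- Class `K ∪ {0}`. -/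
def IsClassKOrZero (f : ℝ → ℝ) : Prop :=
  IsClassK f ∨ ∀ s, 0 ≤ s → f s = 0

/-- The open interval `(-a, b)` of reals, with extended real `a` and `b`. -/
def openInterval (a b : EReal) : Set ℝ :=
  {s | -a < (s : EReal) ∧ (s : EReal) < b}

/-- Class `K^e` on `(-a, b)`. -/
structure IsClassKe (a b : EReal) (f : ℝ → ℝ) : Prop where
  left_pos : 0 < a
  right_pos : 0 < b
  continuousOn : ContinuousOn f (openInterval a b)
  strictMonoOn : StrictMonoOn f (openInterval a b)
  map_zero : f 0 = 0

/-- Class `KL`. -/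
structure IsClassKL (β : ℝ → ℝ → ℝ) : Prop where
  continuousOn : ContinuousOn (Function.uncurry β) (Ici 0 ×ˢ Ici 0)
  classK : ∀ t, 0 ≤ t → IsClassK (fun s => β s t)
  antitoneOn : ∀ s, 0 < s → AntitoneOn (β s) (Ici 0)
  tendsto_zero : ∀ s, 0 < s → Tendsto (β s) atTop (𝓝 0)

/-- The value `h (γ⁻¹ (s)) ∈ [0, ∞]`, for nondecreasing `h` and `γ` on `[0, ∞)`: the supremum of
`h` over all `a ≥ 0` with `γ a ≤ s`. If `γ` is of class `K` and `s = γ a`, this is `h a`; if `s`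
lies above the range of `γ`, it is the supremum of `h`. -/
def compInv (h γ : ℝ → ℝ) (s : ℝ≥0∞) : ℝ≥0∞ :=
  ⨆ (a : ℝ) (_ : 0 ≤ a) (_ : ENNReal.ofReal (γ a) ≤ s), ENNReal.ofReal (h a)

/-- The inverse `γ⁻¹ (s) ∈ [0, ∞]`. -/
def inv (γ : ℝ → ℝ) (s : ℝ≥0∞) : ℝ≥0∞ := compInv (fun a => a) γ s

/-- The monotone extension of `h` from `[0, ∞)` to `[0, ∞]`. -/
def ext (h : ℝ → ℝ) (s : ℝ≥0∞) : ℝ≥0∞ := compInv h (fun a => a) s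

/-! ### The plant -/

/-- The cascade plant `ẋ_i = f_i(z_i) + (g_i + δ_i(z_i)) x_{i+1}`, `i = 1, …, m`, with
`z_i = (x_1, …, x_i)`, `x_i ∈ ℝ^(n i)` and `x_{m+1} = u`. The `k`-th component (`k < i`) of the
argument of `f_i` and `δ_i` is `x_{k+1}`. Indices outside `1, …, m` are not used. -/
structure Plant (m : ℕ) (n : ℕ → ℕ) where
  f : ∀ i : ℕ, (∀ k : Fin i, Vec (n (k.val + 1))) → Vec (n i)
  g : ∀ i : ℕ, Vec (n (i + 1)) →L[ℝ] Vec (n i)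
  δ : ∀ i : ℕ, (∀ k : Fin i, Vec (n (k.val + 1))) → (Vec (n (i + 1)) →L[ℝ] Vec (n i))
  f_lip : ∀ i ∈ Finset.Icc 1 m, LocallyLipschitz (f i)
  δ_lip : ∀ i ∈ Finset.Icc 1 m, LocallyLipschitz (δ i)

variable {m : ℕ} {n : ℕ → ℕ} {nc nl : ℕ}

/-- `z_i = (x_1, …, x_i)`. -/
def trunc (x : ∀ i, Vec (n i)) (i : ℕ) : ∀ k : Fin i, Vec (n (k.val + 1)) :=
  fun k => x (k.val + 1)

/-- The bounds on the plant; `glo`, `ghi` and `δbar` bound the smallest singular value of `g_i`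
(the square root of the least eigenvalue of `g_i g_iᵀ`), `|g_i|` and `|δ_i|`. -/
structure PlantBounds (P : Plant m n) (glo ghi δbar : ℝ) (fbar : ℕ → ℝ → ℝ) : Prop where
  glo_nonneg : 0 ≤ glo
  ghi_nonneg : 0 ≤ ghi
  δbar_nonneg : 0 ≤ δbar
  fbar_class : ∀ i ∈ Finset.Icc 1 m, IsClassKOrZero (fbar i)
  f_le : ∀ i ∈ Finset.Icc 1 m, ∀ z, ‖P.f i z‖ ≤ ∑ k : Fin i, fbar (k.val + 1) ‖z k‖
  le_g : ∀ i ∈ Finset.Icc 1 m, ∀ μ : ℝ,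
    Module.End.HasEigenvalue
      ((P.g i ∘L ContinuousLinearMap.adjoint (P.g i) : Vec (n i) →L[ℝ] Vec (n i)) :
        Vec (n i) →ₗ[ℝ] Vec (n i)) μ → glo ≤ √μ
  g_le : ∀ i ∈ Finset.Icc 1 m, ‖P.g i‖ ≤ ghi
  δ_le : ∀ i ∈ Finset.Icc 1 m, ∀ z, ‖P.δ i z‖ ≤ δbar

/-! ### Certificate functions and nominal controller -/

/-- The assumption on the certificate functions `V_j : X → ℝ₊`, `j = 1, …, nc`. -/
structure CertificateAssumption {d : ℕ} (X : Set (Vec d)) (V : Fin nc → Vec d → ℝ)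
    (v : Fin nc → ℝ) (η : ℝ) : Prop where
  X_open : IsOpen X
  X_nonempty : X.Nonempty
  V_nonneg : ∀ j, ∀ x ∈ X, 0 ≤ V j x
  v_pos : ∀ j, 0 < v j
  disjoint : ∀ j k, k ≠ j → {x | x ∈ X ∧ v j ≤ V j x ∧ v k ≤ V k x} = ∅
  contDiffOn : ∀ j, ContDiffOn ℝ 1 (V j) X
  grad_ne_zero : ∀ j, ∀ x ∈ X, gradient (V j) x ≠ 0
  η_pos : 0 < η
  le_grad : ∀ j, ∀ x ∈ X, v j ≤ V j x → η ≤ ‖gradient (V j) x‖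

/-- The assumption on the nominal controller. -/
structure NominalAssumption {d d' : ℕ} (ρ₀ : Vec d → Vec d') (ρbar : ℝ) : Prop where
  contDiff : ContDiff ℝ 1 ρ₀
  ρbar_pos : 0 < ρbar
  bound : ∀ x, ‖ρ₀ x‖ ≤ ρbar

/-- `max_j V_j`. -/
def maxV {d : ℕ} (V : Fin nc → Vec d → ℝ) (x : Vec d) : ℝ := ⨆ j, V j x

/-- The level set `{x ∈ X : V = v}`. -/
def levelSet {d : ℕ} (X : Set (Vec d)) (V : Vec d → ℝ) (v : ℝ) : Set (Vec d) :=
  {x | x ∈ X ∧ V x = v}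

/-- The signed distance to the level set `{V = v}`, positive where `V > v`. -/
def signedDist {d : ℕ} (X : Set (Vec d)) (V : Vec d → ℝ) (v : ℝ) (x : Vec d) : ℝ :=
  Real.sign (V x - v) * Metric.infDist x (levelSet X V v)

/-- A line segment in the ambient space, from a point of `X` in the unsafe set `{V_j ≥ v_j}` to
a point of `X` on the boundary `{V_k = v_k}` of another unsafe set, meets `{V_j = v_j}`. This
holds automatically for every segment that is contained in `X`. -/
def SegmentsCross {d : ℕ} (X : Set (Vec d)) (V : Fin nc → Vec d → ℝ) (v : Fin nc → ℝ) : Prop :=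
  ∀ j k, k ≠ j → ∀ x ∈ X, v j ≤ V j x → ∀ y ∈ levelSet X (V k) (v k),
    ∃ z ∈ segment ℝ x y, z ∈ levelSet X (V j) (v j)

/-! ### The safety control law for the first subsystem -/

/-- `u` is a minimizer of `|u - p|²` over `S`. -/
def IsNearest {d : ℕ} (S : Set (Vec d)) (p u : Vec d) : Prop :=
  u ∈ S ∧ IsMinOn (fun w => ‖w - p‖ ^ 2) S u

/-- The minimizer of `|u - p|²` over `S` (a chosen one, if there is any). -/
def nearest {d : ℕ} (S : Set (Vec d)) (p : Vec d) : Vec d :=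
  Classical.epsilon (IsNearest S p)

/-- The safety and reshaping parameters: `α`, the functions `αlo_j`, `αup_j` on `(-a_j, b_j)`
that bound `V_j - v_j` in terms of the signed distance, the decay rate `θ`, the thresholds `c_j`,
the bound `cbar` on the cone constants, the constants `cA` and `kφ`, and the rows `l_i` of the
matrix `A_L`. -/
structure SafetyDesign (nc nl d : ℕ) where
  α : ℝ → ℝ
  αlo : Fin nc → ℝ → ℝ
  αup : Fin nc → ℝ → ℝ
  a : Fin nc → EReal
  b : Fin nc → EReal
  θ : ℝ
  c : Fin nc → ℝ
  cbar : ℝ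
  cA : ℝ
  kφ : ℝ
  l : Fin nl → Vec d

/-- `α_j = α ∘ αup_j⁻¹`. -/
def SafetyDesign.αj {d : ℕ} (D : SafetyDesign nc nl d) (j : Fin nc) (s : ℝ) : ℝ :=
  D.α (Function.invFunOn (D.αup j) (openInterval (D.a j) (D.b j)) s)

/-- `cos (arccos √(1 - cbar²) + arccos cA)`. -/
def SafetyDesign.cAbar {d : ℕ} (D : SafetyDesign nc nl d) : ℝ :=
  Real.cos (Real.arccos √(1 - D.cbar ^ 2) + Real.arccos D.cA)

/-- The conditions on the rows `l_i` of `A_L`: unit vectors, more than `d` in number, every `d` of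
them linearly independent, and every unit vector `u` is a positive combination of those `l_i` with
`l_iᵀ u ≥ cA`, of which there are at least `d`. -/
structure IsReshapingBasis {d : ℕ} (cA : ℝ) (l : Fin nl → Vec d) : Prop where
  cA_pos : 0 < cA
  cA_lt_one : cA < 1
  card_lt : d < nl
  unit : ∀ i, ‖l i‖ = 1
  linearIndependent : ∀ s : Finset (Fin nl), s.card = d →
    LinearIndependent ℝ (fun i : s => l i.val)
  card_le : ∀ u : Vec d, ‖u‖ = 1 → d ≤ {i | cA ≤ ⟪l i, u⟫}.ncard
  posComb : ∀ u : Vec d, ‖u‖ = 1 → ∃ w : Fin nl → ℝ, (∀ i, 0 ≤ w i) ∧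
    (∀ i, ⟪l i, u⟫ < cA → w i = 0) ∧ u = ∑ i, w i • l i

section SafetyLaw

variable (P : Plant m n) (glo δbar : ℝ) (V : Fin nc → Vec (n 1) → ℝ) (v : Fin nc → ℝ)
  (D : SafetyDesign nc nl (n 2)) (ρ₀ : Vec (n 1) → Vec (n 2)) (x : Vec (n 1))

/-- The (transposed) `j`-th row of `A_c(x)`: `(∂V_j/∂x) g_1 / |(∂V_j/∂x) g_1|`. -/
def rowA (j : Fin nc) : Vec (n 2) :=
  ‖ContinuousLinearMap.adjoint (P.g 1) (gradient (V j) x)‖⁻¹ •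
    ContinuousLinearMap.adjoint (P.g 1) (gradient (V j) x)

/-- `[b_c(x)]_j = -α_j (V_j(x) - v_j)`. -/
def entryB (j : Fin nc) : ℝ := -D.αj j (V j x - v j)

/-- The original feasible set `{u : A_c(x) u + (δbar / glo) |u| ≤ b_c(x)}`. -/
def coneSet : Set (Vec (n 2)) :=
  {u | ∀ j, ⟪rowA P V x j, u⟫ + δbar / glo * ‖u‖ ≤ entryB V v D x j}

/-- The feasible set `{u : [A_c(x)]_j u ≤ [b_c(x)]_j / (1 - δbar / glo)}` of the QP problem that
determines the selection of the original feasible set. -/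
def selectionSet : Set (Vec (n 2)) :=
  {u | ∀ j, ⟪rowA P V x j, u⟫ ≤ entryB V v D x j / (1 - δbar / glo)}

/-- The selection `ρ_s(x)`: the minimizer of `|u|²` over `selectionSet`. -/
def selection : Vec (n 2) := nearest (selectionSet P glo δbar V v D x) 0

/-- The `i`-th entry of `b_L(x)`. -/
def entryBL (i : Fin nl) : ℝ :=
  ⟪D.l i, selection P glo δbar V v D x⟫ +
    ⨅ j : Fin nc,
      (max ⟪D.l i, rowA P V x j⟫ D.cAbar *
          ((entryB V v D x j - ⟪rowA P V x j, selection P glo δbar V v D x⟫ -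
              δbar / glo * ‖selection P glo δbar V v D x‖) / (1 + δbar / glo)) +
        max (D.kφ * (D.cAbar - ⟪D.l i, rowA P V x j⟫)) 0)

/-- The reshaped feasible set `{u : A_L u ≤ b_L(x)}`. -/
def reshapedSet : Set (Vec (n 2)) :=
  {u | ∀ i, ⟪D.l i, u⟫ ≤ entryBL P glo δbar V v D x i}

/-- The safety control law `ρ_1`: the minimizer of `|u - ρ₀(x)|²` over the reshaped set. -/
def safetyLaw : Vec (n 2) := nearest (reshapedSet P glo δbar V v D x) (ρ₀ x)

end SafetyLaw

/-- The conditions on the safety and reshaping parameters, for the gain `γ₁₂`. -/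
structure SafetyConditions (glo δbar : ℝ) (fbar₁ γ₁₂ : ℝ → ℝ) {d d' : ℕ} (X : Set (Vec d))
    (V : Fin nc → Vec d → ℝ) (v : Fin nc → ℝ) (D : SafetyDesign nc nl d') : Prop where
  δbar_lt : δbar < glo
  α_class : IsClassKe ⊤ ⊤ D.α
  α_feasible : ∀ s ≤ 0, D.α s + (glo + δbar) / (glo - δbar) * D.α (-s) ≤ 0
  αlo_class : ∀ j, IsClassKe (D.a j) (D.b j) (D.αlo j)
  αup_class : ∀ j, IsClassKe (D.a j) (D.b j) (D.αup j)
  signedDist_mem : ∀ j, ∀ x ∈ X, signedDist X (V j) (v j) x ∈ openInterval (D.a j) (D.b j)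
  αup_tendsto : ∀ j, Tendsto (D.αup j) (comap Real.toEReal (𝓝[<] (D.b j))) atTop
  αlo_le : ∀ j, ∀ x ∈ X, D.αlo j (signedDist X (V j) (v j) x) ≤ V j x - v j
  le_αup : ∀ j, ∀ x ∈ X, V j x - v j ≤ D.αup j (signedDist X (V j) (v j) x)
  /-- `αup_j⁻¹` is defined on `(-v_j, ∞)` -/
  αup_surj : ∀ j, Ioi (-v j) ⊆ D.αup j '' openInterval (D.a j) (D.b j)
  θ_pos : 0 < D.θ
  c_gt : ∀ j, v j < D.c j
  γ₁₂_class : IsClassK γ₁₂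
  αj_ge : ∀ j, ∀ x ∈ X, D.c j ≤ V j x →
    ENNReal.ofReal (D.θ * V j x) +
        ENNReal.ofReal (1 + δbar / glo) * inv γ₁₂ (ENNReal.ofReal (V j x)) +
        ENNReal.ofReal (1 / glo * fbar₁ ‖x‖) ≤
      ENNReal.ofReal (D.αj j ((D.c j - v j) / D.c j * V j x))
  cbar_ge : δbar / glo ≤ D.cbar
  cbar_lt_one : D.cbar < 1
  basis : IsReshapingBasis D.cA D.l
  cA_gt : Real.cos (Real.pi / 2 - Real.arccos √(1 - D.cbar ^ 2)) < D.cA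
  kφ_nonneg : 0 ≤ D.kφ

/-! ### The tracking control laws -/

/-- `ρ_i`, `i ≥ 2`. -/
def trackingLaw (P : Plant m n) (glo δbar : ℝ) (κ : ℕ → ℝ → ℝ) (i : ℕ) (e : Vec (n i)) :
    Vec (n (i + 1)) :=
  open Classical in
  if e = 0 then 0
  else -((glo / (glo - δbar) * κ i ‖e‖) •
    (‖ContinuousLinearMap.adjoint (P.g i) e‖⁻¹ • ContinuousLinearMap.adjoint (P.g i) e))

/-- `k_p k_{p+1} ⋯ k_i`, and `0` if `p > i`. -/
def kbar (k : ℕ → ℝ) (p i : ℕ) : ℝ := if p ≤ i then ∏ j ∈ Finset.Icc p i, k j else 0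

/-- `1 + ∑_{j=p}^{i} kbar_{j,i}`. -/
def kbreve (k : ℕ → ℝ) (p i : ℕ) : ℝ := 1 + ∑ j ∈ Finset.Icc p i, kbar k j i

/-- The tracking parameters: the functions `κ_i`, the constants `k_i` (`k_1` belongs to `ρ_1`), the
constant `cx₁`, the gains `γ_{i,j}` (including `γ_{1,2}`), `γ_{i,x₁}`, `γ_{i,ρ₀}`, and the function
`γ_{x₂*,V}`. -/
structure TrackingDesign where
  κ : ℕ → ℝ → ℝ
  k : ℕ → ℝ
  cx₁ : ℝ
  γ : ℕ → ℕ → ℝ → ℝ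
  γx₁ : ℕ → ℝ → ℝ
  γρ₀ : ℕ → ℝ → ℝ
  γV : ℝ → ℝ

section Tracking

variable (glo ghi δbar : ℝ) (fbar : ℕ → ℝ → ℝ) (T : TrackingDesign)

/-- `α_{i,x₁}`. -/
def gainX₁ (i : ℕ) (s : ℝ) : ℝ := kbreve T.k 1 (i - 1) * s

/-- `α_{i,ρ₀}`. -/
def gainRho₀ (i : ℕ) (s : ℝ) : ℝ :=
  kbreve T.k 2 (i - 1) * fbar 2 (4 * s) + kbar T.k 1 (i - 1) * (ghi + δbar) * s

/-- `α_{i,j}` for `1 ≤ j ≤ i - 1`. -/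
def gain (i j : ℕ) (s : ℝ) : ℝ :=
  if j = 1 then gainRho₀ ghi δbar fbar T i (T.γV s)
  else
    kbreve T.k j (i - 1) * fbar j (2 * s) +
      kbreve T.k j (i - 1) * fbar (j + 1) (2 * glo * T.κ j s / (glo - δbar)) +
      (ghi + δbar) *
        (kbar T.k j (i - 1) * (glo * T.κ j s / (glo - δbar)) + kbar T.k (j - 1) (i - 1) * s)

/-- `α_{i,i}`. -/
def gainDiag (i : ℕ) (s : ℝ) : ℝ := fbar i (2 * s) + T.k (i - 1) * (ghi + δbar) * s

/-- The conditions on the tracking parameters, where `ρ₁` is the first virtual control law,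
`Vmax = max_j V_j` and `θ` is the decay rate. -/
structure TrackingConditions (m : ℕ) {d d' : ℕ} (X : Set (Vec d)) (Vmax : Vec d → ℝ)
    (ρ₁ : Vec d → Vec d') (ρbar θ : ℝ) : Prop where
  γV_class : IsClassK T.γV
  γV_bound : ∀ x ∈ X, ‖ρ₁ x‖ ≤ T.γV (Vmax x) + ρbar
  k₁_pos : 0 < T.k 1
  /-- `k_1` is a (local) Lipschitz constant of `ρ₁` -/
  k₁_lip : ∀ x ∈ X, ∃ U ∈ 𝓝[X] x, ∀ y ∈ U, ∀ z ∈ U, ‖ρ₁ y - ρ₁ z‖ ≤ T.k 1 * ‖y - z‖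
  cx₁_nonneg : 0 ≤ T.cx₁
  fbar₁_le : ∀ x ∈ X, fbar 1 ‖x‖ ≤ T.cx₁
  γ_class : ∀ i ∈ Finset.Icc 2 m, ∀ j ∈ Finset.Icc 1 (i + 1), j ≠ i → IsClassKOrZero (T.γ i j)
  γx₁_class : ∀ i ∈ Finset.Icc 2 m, IsClassKOrZero (T.γx₁ i)
  γρ₀_class : ∀ i ∈ Finset.Icc 2 m, IsClassKOrZero (T.γρ₀ i)
  κ_contDiff : ∀ i ∈ Finset.Icc 2 m, ContDiff ℝ 1 (T.κ i)
  κ_odd : ∀ i ∈ Finset.Icc 2 m, ∀ s, T.κ i (-s) = -T.κ i s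
  κ_strictMono : ∀ i ∈ Finset.Icc 2 m, StrictMono (T.κ i)
  κ_unbounded : ∀ i ∈ Finset.Icc 2 m, Tendsto (T.κ i) atTop atTop
  κ_ge : ∀ i ∈ Finset.Icc 2 m, ∀ s, 0 ≤ s →
    ENNReal.ofReal (θ * s) +
        ENNReal.ofReal ((glo + δbar) / glo) * inv (T.γ i (i + 1)) (ENNReal.ofReal s) +
        ENNReal.ofReal (1 / glo) *
          (compInv (gainX₁ T i) (T.γx₁ i) (ENNReal.ofReal s) +
            compInv (gainRho₀ ghi δbar fbar T i) (T.γρ₀ i) (ENNReal.ofReal s) +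
            ∑ j ∈ Finset.Icc 1 (i - 1),
              compInv (gain glo ghi δbar fbar T i j) (T.γ i j) (ENNReal.ofReal s) +
            ENNReal.ofReal (gainDiag ghi δbar fbar T i s)) ≤
      ENNReal.ofReal (T.κ i s)
  k_ge : ∀ i ∈ Finset.Icc 2 m, ∀ s, 0 < s →
    glo / (glo - δbar) * (ghi / glo * (T.κ i s / s) + deriv (T.κ i) s) ≤ T.k i

/-- The small-gain conditions `γ_{i,j} < id` and `γ_{i,1} < γ_{1,2}⁻¹`, for the gains that occur:
`γ_{1,2}`, and `γ_{i,j}` with `i ≥ 2`, `j ≤ i + 1`, `j ≠ i`. -/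
structure SmallGain (m : ℕ) : Prop where
  γ₁₂_lt : 2 ≤ m → ∀ s, 0 < s → T.γ 1 2 s < s
  γ_lt : ∀ i ∈ Finset.Icc 2 m, ∀ j ∈ Finset.Icc 1 m, j ≠ i → j ≤ i + 1 → ∀ s, 0 < s → T.γ i j s < s
  γ_lt_inv : ∀ i ∈ Finset.Icc 2 m, ∀ s, 0 < s →
    ENNReal.ofReal (T.γ i 1 s) < inv (T.γ 1 2) (ENNReal.ofReal s)

/-- `γ_{1,i} = γ_{1,2} ∘ ⋯ ∘ γ_{i-1,i}` for `i ≥ 2`. -/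
def gammaChain (γ : ℕ → ℕ → ℝ → ℝ) : ℕ → ℝ → ℝ
  | 0 => id
  | 1 => id
  | i + 2 => gammaChain γ (i + 1) ∘ γ (i + 1) (i + 2)

/-- The constant in the bound on `max_j V_j`. -/
def finalC (m : ℕ) (c : Fin nc → ℝ) (ρbar : ℝ) : ℝ≥0∞ :=
  max (Finset.univ.sup fun j => ENNReal.ofReal (c j))
    (max (inv (T.γ 1 2) ((Finset.Icc 2 m).sup fun i => ENNReal.ofReal (T.γx₁ i T.cx₁)))
      (inv (T.γ 1 2) ((Finset.Icc 2 m).sup fun i => ENNReal.ofReal (T.γρ₀ i ρbar))))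

/-- The constant in the bound on `|x_i|`. -/
def finalCi (m : ℕ) (c : Fin nc → ℝ) (ρbar : ℝ) (i : ℕ) : ℝ≥0∞ :=
  max (3 * ext T.γV (finalC T m c ρbar))
    (max (3 * inv (T.γ 1 2) (finalC T m c ρbar))
      (max (3 * ENNReal.ofReal ρbar)
        (2 * (Finset.Icc 3 i).sup fun j =>
          max (ENNReal.ofReal (glo / (glo - δbar)) *
              compInv (T.κ (j - 1)) (gammaChain T.γ (j - 1)) (finalC T m c ρbar))
            (inv (gammaChain T.γ j) (finalC T m c ρbar)))))

end Tracking

/-! ### The closed loop -/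

/-- The virtual control inputs `x*_2 = ρ_1(x_1)`, `x*_{i+1} = ρ_i(x_i - x*_i)` for `i ≥ 2`
(the values at `0` and `1` are not used). -/
def virtualInput (ρ₁ : Vec (n 1) → Vec (n 2)) (ρ : ∀ i, Vec (n i) → Vec (n (i + 1)))
    (x : ∀ i, Vec (n i)) : ∀ i, Vec (n i)
  | 0 => 0
  | 1 => 0
  | 2 => ρ₁ (x 1)
  | i + 3 => ρ (i + 2) (x (i + 2) - virtualInput ρ₁ ρ x (i + 2))

/-- `x` is a Carathéodory solution (in integral form) of the plant in closed loop with
`u = x*_{m+1}` on the interval `I ∋ 0` of nonnegative times; `x_{m+1}` is the input `u`. Since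
`ρ_1` is defined on `X`, a solution has `x_1(t) ∈ X`. -/
structure IsClosedLoopSolution (P : Plant m n) (X : Set (Vec (n 1)))
    (ρ₁ : Vec (n 1) → Vec (n 2)) (ρ : ∀ i, Vec (n i) → Vec (n (i + 1)))
    (I : Set ℝ) (x : ∀ i, ℝ → Vec (n i)) : Prop where
  ordConnected : I.OrdConnected
  zero_mem : 0 ∈ I
  nonneg : I ⊆ Ici 0
  mem : ∀ t ∈ I, x 1 t ∈ X
  input : ∀ t ∈ I, x (m + 1) t = virtualInput ρ₁ ρ (fun i => x i t) (m + 1)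
  integrable : ∀ i ∈ Finset.Icc 1 m, ∀ t ∈ I, IntervalIntegrable
    (fun s => P.f i (trunc (fun k => x k s) i) +
      (P.g i + P.δ i (trunc (fun k => x k s) i)) (x (i + 1) s)) volume 0 t
  eq_integral : ∀ i ∈ Finset.Icc 1 m, ∀ t ∈ I, x i t = x i 0 + ∫ s in (0 : ℝ)..t,
    (P.f i (trunc (fun k => x k s) i) +
      (P.g i + P.δ i (trunc (fun k => x k s) i)) (x (i + 1) s))

/-- `max {V(x_1(0)), |ρ₀(x_1(0))|, |x_2(0)|, …, |x_m(0)|}`. -/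
def initialSize (m : ℕ) (Vmax : Vec (n 1) → ℝ) (ρ₀ : Vec (n 1) → Vec (n 2))
    (x : ∀ i, Vec (n i)) : ℝ :=
  max (max (Vmax (x 1)) ‖ρ₀ (x 1)‖) (((Finset.Icc 2 m).sup fun i => ‖x i‖₊ : ℝ≥0) : ℝ)

/-- The safety control objective with the constants `C` and `Ci`. -/
def SafetyObjective (P : Plant m n) (X : Set (Vec (n 1))) (Vmax : Vec (n 1) → ℝ)
    (ρ₀ ρ₁ : Vec (n 1) → Vec (n 2)) (ρ : ∀ i, Vec (n i) → Vec (n (i + 1)))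
    (C : ℝ≥0∞) (Ci : ℕ → ℝ≥0∞) : Prop :=
  ∃ (β : ℝ → ℝ → ℝ) (βi : ℕ → ℝ → ℝ → ℝ), IsClassKL β ∧
    (∀ i ∈ Finset.Icc 2 m, IsClassKL (βi i)) ∧
    ∀ (I : Set ℝ) (x : ∀ i, ℝ → Vec (n i)), IsClosedLoopSolution P X ρ₁ ρ I x → ∀ t ∈ I,
      x 1 t ∈ X ∧
      ENNReal.ofReal (Vmax (x 1 t)) ≤
        max (ENNReal.ofReal (β (initialSize m Vmax ρ₀ fun i => x i 0) t)) C ∧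
      ∀ i ∈ Finset.Icc 2 m, ENNReal.ofReal ‖x i t‖ ≤
        max (ENNReal.ofReal (βi i (initialSize m Vmax ρ₀ fun i => x i 0) t)) (Ci i)

end CascadeSafety

end

open Set Filter Topology MeasureTheory
open scoped ENNReal NNReal RealInnerProductSpace

noncomputable section

namespace CascadeSafety

variable {m : ℕ} {n : ℕ → ℕ} {nc nl : ℕ}

/-! ### Comparison functions -/

/-! Put y_1 = max_j V_j(x_1) and y_i = |x_i - x*_i| for i ≥ 2 (`errorSize`). The proof is a
small-gain argument in these scalars: each y_i decays at a common exponential rate μ whenever it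
dominates, that is, whenever γ_{i,j}(y_j) ≤ y_i for the relevant j and y_i is at least the constant
C = `finalC`.

Decay of y_1 rests on the geometry of the constraints. At most one V_j exceeds its threshold, and
the corresponding unsafe set is then at least as close as the other level sets, so the condition on
α lets the constraint of that index imply the remaining ones; hence the selection is explicit and
lies in the second-order cone set (`selection_spec`). The polyhedral set built around the selection
stays inside the cone set because every direction near a row a_j is a nonnegative combination of
vectors l_i that are themselves near a_j (`reshapedSet_spec`). The safety law thus satisfies the
robust constraint, which gives `certificate_decrease`.

Decay of y_i for i ≥ 2 needs the speed of the virtual input x*_i, which is merely Lipschitz along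
the trajectory. One-sided speed bounds replace derivatives: they propagate through the cascade with
products of the k_j (`speedLE_virtualInput`), the resulting sums regroup into the functions α_{i,j}
(`disturbance_le`), and κ_i dominates them by design (`tracking_decrease`).

To combine the decays, enlarge each γ_{i,i+1} to a bijection G_i ≤ id and set σ_i = G_1 ∘ ⋯ ∘
G_{i-1} (`chainIso`). Claim: y_i(t) ≤ σ_i⁻¹(max(b(t), C)) for all i. Suppose these bounds hold at
some time and the i-th is an equality. Then G_i(y_{i+1}) ≤ y_i by the definition of σ_{i+1}, while
y_j ≤ σ_j⁻¹(⋯) ≤ y_i for j < i because σ_i ≤ σ_j, so y_i dominates and decays. It remains to choose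
b so that no bound falls faster than e^{-μt}. With Ψ = ∏ σ_i⁻¹, take b(t) = Ψ⁻¹(e^{-μt} Ψ(r)): the
product of the bounds σ_i⁻¹(b) decays exactly at rate μ and all factors decrease, so no single
factor outruns μ (`envelope_factor`). Continuous induction (`le_bound_of_decay`, applied in
`errorSize_le`) proves the claim, and b is a KL function of the initial size. The bounds on |x_i|
follow from |x_i| ≤ y_i + |x*_i|. -/

theorem IsClassK.mono {f : ℝ → ℝ} (hf : IsClassK f) {a b : ℝ} (ha : 0 ≤ a) (hab : a ≤ b) :
    f a ≤ f b :=
  hf.strictMonoOn.monotoneOn ha (ha.trans hab) hab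

theorem IsClassK.nonneg {f : ℝ → ℝ} (hf : IsClassK f) {a : ℝ} (ha : 0 ≤ a) : 0 ≤ f a :=
  hf.map_zero ▸ hf.mono le_rfl ha

theorem IsClassKOrZero.mono {f : ℝ → ℝ} (hf : IsClassKOrZero f) {a b : ℝ} (ha : 0 ≤ a)
    (hab : a ≤ b) : f a ≤ f b := by
  rcases hf with hf | hf
  · exact hf.mono ha hab
  · rw [hf a ha, hf b (ha.trans hab)]

theorem IsClassKOrZero.map_zero {f : ℝ → ℝ} (hf : IsClassKOrZero f) : f 0 = 0 := by
  rcases hf with hf | hf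
  · exact hf.map_zero
  · exact hf 0 le_rfl

theorem IsClassKOrZero.nonneg {f : ℝ → ℝ} (hf : IsClassKOrZero f) {a : ℝ} (ha : 0 ≤ a) :
    0 ≤ f a :=
  hf.map_zero ▸ hf.mono le_rfl ha

theorem IsClassKOrZero.continuousOn {f : ℝ → ℝ} (hf : IsClassKOrZero f) :
    ContinuousOn f (Ici 0) := by
  rcases hf with hf | hf
  · exact hf.continuousOn
  · exact continuousOn_const.congr fun s hs => hf s hs

theorem IsClassKOrZero.le_two_mul {f : ℝ → ℝ} (hf : IsClassKOrZero f) {s a b : ℝ} (hs : 0 ≤ s)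
    (ha : 0 ≤ a) (hb : 0 ≤ b) (h : s ≤ a + b) : f s ≤ f (2 * a) + f (2 * b) := by
  have h1 := hf.nonneg (mul_nonneg zero_le_two ha)
  have h2 := hf.nonneg (mul_nonneg zero_le_two hb)
  rcases le_total a b with hab | hab
  · linarith [hf.mono hs (show s ≤ 2 * b by linarith)]
  · linarith [hf.mono hs (show s ≤ 2 * a by linarith)]

/-- Splitting off `a` first and then separating `b` from `c` yields the factors 2, 4, 4, which are
the ones built into `gainDiag` and `gainRho₀`. -/
theorem IsClassKOrZero.le_four_mul {f : ℝ → ℝ} (hf : IsClassKOrZero f) {s a b c : ℝ} (hs : 0 ≤ s)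
    (ha : 0 ≤ a) (hb : 0 ≤ b) (hc : 0 ≤ c) (h : s ≤ a + b + c) :
    f s ≤ f (2 * a) + (f (4 * b) + f (4 * c)) := by
  have h1 := hf.le_two_mul hs ha (add_nonneg hb hc) (by linarith)
  have h2 := hf.le_two_mul (s := 2 * (b + c)) (a := 2 * b) (b := 2 * c) (by positivity)
    (by positivity) (by positivity) (by linarith)
  rw [show 2 * (2 * b) = 4 * b by ring, show 2 * (2 * c) = 4 * c by ring] at h2
  linarith

theorem IsClassK.add {f g : ℝ → ℝ} (hf : IsClassK f) (hg : IsClassK g) :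
    IsClassK fun s => f s + g s where
  continuousOn := hf.continuousOn.add hg.continuousOn
  strictMonoOn := hf.strictMonoOn.add hg.strictMonoOn
  map_zero := by simp [hf.map_zero, hg.map_zero]

theorem IsClassK.const_mul {f : ℝ → ℝ} (hf : IsClassK f) {c : ℝ} (hc : 0 < c) :
    IsClassK fun s => c * f s where
  continuousOn := continuousOn_const.mul hf.continuousOn
  strictMonoOn := fun _ ha _ hb hab => mul_lt_mul_of_pos_left (hf.strictMonoOn ha hb hab) hc
  map_zero := by simp [hf.map_zero]

theorem isClassK_id : IsClassK fun s => s where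
  continuousOn := continuousOn_id
  strictMonoOn := strictMonoOn_id
  map_zero := rfl

theorem IsClassK.comp {f g : ℝ → ℝ} (hf : IsClassK f) (hg : IsClassK g) :
    IsClassK fun s => f (g s) where
  continuousOn := hf.continuousOn.comp hg.continuousOn fun _ hs => hg.nonneg hs
  strictMonoOn := hf.strictMonoOn.comp hg.strictMonoOn fun _ hs => hg.nonneg hs
  map_zero := by simp [hf.map_zero, hg.map_zero]

theorem orderIso_zero (e : ℝ≥0 ≃o ℝ≥0) : e 0 = 0 := by
  have := e.map_bot
  rwa [bot_eq_zero] at this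

theorem isClassK_orderIso (e : ℝ≥0 ≃o ℝ≥0) : IsClassK fun s => (e s.toNNReal : ℝ) where
  continuousOn := (NNReal.continuous_coe.comp (e.continuous.comp continuous_real_toNNReal)).continuousOn
  strictMonoOn := fun a ha b _ hab => by
    have : a.toNNReal < b.toNNReal :=
      (Real.toNNReal_lt_toNNReal_iff (lt_of_le_of_lt ha hab)).2 hab
    exact_mod_cast e.strictMono this
  map_zero := by simp [orderIso_zero]

theorem IsClassKL.comp_left {h : ℝ → ℝ} {β : ℝ → ℝ → ℝ} (hh : IsClassK h) (hβ : IsClassKL β) :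
    IsClassKL fun s t => h (β s t) where
  continuousOn := hh.continuousOn.comp (f := Function.uncurry β) hβ.continuousOn fun p hp =>
    (hβ.classK p.2 hp.2).nonneg hp.1
  classK := fun t ht => hh.comp (hβ.classK t ht)
  antitoneOn := fun s hs _ ha _ hb hab =>
    hh.mono ((hβ.classK _ hb).nonneg hs.le) (hβ.antitoneOn s hs ha hb hab)
  tendsto_zero := fun s hs => by
    have h1 : Tendsto (β s) atTop (𝓝[Ici 0] 0) :=
      tendsto_nhdsWithin_iff.2 ⟨hβ.tendsto_zero s hs, by
        filter_upwards [eventually_ge_atTop 0] with t ht using (hβ.classK t ht).nonneg hs.le⟩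
    have h2 := hh.continuousOn 0 self_mem_Ici
    rw [ContinuousWithinAt, hh.map_zero] at h2
    exact h2.comp h1

/-! ### Generalized inverses with values in [0, ∞] -/

theorem le_compInv {h γ : ℝ → ℝ} {s a : ℝ} (ha : 0 ≤ a) (h1 : γ a ≤ s) :
    ENNReal.ofReal (h a) ≤ compInv h γ (ENNReal.ofReal s) :=
  le_iSup₂_of_le a ha (le_iSup_of_le (ENNReal.ofReal_le_ofReal h1) le_rfl)

theorem compInv_mono (h γ : ℝ → ℝ) {s s' : ℝ≥0∞} (hs : s ≤ s') :
    compInv h γ s ≤ compInv h γ s' :=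
  iSup₂_mono fun _ _ => iSup_mono' fun h1 => ⟨h1.trans hs, le_rfl⟩

/-- An unbounded gain has bounded sublevel sets, and `h` is monotone, so the supremum is at most the
value of `h` at a bound for the sublevel set. -/
theorem compInv_lt_top {h γ : ℝ → ℝ} (hh : MonotoneOn h (Ici 0)) (hγ : Tendsto γ atTop atTop)
    {s : ℝ≥0∞} (hs : s < ⊤) : compInv h γ s < ⊤ := by
  obtain ⟨A, hA⟩ := (hγ.eventually (eventually_gt_atTop s.toReal)).exists_forall_of_atTop
  refine lt_of_le_of_lt (iSup₂_le fun a ha => iSup_le fun h1 => ?_)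
    (ENNReal.ofReal_lt_top (r := h (max A 0)))
  refine ENNReal.ofReal_le_ofReal (hh ha (le_max_right A 0) ?_)
  by_contra hcon
  have h2 := hA a ((le_max_left A 0).trans (not_le.1 hcon).le)
  have h3 := (ENNReal.ofReal_le_iff_le_toReal hs.ne).1 h1
  linarith

theorem inv_top (γ : ℝ → ℝ) : inv γ ⊤ = ⊤ := by
  refine ENNReal.eq_top_of_forall_nnreal_le fun r => ?_
  refine le_iSup₂_of_le (r : ℝ) r.2 (le_iSup_of_le le_top ?_)
  simp

/-- A gain is unbounded if its inverse is finite. -/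
theorem tendsto_atTop_of_inv_lt_top {γ : ℝ → ℝ}
    (h : ∀ s : ℝ, 0 ≤ s → inv γ (ENNReal.ofReal s) < ⊤) : Tendsto γ atTop atTop := by
  refine Filter.tendsto_atTop.2 fun b => ?_
  have h1 := h (max b 0) (le_max_right _ _)
  filter_upwards [eventually_gt_atTop (inv γ (ENNReal.ofReal (max b 0))).toReal,
    eventually_ge_atTop 0] with a ha ha0
  by_contra hcon
  have h2 : ENNReal.ofReal a ≤ inv γ (ENNReal.ofReal (max b 0)) :=
    le_compInv (h := fun a => a) ha0 ((not_le.1 hcon).le.trans (le_max_left _ _))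
  have h3 := (ENNReal.ofReal_le_iff_le_toReal h1.ne).1 h2
  linarith

/-! ### Envelopes -/

theorem exists_orderIso {f : ℝ≥0 → ℝ≥0} (h0 : f 0 = 0) (hf : StrictMono f) (hc : Continuous f)
    (ht : Tendsto f atTop atTop) : ∃ e : ℝ≥0 ≃o ℝ≥0, ∀ s, e s = f s :=
  ⟨hf.orderIsoOfSurjective f fun b => mem_range_of_exists_le_of_exists_ge hc
    ⟨0, h0.le.trans zero_le⟩ (ht.eventually (eventually_ge_atTop b)).exists, fun _ => rfl⟩

/-- A gain below the identity is dominated by an unbounded one. -/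
theorem exists_orderIso_gain {γ : ℝ → ℝ} (hγ : IsClassKOrZero γ) (hlt : ∀ s, 0 < s → γ s < s) :
    ∃ e : ℝ≥0 ≃o ℝ≥0, (∀ s, e s ≤ s) ∧ ∀ s : ℝ≥0, γ s ≤ e s := by
  -- The half-identity makes the gain strictly increasing and unbounded even if γ is zero or
  -- bounded; since γ lies below the identity, the maximum does too.
  have hγ' : StrictMono fun s : ℝ≥0 => max (γ s).toNNReal (s / 2) := by
    intro a b hab
    have h2 : a / 2 < b / 2 := by
      rw [← NNReal.coe_lt_coe] at hab ⊢; push_cast; linarith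
    refine max_lt ?_ (lt_max_of_lt_right h2)
    rcases hγ with hγ | hγ
    · have hb := hγ.strictMonoOn a.2 b.2 hab
      exact lt_max_of_lt_left
        ((Real.toNNReal_lt_toNNReal_iff (lt_of_le_of_lt (hγ.nonneg a.2) hb)).2 hb)
    · rw [hγ a a.2, Real.toNNReal_zero]
      exact lt_max_of_lt_right (lt_of_le_of_lt zero_le h2)
  have hc : Continuous fun s : ℝ≥0 => max (γ s).toNNReal (s / 2) :=
    (continuous_real_toNNReal.comp (hγ.continuousOn.comp_continuous NNReal.continuous_coe
      fun s => s.2)).max (continuous_id.div_const 2)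
  have ht : Tendsto (fun s : ℝ≥0 => max (γ s).toNNReal (s / 2)) atTop atTop := by
    refine tendsto_atTop.2 fun b => ?_
    filter_upwards [eventually_ge_atTop (b * 2)] with s hs
    exact le_max_of_le_right ((le_div_iff₀ (by norm_num)).2 hs)
  obtain ⟨e, he⟩ := exists_orderIso (by simp [hγ.map_zero]) hγ' hc ht
  refine ⟨e, fun s => ?_, fun s => ?_⟩
  · rw [he]
    refine max_le (Real.toNNReal_le_iff_le_coe.2 ?_) (NNReal.half_le_self s)
    rcases eq_or_ne s 0 with rfl | hs
    · simp [hγ.map_zero]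
    · exact (hlt s (by exact_mod_cast pos_of_ne_zero hs)).le
  · rw [he]
    exact (Real.le_coe_toNNReal _).trans (by exact_mod_cast le_max_left _ _)

/-- `G_1 ∘ ⋯ ∘ G_{i-1}`. -/
def chainIso (G : ℕ → ℝ≥0 ≃o ℝ≥0) : ℕ → ℝ≥0 ≃o ℝ≥0
  | 0 => OrderIso.refl _
  | 1 => OrderIso.refl _
  | i + 2 => (G (i + 1)).trans (chainIso G (i + 1))

theorem chainIso_succ (G : ℕ → ℝ≥0 ≃o ℝ≥0) {i : ℕ} (hi : 1 ≤ i) (s : ℝ≥0) :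
    chainIso G (i + 1) s = chainIso G i (G i s) := by
  obtain ⟨k, rfl⟩ := Nat.exists_eq_add_of_le' hi
  rfl

theorem chainIso_antitone {G : ℕ → ℝ≥0 ≃o ℝ≥0} (hG : ∀ i s, G i s ≤ s) (s : ℝ≥0) {i j : ℕ}
    (hij : i ≤ j) : chainIso G j s ≤ chainIso G i s := by
  refine antitone_nat_of_succ_le (f := fun i => chainIso G i s) (fun i => ?_) hij
  rcases Nat.eq_zero_or_pos i with rfl | hi
  · exact le_rfl
  · rw [chainIso_succ G hi]
    exact (chainIso G i).monotone (hG i s)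

theorem chainIso_le {G : ℕ → ℝ≥0 ≃o ℝ≥0} (hG : ∀ i s, G i s ≤ s) (i : ℕ) (s : ℝ≥0) :
    chainIso G i s ≤ s :=
  chainIso_antitone hG s (Nat.zero_le i)

/-- The product of the inverses is the quantity that will be made to decay exactly exponentially. It
is a bijection of [0, ∞) because every factor is one and is at least `b`. -/
theorem exists_gauge (m : ℕ) (hm : 1 ≤ m) (σ : ℕ → ℝ≥0 ≃o ℝ≥0) (hσ : ∀ i s, σ i s ≤ s) :
    ∃ Ψ : ℝ≥0 ≃o ℝ≥0, ∀ b, Ψ b = ∏ i ∈ Finset.Icc 1 m, (σ i).symm b := by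
  have hle : ∀ i b, b ≤ (σ i).symm b := fun i b => by
    simpa using hσ i ((σ i).symm b)
  have hne : (Finset.Icc 1 m).Nonempty := ⟨1, by simp [hm]⟩
  refine exists_orderIso ?_ ?_ ?_ ?_
  · exact Finset.prod_eq_zero (i := 1) (by simp [hm]) (orderIso_zero _)
  · intro a b hab
    rcases eq_or_ne a 0 with rfl | ha
    · refine lt_of_eq_of_lt (Finset.prod_eq_zero (i := 1) (by simp [hm]) (orderIso_zero _))
        (Finset.prod_pos fun i _ => lt_of_lt_of_le hab (hle i b))
    · exact Finset.prod_lt_prod_of_nonempty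
        (fun i _ => lt_of_lt_of_le (pos_of_ne_zero ha) (hle i a))
        (fun i _ => (σ i).symm.strictMono hab) hne
  · exact continuous_finsetProd _ fun i _ => (σ i).symm.continuous
  · refine tendsto_atTop.2 fun b => ?_
    filter_upwards [eventually_ge_atTop b, eventually_ge_atTop 1] with s hs hs1
    calc b ≤ s ^ 1 := by simpa using hs
      _ ≤ s ^ (Finset.Icc 1 m).card := pow_le_pow_right₀ hs1 hne.card_pos
      _ = ∏ i ∈ Finset.Icc 1 m, s := by simp
      _ ≤ _ := Finset.prod_le_prod' fun i _ => hle i s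

/-- The envelope that starts at `r` and decreases so that `Ψ` decays at the rate `μ`. -/
def envelope (Ψ : ℝ≥0 ≃o ℝ≥0) (μ : ℝ) (r : ℝ≥0) (t : ℝ) : ℝ≥0 :=
  Ψ.symm ((Real.exp (-(μ * t))).toNNReal * Ψ r)

theorem envelope_zero (Ψ : ℝ≥0 ≃o ℝ≥0) (μ : ℝ) (r : ℝ≥0) : envelope Ψ μ r 0 = r := by
  simp [envelope]

theorem continuous_envelope (Ψ : ℝ≥0 ≃o ℝ≥0) (μ : ℝ) :
    Continuous fun p : ℝ≥0 × ℝ => envelope Ψ μ p.1 p.2 := by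
  have h1 := Ψ.continuous
  have h2 := Ψ.symm.continuous
  unfold envelope
  refine h2.comp ((continuous_real_toNNReal.comp (by fun_prop)).mul (h1.comp continuous_fst))

theorem envelope_anti (Ψ : ℝ≥0 ≃o ℝ≥0) {μ : ℝ} (hμ : 0 ≤ μ) (r : ℝ≥0) :
    Antitone (envelope Ψ μ r) := fun t t' htt => by
  refine Ψ.symm.monotone (mul_le_mul_left (Real.toNNReal_mono (Real.exp_le_exp.2 ?_)) _)
  nlinarith

theorem envelope_strictMono (Ψ : ℝ≥0 ≃o ℝ≥0) (μ t : ℝ) :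
    StrictMono fun r => envelope Ψ μ r t := fun _ _ h =>
  Ψ.symm.strictMono (mul_lt_mul_of_pos_left (Ψ.strictMono h) (Real.toNNReal_pos.2 (Real.exp_pos _)))

theorem tendsto_envelope (Ψ : ℝ≥0 ≃o ℝ≥0) {μ : ℝ} (hμ : 0 < μ) (r : ℝ≥0) :
    Tendsto (envelope Ψ μ r) atTop (𝓝 0) := by
  have h1 : Tendsto (fun t : ℝ => Real.exp (-(μ * t))) atTop (𝓝 0) :=
    Real.tendsto_exp_neg_atTop_nhds_zero.comp (tendsto_id.const_mul_atTop hμ)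
  have h2 : Tendsto (fun t : ℝ => (Real.exp (-(μ * t))).toNNReal * Ψ r) atTop (𝓝 (0 * Ψ r)) := by
    have := (continuous_real_toNNReal.tendsto 0).comp h1
    rw [Real.toNNReal_zero] at this
    exact this.mul_const _
  have h3 := (Ψ.symm.continuous.tendsto _).comp h2
  rwa [zero_mul, orderIso_zero] at h3

theorem envelope_apply_zero (Ψ : ℝ≥0 ≃o ℝ≥0) (μ t : ℝ) : envelope Ψ μ 0 t = 0 := by
  simp [envelope, orderIso_zero]

theorem isClassKL_envelope (Ψ : ℝ≥0 ≃o ℝ≥0) {μ : ℝ} (hμ : 0 < μ) {R : ℝ → ℝ} (hR : IsClassK R) :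
    IsClassKL fun s t => (envelope Ψ μ (R s).toNNReal t : ℝ) := by
  have hcR : ContinuousOn (fun s => (R s).toNNReal) (Ici 0) :=
    continuous_real_toNNReal.comp_continuousOn hR.continuousOn
  refine ⟨?_, fun t _ => ⟨?_, fun a ha b hb hab => ?_, ?_⟩, fun s _ a _ b _ hab => ?_, fun s _ => ?_⟩
  · have h1 : ContinuousOn (fun p : ℝ × ℝ => ((R p.1).toNNReal, p.2)) (Ici 0 ×ˢ Ici 0) :=
      (hcR.comp continuousOn_fst fun p hp => hp.1).prodMk continuousOn_snd
    have h2 : Continuous fun p : ℝ≥0 × ℝ => (envelope Ψ μ p.1 p.2 : ℝ) :=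
      NNReal.continuous_coe.comp (continuous_envelope Ψ μ)
    have h3 := h2.comp_continuousOn h1
    simp only [Function.comp_def] at h3
    simpa only [Function.uncurry_def] using h3
  · have h1 : Continuous fun r => (envelope Ψ μ r t : ℝ) :=
      NNReal.continuous_coe.comp
        ((continuous_envelope Ψ μ).comp (continuous_id.prodMk continuous_const))
    exact h1.comp_continuousOn hcR
  · have h1 := hR.strictMonoOn ha hb hab
    have h2 := (Real.toNNReal_lt_toNNReal_iff (lt_of_le_of_lt (hR.nonneg ha) h1)).2 h1
    exact NNReal.coe_lt_coe.2 (envelope_strictMono Ψ μ t h2)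
  · simp only [hR.map_zero, Real.toNNReal_zero, envelope_apply_zero, NNReal.coe_zero]
  · exact NNReal.coe_le_coe.2 (envelope_anti Ψ hμ.le _ hab)
  · have h1 := (NNReal.continuous_coe.tendsto _).comp (tendsto_envelope Ψ hμ (R s).toNNReal)
    rwa [NNReal.coe_zero] at h1

/-- Ψ of the envelope shrinks between the two times by exactly the exponential factor. All factors
of Ψ are nonincreasing in time, so the decrease of one of them cannot exceed that of the product. -/
theorem envelope_factor {m : ℕ} {σ : ℕ → ℝ≥0 ≃o ℝ≥0} {Ψ : ℝ≥0 ≃o ℝ≥0}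
    (hΨ : ∀ b, Ψ b = ∏ i ∈ Finset.Icc 1 m, (σ i).symm b) {μ : ℝ} (hμ : 0 ≤ μ) (r : ℝ≥0)
    {t t' : ℝ} (htt : t ≤ t') {i : ℕ} (hi : i ∈ Finset.Icc 1 m) :
    (Real.exp (-(μ * (t' - t)))).toNNReal * (σ i).symm (envelope Ψ μ r t) ≤
      (σ i).symm (envelope Ψ μ r t') := by
  set b := envelope Ψ μ r t with hb
  set b' := envelope Ψ μ r t' with hb'
  set q := (Real.exp (-(μ * (t' - t)))).toNNReal with hq
  have hbb : b' ≤ b := envelope_anti Ψ hμ r htt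
  have h1 : Ψ b' = q * Ψ b := by
    rw [hb, hb', hq, envelope, envelope, OrderIso.apply_symm_apply, OrderIso.apply_symm_apply,
      ← mul_assoc, ← Real.toNNReal_mul (Real.exp_pos _).le, ← Real.exp_add]
    congr 3
    ring
  rw [hΨ, hΨ, ← Finset.mul_prod_erase _ _ hi, ← Finset.mul_prod_erase _ _ hi] at h1
  rcases eq_or_ne b 0 with h0 | h0
  · simp [h0, orderIso_zero]
  have hpos : 0 < ∏ k ∈ (Finset.Icc 1 m).erase i, (σ k).symm b :=
    Finset.prod_pos fun k _ => by
      have := (σ k).symm.strictMono (pos_of_ne_zero h0)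
      simpa [orderIso_zero] using this
  have h2 : ∏ k ∈ (Finset.Icc 1 m).erase i, (σ k).symm b' ≤
      ∏ k ∈ (Finset.Icc 1 m).erase i, (σ k).symm b :=
    Finset.prod_le_prod' fun k _ => (σ k).symm.monotone hbb
  refine le_of_mul_le_mul_right ?_ hpos
  rw [mul_assoc, ← h1]
  exact mul_le_mul_right h2 _

/-- Continuous functions that decay at the rate `μ` whenever they meet their bounds, which decay
at most at that rate, stay below these bounds. -/
theorem le_bound_of_decay {s : Finset ℕ} {y M : ℕ → ℝ → ℝ} {μ τ : ℝ}
    (hy : ∀ i ∈ s, ContinuousOn (y i) (Icc 0 τ)) (hM : ∀ i ∈ s, Continuous (M i))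
    (hdec : ∀ i ∈ s, ∀ t t', t ≤ t' → Real.exp (-(μ * (t' - t))) * M i t ≤ M i t')
    (h0 : ∀ i ∈ s, y i 0 ≤ M i 0)
    (hstep : ∀ t ∈ Ico 0 τ, (∀ j ∈ s, y j t ≤ M j t) → ∀ i ∈ s, y i t = M i t →
      ∀ᶠ t' in 𝓝[>] t, y i t' ≤ Real.exp (-(μ * (t' - t))) * y i t) :
    ∀ t ∈ Icc 0 τ, ∀ i ∈ s, y i t ≤ M i t := by
  suffices Icc 0 τ ⊆ {t | ∀ i ∈ s, y i t ≤ M i t} from this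
  -- Continuous induction: the set of good times is closed, contains 0, and extends to the right of
  -- each of its points.
  refine IsClosed.Icc_subset_of_forall_mem_nhdsWithin ?_ h0 ?_
  · have : {t | ∀ i ∈ s, y i t ≤ M i t} ∩ Icc 0 τ =
        Icc 0 τ ∩ ⋂ i ∈ s, {t | t ∈ Icc 0 τ ∧ y i t ≤ M i t} := by
      ext t; simp only [mem_inter_iff, mem_ofPred_eq, mem_iInter]
      exact ⟨fun h => ⟨h.2, fun i hi => ⟨h.2, h.1 i hi⟩⟩, fun h => ⟨fun i hi => (h.2 i hi).2, h.1⟩⟩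
    rw [this]
    refine isClosed_Icc.inter (isClosed_biInter fun i hi => ?_)
    exact isClosed_Icc.isClosed_le (hy i hi) (hM i hi).continuousOn
  · rintro t ⟨ht, htI⟩
    have hev : ∀ i ∈ s, ∀ᶠ t' in 𝓝[>] t, y i t' ≤ M i t' := by
      intro i hi
      -- On contact, the decay of `y i` is compared with the slower decay of `M i`; without contact,
      -- continuity suffices.
      rcases eq_or_lt_of_le (ht i hi) with heq | hlt
      · filter_upwards [hstep t htI ht i hi heq, self_mem_nhdsWithin] with t' h1 h2
        exact h1.trans (heq ▸ hdec i hi t t' (le_of_lt h2))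
      · have h1 : ContinuousWithinAt (y i) (Ioi t) t :=
          ((hy i hi).continuousWithinAt ⟨htI.1, htI.2.le⟩).mono_of_mem_nhdsWithin
            (mem_of_superset (Ioo_mem_nhdsGT htI.2)
              fun u hu => ⟨htI.1.trans hu.1.le, hu.2.le⟩)
        have h2 := h1.eventually_lt (hM i hi).continuousAt.continuousWithinAt hlt
        filter_upwards [h2] with t' h using h.le
    exact (Finset.eventually_all s).2 hev

/-! ### Projections onto convex sets -/

theorem isNearest_iff {d : ℕ} {S : Set (Vec d)} (hS : Convex ℝ S) (p u : Vec d) :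
    IsNearest S p u ↔ u ∈ S ∧ ∀ w ∈ S, ⟪p - u, w - u⟫ ≤ 0 := by
  refine and_congr_right fun hu => ?_
  rw [← norm_eq_iInf_iff_real_inner_le_zero hS hu]
  have : Nonempty S := ⟨⟨u, hu⟩⟩
  have hbdd : BddBelow (range fun w : S => ‖p - w‖) :=
    ⟨0, forall_mem_range.2 fun _ => norm_nonneg _⟩
  constructor
  · intro h
    refine le_antisymm (le_ciInf fun w => ?_) (ciInf_le hbdd ⟨u, hu⟩)
    have h1 : ‖u - p‖ ^ 2 ≤ ‖(w : Vec d) - p‖ ^ 2 := h w.2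
    rw [norm_sub_rev p, norm_sub_rev p]
    exact (pow_le_pow_iff_left₀ (norm_nonneg _) (norm_nonneg _) two_ne_zero).1 h1
  · intro h w hw
    have h1 : ‖p - u‖ ≤ ‖p - w‖ := h.le.trans (ciInf_le hbdd ⟨w, hw⟩)
    rw [norm_sub_rev p, norm_sub_rev p] at h1
    exact pow_le_pow_left₀ (norm_nonneg _) h1 2

theorem IsNearest.unique {d : ℕ} {S : Set (Vec d)} (hS : Convex ℝ S) {p u w : Vec d}
    (hu : IsNearest S p u) (hw : IsNearest S p w) : u = w := by
  rw [isNearest_iff hS] at hu hw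
  have h1 := hu.2 w hw.1
  have h2 := hw.2 u hu.1
  have h3 : ⟪w - u, w - u⟫ ≤ 0 := by
    have : ⟪w - u, w - u⟫ = ⟪p - u, w - u⟫ + ⟪p - w, u - w⟫ := by
      simp only [inner_sub_left, inner_sub_right]; ring
    linarith
  rw [real_inner_self_eq_norm_sq] at h3
  exact (sub_eq_zero.1 (norm_eq_zero.1 (pow_eq_zero_iff two_ne_zero |>.1
    (le_antisymm h3 (sq_nonneg _))))).symm

theorem existsUnique_isNearest {d : ℕ} {S : Set (Vec d)} (hS : Convex ℝ S) (hc : IsClosed S)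
    (hne : S.Nonempty) (p : Vec d) : ∃! u, IsNearest S p u := by
  obtain ⟨u, hu, h⟩ := exists_norm_eq_iInf_of_complete_convex hne hc.isComplete hS p
  have h1 : IsNearest S p u :=
    (isNearest_iff hS p u).2 ⟨hu, (norm_eq_iInf_iff_real_inner_le_zero hS hu).1 h⟩
  exact ⟨u, h1, fun w hw => IsNearest.unique hS hw h1⟩

theorem isNearest_nearest {d : ℕ} {S : Set (Vec d)} {p : Vec d} (h : ∃ u, IsNearest S p u) :
    IsNearest S p (nearest S p) :=
  Classical.epsilon_spec h

/-- The hypothesis says that `u` lies in the ball with diameter from `p` to `s` (Thales). With `u`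
the projection of `p` and `s` any feasible point, it bounds the safety law by the nominal controller
and the selection. -/
theorem norm_le_of_inner_nonpos {d : ℕ} {p u s : Vec d} (h : ⟪p - u, s - u⟫ ≤ 0) :
    ‖u‖ ≤ ‖p‖ + ‖s‖ := by
  have h1 : ‖(2 : ℝ) • u - (p + s)‖ ≤ ‖p - s‖ := by
    refine le_of_sq_le_sq ?_ (norm_nonneg _)
    have : ‖(2 : ℝ) • u - (p + s)‖ ^ 2 = ‖p - s‖ ^ 2 + 4 * ⟪p - u, s - u⟫ := by
      rw [show (2 : ℝ) • u - (p + s) = -((p - u) + (s - u)) by rw [two_smul]; abel,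
        show p - s = (p - u) - (s - u) by abel, norm_neg]
      linarith [norm_add_sq_real (p - u) (s - u), norm_sub_sq_real (p - u) (s - u)]
    linarith
  have h2 : ‖(2 : ℝ) • u‖ ≤ ‖(2 : ℝ) • u - (p + s)‖ + ‖p + s‖ := by
    simpa using norm_add_le ((2 : ℝ) • u - (p + s)) (p + s)
  rw [norm_smul, Real.norm_ofNat] at h2
  linarith [norm_add_le p s, norm_sub_le p s]

theorem convex_halfspaces {d : ℕ} {ι : Type*} (a : ι → Vec d) (c : ι → ℝ) :
    Convex ℝ {u : Vec d | ∀ i, ⟪a i, u⟫ ≤ c i} := by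
  intro u hu w hw p q hp hq hpq i
  rw [inner_add_right, inner_smul_right, inner_smul_right]
  have h1 := mul_le_mul_of_nonneg_left (hu i) hp
  have h2 := mul_le_mul_of_nonneg_left (hw i) hq
  have h3 : p * c i + q * c i = c i := by rw [← add_mul, hpq, one_mul]
  linarith

theorem isClosed_halfspaces {d : ℕ} {ι : Type*} (a : ι → Vec d) (c : ι → ℝ) :
    IsClosed {u : Vec d | ∀ i, ⟪a i, u⟫ ≤ c i} := by
  have : {u : Vec d | ∀ i, ⟪a i, u⟫ ≤ c i} = ⋂ i, {u | ⟪a i, u⟫ ≤ c i} := by ext; simp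
  rw [this]
  exact isClosed_iInter fun i => isClosed_le (by fun_prop) continuous_const

/-! ### Bounds on the plant -/

/-- The infimum of the Rayleigh quotient of g_i g_iᵀ is an eigenvalue, and that quotient at `e` is
|g_iᵀ e|² / |e|². -/
theorem PlantBounds.le_norm_adjoint {P : Plant m n} {glo ghi δbar : ℝ} {fbar : ℕ → ℝ → ℝ}
    (hP : PlantBounds P glo ghi δbar fbar) {i : ℕ} (hi : i ∈ Finset.Icc 1 m) (e : Vec (n i)) :
    glo * ‖e‖ ≤ ‖ContinuousLinearMap.adjoint (P.g i) e‖ := by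
  rcases eq_or_ne e 0 with rfl | he
  · simp
  have : Nontrivial (Vec (n i)) := ⟨e, 0, he⟩
  set T : Vec (n i) →L[ℝ] Vec (n i) := P.g i ∘L ContinuousLinearMap.adjoint (P.g i) with hT
  have hin : ∀ x : Vec (n i), ⟪T x, x⟫ = ‖ContinuousLinearMap.adjoint (P.g i) x‖ ^ 2 := by
    intro x
    rw [hT, ContinuousLinearMap.comp_apply, ← ContinuousLinearMap.adjoint_inner_right,
      real_inner_self_eq_norm_sq]
  have hsym : (T : Vec (n i) →ₗ[ℝ] Vec (n i)).IsSymmetric := by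
    intro x y
    simp only [ContinuousLinearMap.coe_coe, hT, ContinuousLinearMap.comp_apply]
    rw [← ContinuousLinearMap.adjoint_inner_right, ContinuousLinearMap.adjoint_inner_left]
  have h1 := hP.le_g i hi _ hsym.hasEigenvalue_iInf_of_finiteDimensional
  set μ : ℝ := ⨅ x : { x : Vec (n i) // x ≠ 0 },
    RCLike.re ⟪(T : Vec (n i) →ₗ[ℝ] Vec (n i)) x, (x : Vec (n i))⟫ / ‖(x : Vec (n i))‖ ^ 2 with hμ
  have hpos : ∀ x : { x : Vec (n i) // x ≠ 0 }, 0 ≤ RCLike.re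
      ⟪(T : Vec (n i) →ₗ[ℝ] Vec (n i)) x, (x : Vec (n i))⟫ / ‖(x : Vec (n i))‖ ^ 2 := by
    intro x
    have := hin x
    simp only [ContinuousLinearMap.coe_coe, RCLike.re_to_real]
    rw [this]; positivity
  have h2 : μ ≤ ‖ContinuousLinearMap.adjoint (P.g i) e‖ ^ 2 / ‖e‖ ^ 2 := by
    have := ciInf_le (f := fun x : { x : Vec (n i) // x ≠ 0 } => RCLike.re
      ⟪(T : Vec (n i) →ₗ[ℝ] Vec (n i)) x, (x : Vec (n i))⟫ / ‖(x : Vec (n i))‖ ^ 2)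
      ⟨0, forall_mem_range.2 hpos⟩ ⟨e, he⟩
    simp only [ContinuousLinearMap.coe_coe, RCLike.re_to_real] at this
    rwa [hin] at this
  have h3 : glo ≤ ‖ContinuousLinearMap.adjoint (P.g i) e‖ / ‖e‖ := by
    refine h1.trans ((Real.sqrt_le_sqrt h2).trans_eq ?_)
    rw [← div_pow, Real.sqrt_sq (by positivity)]
  rwa [le_div_iff₀ (norm_pos_iff.2 he)] at h3

theorem PlantBounds.norm_adjoint_le {P : Plant m n} {glo ghi δbar : ℝ} {fbar : ℕ → ℝ → ℝ}
    (hP : PlantBounds P glo ghi δbar fbar) {i : ℕ} (hi : i ∈ Finset.Icc 1 m) (e : Vec (n i)) :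
    ‖ContinuousLinearMap.adjoint (P.g i) e‖ ≤ ghi * ‖e‖ := by
  refine (ContinuousLinearMap.le_opNorm _ _).trans ?_
  rw [LinearIsometryEquiv.norm_map]
  exact mul_le_mul_of_nonneg_right (hP.g_le i hi) (norm_nonneg e)

/-! ### The certificates -/

section Certificates

variable {X : Set (Vec (n 1))} {V : Fin nc → Vec (n 1) → ℝ} {v : Fin nc → ℝ} {η : ℝ}

theorem CertificateAssumption.differentiableAt (hV : CertificateAssumption X V v η) (j : Fin nc)
    {x : Vec (n 1)} (hx : x ∈ X) : DifferentiableAt ℝ (V j) x :=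
  ((hV.contDiffOn j).contDiffAt (hV.X_open.mem_nhds hx)).differentiableAt one_ne_zero

/-- A zero of a nonnegative function on an open set is a local minimum, where the gradient would
vanish. Strict positivity places V_j - v_j in the domain (-v_j, ∞) of α_j. -/
theorem CertificateAssumption.pos (hV : CertificateAssumption X V v η) (j : Fin nc)
    {x : Vec (n 1)} (hx : x ∈ X) : 0 < V j x := by
  refine lt_of_le_of_ne (hV.V_nonneg j x hx) fun h => hV.grad_ne_zero j x hx ?_
  have h1 : IsLocalMin (V j) x := by
    filter_upwards [hV.X_open.mem_nhds hx] with y hy using h ▸ hV.V_nonneg j y hy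
  rw [gradient, h1.fderiv_eq_zero, map_zero]

theorem le_maxV (V : Fin nc → Vec (n 1) → ℝ) (x : Vec (n 1)) (j : Fin nc) : V j x ≤ maxV V x :=
  le_ciSup (f := fun j => V j x) (finite_range _).bddAbove j

theorem maxV_le (hnc : 1 ≤ nc) {V : Fin nc → Vec (n 1) → ℝ} {x : Vec (n 1)} {c : ℝ}
    (h : ∀ j, V j x ≤ c) : maxV V x ≤ c := by
  have : Nonempty (Fin nc) := ⟨⟨0, hnc⟩⟩
  exact ciSup_le h

theorem continuousOn_maxV (hnc : 1 ≤ nc) (hV : CertificateAssumption X V v η) :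
    ContinuousOn (maxV V) X := by
  have : Nonempty (Fin nc) := ⟨⟨0, hnc⟩⟩
  have h1 : ContinuousOn (fun x => Finset.univ.sup' Finset.univ_nonempty fun j => V j x) X :=
    ContinuousOn.finset_sup'_apply _ fun j _ => (hV.contDiffOn j).continuousOn
  refine h1.congr fun x _ => ?_
  exact (Finset.sup'_univ_eq_ciSup fun j => V j x).symm

end Certificates

/-! ### The functions `α_j` -/

section Safety

variable {glo ghi δbar : ℝ} {fbar : ℕ → ℝ → ℝ} {fbar₁ γ₁₂ : ℝ → ℝ}

section Alpha

variable {d d' : ℕ} {X : Set (Vec d)} {V : Fin nc → Vec d → ℝ} {v : Fin nc → ℝ}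
  {D : SafetyDesign nc nl d'}

theorem SafetyConditions.invFunOn_mem (hD : SafetyConditions glo δbar fbar₁ γ₁₂ X V v D)
    (j : Fin nc) {s : ℝ} (hs : -v j < s) :
    Function.invFunOn (D.αup j) (openInterval (D.a j) (D.b j)) s ∈ openInterval (D.a j) (D.b j) :=
  Function.invFunOn_mem (hD.αup_surj j hs)

theorem SafetyConditions.apply_invFunOn (hD : SafetyConditions glo δbar fbar₁ γ₁₂ X V v D)
    (j : Fin nc) {s : ℝ} (hs : -v j < s) :
    D.αup j (Function.invFunOn (D.αup j) (openInterval (D.a j) (D.b j)) s) = s :=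
  Function.invFunOn_eq (hD.αup_surj j hs)

theorem IsClassKe.zero_mem {a b : EReal} {f : ℝ → ℝ} (hf : IsClassKe a b f) :
    (0 : ℝ) ∈ openInterval a b :=
  ⟨by simpa using hf.left_pos, by simpa using hf.right_pos⟩

theorem IsClassKe.strictMono {f : ℝ → ℝ} (hf : IsClassKe ⊤ ⊤ f) : StrictMono f := by
  have h : openInterval ⊤ ⊤ = univ := by
    ext s; simp [openInterval, EReal.bot_lt_coe, EReal.coe_lt_top]
  have := hf.strictMonoOn
  rwa [h, strictMonoOn_univ] at this

theorem IsClassKe.continuous {f : ℝ → ℝ} (hf : IsClassKe ⊤ ⊤ f) : Continuous f := by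
  have h : openInterval ⊤ ⊤ = univ := by
    ext s; simp [openInterval, EReal.bot_lt_coe, EReal.coe_lt_top]
  have := hf.continuousOn
  rwa [h, continuousOn_univ] at this

theorem SafetyConditions.invFunOn_strictMonoOn
    (hD : SafetyConditions glo δbar fbar₁ γ₁₂ X V v D) (j : Fin nc) :
    StrictMonoOn (Function.invFunOn (D.αup j) (openInterval (D.a j) (D.b j))) (Ioi (-v j)) := by
  intro s hs t ht hst
  rw [← (hD.αup_class j).strictMonoOn.lt_iff_lt (hD.invFunOn_mem j hs) (hD.invFunOn_mem j ht),
    hD.apply_invFunOn j hs, hD.apply_invFunOn j ht]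
  exact hst

theorem SafetyConditions.αj_strictMonoOn (hD : SafetyConditions glo δbar fbar₁ γ₁₂ X V v D)
    (j : Fin nc) : StrictMonoOn (D.αj j) (Ioi (-v j)) := fun _ hs _ ht hst =>
  hD.α_class.strictMono (hD.invFunOn_strictMonoOn j hs ht hst)

theorem SafetyConditions.αj_zero (hD : SafetyConditions glo δbar fbar₁ γ₁₂ X V v D)
    {j : Fin nc} (hv : 0 < v j) : D.αj j 0 = 0 := by
  have h0 : -v j < 0 := by linarith
  have h1 : Function.invFunOn (D.αup j) (openInterval (D.a j) (D.b j)) 0 = 0 :=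
    (hD.αup_class j).strictMonoOn.injOn (hD.invFunOn_mem j h0) (hD.αup_class j).zero_mem
      (by rw [hD.apply_invFunOn j h0, (hD.αup_class j).map_zero])
  rw [SafetyDesign.αj, h1, hD.α_class.map_zero]

theorem isOpen_openInterval (a b : EReal) : IsOpen (openInterval a b) :=
  (isOpen_lt continuous_const continuous_coe_real_ereal).inter
    (isOpen_lt continuous_coe_real_ereal continuous_const)

/-- The inverse of `αup j` is monotone, and its image contains a neighbourhood of each of its
values, so it has no jumps. -/
theorem SafetyConditions.αj_continuousOn (hD : SafetyConditions glo δbar fbar₁ γ₁₂ X V v D)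
    (j : Fin nc) : ContinuousOn (D.αj j) (Ioi (-v j)) := by
  intro s hs
  refine (hD.α_class.continuous.continuousAt.comp
    (continuousAt_of_monotoneOn_of_image_mem_nhds (s := Ioi (-v j))
      (hD.invFunOn_strictMonoOn j).monotoneOn (Ioi_mem_nhds hs) ?_)).continuousWithinAt
  set φ := Function.invFunOn (D.αup j) (openInterval (D.a j) (D.b j)) with hφ
  have hopen := isOpen_openInterval (D.a j) (D.b j)
  have h1 : ContinuousAt (D.αup j) (φ s) :=
    (hD.αup_class j).continuousOn.continuousAt (hopen.mem_nhds (hD.invFunOn_mem j hs))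
  have h2 : ∀ᶠ y in 𝓝 (φ s), -v j < D.αup j y :=
    h1.eventually (by rw [hφ, hD.apply_invFunOn j hs]; exact Ioi_mem_nhds hs)
  filter_upwards [h2, hopen.mem_nhds (hD.invFunOn_mem j hs)] with y hy hy'
  exact ⟨D.αup j y, hy, (hD.αup_class j).strictMonoOn.injOn (hD.invFunOn_mem j hy) hy'
    (hD.apply_invFunOn j hy)⟩

theorem SafetyConditions.αj_pos_iff (hD : SafetyConditions glo δbar fbar₁ γ₁₂ X V v D)
    {j : Fin nc} (hv : 0 < v j) {s : ℝ} (hs : -v j < s) : 0 < D.αj j s ↔ 0 < s := by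
  have := (hD.αj_strictMonoOn j).lt_iff_lt (show (0 : ℝ) ∈ Ioi (-v j) from neg_lt_zero.2 hv) hs
  rwa [hD.αj_zero hv] at this

theorem SafetyConditions.αj_le_α_signedDist (hD : SafetyConditions glo δbar fbar₁ γ₁₂ X V v D)
    {j : Fin nc} {x : Vec d} (hx : x ∈ X) (hpos : 0 < V j x) :
    D.αj j (V j x - v j) ≤ D.α (signedDist X (V j) (v j) x) := by
  have hs : -v j < V j x - v j := by linarith
  refine hD.α_class.strictMono.monotone ?_
  rw [← (hD.αup_class j).strictMonoOn.le_iff_le (hD.invFunOn_mem j hs)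
    (hD.signedDist_mem j x hx), hD.apply_invFunOn j hs]
  exact hD.le_αup j x hx

theorem SafetyConditions.levelSet_nonempty (hD : SafetyConditions glo δbar fbar₁ γ₁₂ X V v D)
    (j : Fin nc) {x : Vec d} (hx : x ∈ X) : (levelSet X (V j) (v j)).Nonempty := by
  by_contra hne
  rw [not_nonempty_iff_eq_empty] at hne
  -- By convention the distance to the empty set is 0, so the two bounds in terms of the signed
  -- distance would force V_j(x) = v_j.
  have h0 : signedDist X (V j) (v j) x = 0 := by simp [signedDist, hne]
  have h1 := hD.αlo_le j x hx
  have h2 := hD.le_αup j x hx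
  rw [h0, (hD.αlo_class j).map_zero] at h1
  rw [h0, (hD.αup_class j).map_zero] at h2
  have : x ∈ levelSet X (V j) (v j) := ⟨hx, by linarith⟩
  simp [hne] at this

/-- Where `V_j > v_j`, the constraint of index `j` is dominated by those of other indices. -/
theorem SafetyConditions.α_dominates (hD : SafetyConditions glo δbar fbar₁ γ₁₂ X V v D)
    (hδ : 0 ≤ δbar)
    (hX : SegmentsCross X V v) (hdisj : ∀ j k, k ≠ j → {x | x ∈ X ∧ v j ≤ V j x ∧ v k ≤ V k x} = ∅)
    {j k : Fin nc} (hjk : k ≠ j) {x : Vec d} (hx : x ∈ X) (hpos : ∀ j, 0 < V j x)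
    (hj : v j < V j x) :
    (glo + δbar) / (glo - δbar) * D.αj j (V j x - v j) ≤ -D.αj k (V k x - v k) := by
  have hk : V k x < v k := by
    by_contra hcon
    have : x ∈ {x | x ∈ X ∧ v j ≤ V j x ∧ v k ≤ V k x} := ⟨hx, hj.le, not_lt.1 hcon⟩
    rw [hdisj j k hjk] at this
    exact this
  set dj := Metric.infDist x (levelSet X (V j) (v j)) with hdj
  set dk := Metric.infDist x (levelSet X (V k) (v k)) with hdk
  have hsj : signedDist X (V j) (v j) x = dj := by
    rw [signedDist, Real.sign_of_pos (sub_pos.2 hj), one_mul]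
  have hsk : signedDist X (V k) (v k) x = -dk := by
    rw [signedDist, Real.sign_of_neg (sub_neg.2 hk), neg_one_mul]
  -- The way from `x` to any point of {V_k = v_k} crosses {V_j = v_j}, so the latter set is no
  -- farther away.
  have hdd : dj ≤ dk := by
    refine (Metric.le_infDist (hD.levelSet_nonempty k hx)).2 fun y hy => ?_
    obtain ⟨z, hz, hzl⟩ := hX j k hjk x hx hj.le y hy
    have h1 := (mem_segment_iff_wbtw.1 hz).dist_add_dist
    have h2 := Metric.infDist_le_dist_of_mem (x := x) hzl
    linarith [dist_nonneg (x := z) (y := y)]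
  have h1 := hD.αj_le_α_signedDist hx (hpos j)
  have h2 := hD.αj_le_α_signedDist hx (hpos k)
  rw [hsj] at h1
  rw [hsk] at h2
  have h3 := hD.α_feasible (-dk) (by have := Metric.infDist_nonneg (x := x)
                                        (s := levelSet X (V k) (v k)); linarith)
  rw [neg_neg] at h3
  have h4 := hD.α_class.strictMono.monotone hdd
  have hR : 0 ≤ (glo + δbar) / (glo - δbar) :=
    div_nonneg (by linarith [hD.δbar_lt]) (sub_nonneg.2 hD.δbar_lt.le)
  have h5 := mul_le_mul_of_nonneg_left (h1.trans h4) hR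
  linarith

end Alpha

/-! ### The quadratic programs -/

section Programs

variable {P : Plant m n} {X : Set (Vec (n 1))} {V : Fin nc → Vec (n 1) → ℝ} {v : Fin nc → ℝ}
  {η : ℝ} {D : SafetyDesign nc nl (n 2)}

theorem norm_rowA {j : Fin nc} {x : Vec (n 1)}
    (h : ContinuousLinearMap.adjoint (P.g 1) (gradient (V j) x) ≠ 0) : ‖rowA P V x j‖ = 1 :=
  norm_smul_inv_norm (𝕜 := ℝ) h

theorem norm_rowA_of_mem (hm : 1 ≤ m) (hP : PlantBounds P glo ghi δbar fbar) (hglo : 0 < glo)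
    (hV : CertificateAssumption X V v η) (j : Fin nc) {x : Vec (n 1)} (hx : x ∈ X) :
    ‖rowA P V x j‖ = 1 := by
  refine norm_rowA fun h => ?_
  have h1 := hP.le_norm_adjoint (i := 1) (by simp [hm]) (gradient (V j) x)
  rw [h, norm_zero] at h1
  have h2 := norm_pos_iff.2 (hV.grad_ne_zero j x hx)
  nlinarith

/-- If no V_j exceeds v_j, then 0 is feasible and minimal. Otherwise exactly one index j is
critical, and the minimizer is the projection of 0 onto the half-space of that index, whose norm is
small enough for all other constraints. -/
theorem selection_spec (hm : 1 ≤ m) (hP : PlantBounds P glo ghi δbar fbar)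
    (hV : CertificateAssumption X V v η) (hX : SegmentsCross X V v)
    (hD : SafetyConditions glo δbar fbar₁ γ₁₂ X V v D) {x : Vec (n 1)} (hx : x ∈ X) :
    (∃! u, IsNearest (selectionSet P glo δbar V v D x) 0 u) ∧
    selection P glo δbar V v D x ∈ coneSet P glo δbar V v D x ∧
    ‖selection P glo δbar V v D x‖ ≤
      ∑ j, max (D.αj j (V j x - v j)) 0 / (1 - δbar / glo) := by
  have hδ := hP.δbar_nonneg
  have hlt := hD.δbar_lt
  have hglo : 0 < glo := lt_of_le_of_lt hδ hlt
  set ε := δbar / glo with hε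
  have hε0 : 0 ≤ ε := div_nonneg hδ hglo.le
  have hε1 : ε < 1 := (div_lt_one hglo).2 hlt
  have hε' : 0 < 1 - ε := sub_pos.2 hε1
  have hpos : ∀ j, 0 < V j x := fun j => hV.pos j hx
  have ha : ∀ j, ‖rowA P V x j‖ = 1 := fun j => norm_rowA_of_mem hm hP hglo hV j hx
  have hconv : Convex ℝ (selectionSet P glo δbar V v D x) := convex_halfspaces _ _
  have hclosed : IsClosed (selectionSet P glo δbar V v D x) := isClosed_halfspaces _ _
  have hsum0 : ∀ j, 0 ≤ max (D.αj j (V j x - v j)) 0 / (1 - ε) := fun j =>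
    div_nonneg (le_max_right _ _) hε'.le
  suffices h : ∃ u, IsNearest (selectionSet P glo δbar V v D x) 0 u ∧
      u ∈ coneSet P glo δbar V v D x ∧ ‖u‖ ≤ ∑ j, max (D.αj j (V j x - v j)) 0 / (1 - ε) by
    obtain ⟨u, hu, hu1, hu2⟩ := h
    have hs : selection P glo δbar V v D x = u := (isNearest_nearest ⟨u, hu⟩).unique hconv hu
    rw [hs]
    exact ⟨existsUnique_isNearest hconv hclosed ⟨u, hu.1⟩ 0, hu1, hu2⟩
  by_cases hcase : ∃ j, v j < V j x
  · obtain ⟨j, hj⟩ := hcase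
    set B := D.αj j (V j x - v j) with hB
    have hBpos : 0 < B :=
      (hD.αj_pos_iff (hV.v_pos j) (by linarith [hpos j])).2 (sub_pos.2 hj)
    have hbj : entryB V v D x j = -B := rfl
    -- The division by 1 - ε makes the robust constraint of index j tight: ⟪a_j, u⟫ + ε|u| = -B.
    set u : Vec (n 2) := (-(B / (1 - ε))) • rowA P V x j with hu
    have hBε : 0 < B / (1 - ε) := div_pos hBpos hε'
    have hun : ‖u‖ = B / (1 - ε) := by
      rw [hu, norm_smul, ha, mul_one, norm_neg, Real.norm_of_nonneg hBε.le]
    have hau : ⟪rowA P V x j, u⟫ = -(B / (1 - ε)) := by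
      rw [hu, inner_smul_right, real_inner_self_eq_norm_sq, ha]; ring
    have hk : ∀ k, k ≠ j → ‖u‖ + ε * ‖u‖ ≤ entryB V v D x k := by
      intro k hkj
      have h1 := hD.α_dominates hδ hX hV.disjoint hkj hx hpos hj
      -- The ratio in the condition on α equals (1 + ε) / (1 - ε).
      have h2 : (glo + δbar) / (glo - δbar) * B = ‖u‖ + ε * ‖u‖ := by
        rw [hun, hε]
        have : glo - δbar ≠ 0 := (sub_pos.2 hlt).ne'
        field_simp
      rw [← h2]
      exact h1
    have hle : ∀ k, ⟪rowA P V x k, u⟫ ≤ ‖u‖ := fun k => by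
      simpa [ha] using real_inner_le_norm (rowA P V x k) u
    refine ⟨u, ⟨fun k => ?_, fun w hw => ?_⟩, fun k => ?_, ?_⟩
    · rcases eq_or_ne k j with rfl | hkj
      · rw [hau, hbj, neg_div]
      · have h1 := hk k hkj
        have h2 : ‖u‖ ≤ entryB V v D x k / (1 - ε) := by
          rw [le_div_iff₀ hε']
          nlinarith [norm_nonneg u]
        exact (hle k).trans h2
    · have h1 : ⟪rowA P V x j, w⟫ ≤ entryB V v D x j / (1 - ε) := hw j
      -- Minimality: the constraint of index j alone forces |w| ≥ -⟪a_j, w⟫ ≥ B / (1 - ε).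
      have h2 := (abs_le.1 (abs_real_inner_le_norm (rowA P V x j) w)).1
      rw [ha, one_mul] at h2
      rw [hbj, neg_div] at h1
      change ‖u - 0‖ ^ 2 ≤ ‖w - 0‖ ^ 2
      rw [sub_zero, sub_zero, hun]
      exact pow_le_pow_left₀ hBε.le (by linarith) 2
    · rcases eq_or_ne k j with rfl | hkj
      · rw [hau, hun, hbj, ← hε]
        apply le_of_eq
        field_simp
        ring
      · linarith [hk k hkj, hle k]
    · rw [hun]
      refine le_trans ?_ (Finset.single_le_sum (fun k _ => hsum0 k) (Finset.mem_univ j))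
      exact div_le_div_of_nonneg_right (le_max_left _ _) hε'.le
  · push Not at hcase
    have hb : ∀ j, 0 ≤ entryB V v D x j := fun j => by
      have h1 := (hD.αj_pos_iff (hV.v_pos j) (s := V j x - v j) (by linarith [hpos j])).not.2
        (by linarith [hcase j])
      simpa [entryB] using h1
    refine ⟨0, ⟨fun j => ?_, fun w _ => ?_⟩, fun j => ?_, ?_⟩
    · rw [inner_zero_right]; exact div_nonneg (hb j) hε'.le
    · simp
    · rw [inner_zero_right, norm_zero, mul_zero, add_zero]; exact hb j
    · rw [norm_zero]; exact Finset.sum_nonneg fun j _ => hsum0 j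

/-- The lower bound on `cA` says precisely that the two angles add up to less than a right angle;
positivity of the cosine makes the coefficients in `entryBL` nonnegative. -/
theorem SafetyConditions.cAbar_pos {d : ℕ} {X : Set (Vec d)} {V : Fin nc → Vec d → ℝ}
    {d' : ℕ} {D : SafetyDesign nc nl d'} (hD : SafetyConditions glo δbar fbar₁ γ₁₂ X V v D) :
    0 < D.cAbar ∧ Real.arccos √(1 - D.cbar ^ 2) + Real.arccos D.cA < Real.pi / 2 := by
  have h0 := Real.arccos_nonneg √(1 - D.cbar ^ 2)
  have h0' := Real.arccos_nonneg D.cA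
  have h1 : Real.arccos √(1 - D.cbar ^ 2) ≤ Real.pi / 2 :=
    Real.arccos_le_pi_div_two.2 (Real.sqrt_nonneg _)
  have h2 : Real.arccos D.cA < Real.pi / 2 - Real.arccos √(1 - D.cbar ^ 2) := by
    rw [← Real.arccos_cos (x := Real.pi / 2 - Real.arccos √(1 - D.cbar ^ 2)) (by linarith)
      (by linarith [Real.pi_pos])]
    exact Real.arccos_lt_arccos (Real.neg_one_le_cos _) hD.cA_gt hD.basis.cA_lt_one.le
  exact ⟨Real.cos_pos_of_mem_Ioo ⟨by linarith [Real.pi_pos], by linarith⟩, by linarith⟩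

/-- A vector in the ball of radius `ε` about a unit vector makes an angle of at most
`arcsin ε` with it. -/
theorem angle_le_of_norm_sub_le {d : ℕ} {a p : Vec d} {ε c : ℝ} (ha : ‖a‖ = 1)
    (hp : ‖p - a‖ ≤ ε) (hc : ε ≤ c) (hc1 : c < 1) :
    InnerProductGeometry.angle p a ≤ Real.arccos √(1 - c ^ 2) := by
  refine Real.arccos_le_arccos ?_
  have hε0 : 0 ≤ ε := (norm_nonneg _).trans hp
  have hp0 : p ≠ 0 := by
    rintro rfl
    rw [zero_sub, norm_neg, ha] at hp
    linarith
  have hpn := norm_pos_iff.2 hp0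
  have h1 : ‖p‖ ^ 2 - 2 * ⟪p, a⟫ + 1 ≤ c ^ 2 := by
    have h2 := norm_sub_sq_real p a
    rw [ha, one_pow] at h2
    have h3 := pow_le_pow_left₀ (norm_nonneg _) (hp.trans hc) 2
    linarith
  have hc2 : c ^ 2 < 1 := by nlinarith
  rw [ha, mul_one, le_div_iff₀ hpn]
  have hs := Real.sq_sqrt (sub_nonneg.2 hc2.le)
  -- By the arithmetic-geometric mean inequality, 2⟪p, a⟫ ≥ |p|² + (1 - c²) ≥ 2|p|√(1 - c²).
  nlinarith [sq_nonneg (√(1 - c ^ 2) - ‖p‖)]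

/-- With w = u - s, the quantity ⟪a, w⟫ + ε|w| equals ⟪p, w⟫ for p = a + ε w/|w|, a vector near `a`.
Up to scaling, `p` is a nonnegative combination of those l_i close to it, hence close to `a`, and
for these l_i the reshaped constraint reads ⟪l_i, w⟫ ≤ ⟪l_i, a⟫σ. Summation gives ⟪p, w⟫ ≤ ⟪p, a⟫σ ≤
(1 + ε)σ, where (1 + ε)σ is the slack of the cone constraint at the selection. -/
theorem reshapedSet_spec (hm : 1 ≤ m) (hnc : 1 ≤ nc) (hP : PlantBounds P glo ghi δbar fbar)
    (hV : CertificateAssumption X V v η) (hX : SegmentsCross X V v)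
    (hD : SafetyConditions glo δbar fbar₁ γ₁₂ X V v D) {x : Vec (n 1)} (hx : x ∈ X) :
    selection P glo δbar V v D x ∈ reshapedSet P glo δbar V v D x ∧
    reshapedSet P glo δbar V v D x ⊆ coneSet P glo δbar V v D x := by
  have : Nonempty (Fin nc) := ⟨⟨0, hnc⟩⟩
  have hδ := hP.δbar_nonneg
  have hglo : 0 < glo := lt_of_le_of_lt hδ hD.δbar_lt
  have hcone := (selection_spec hm hP hV hX hD hx).2.1
  have ha : ∀ j, ‖rowA P V x j‖ = 1 := fun j => norm_rowA_of_mem hm hP hglo hV j hx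
  obtain ⟨hcpos, hang⟩ := hD.cAbar_pos
  set s := selection P glo δbar V v D x with hs
  set ε := δbar / glo with hε
  have hε0 : 0 ≤ ε := div_nonneg hδ hglo.le
  have hσ : ∀ j, 0 ≤ (entryB V v D x j - ⟪rowA P V x j, s⟫ - ε * ‖s‖) / (1 + ε) := fun j =>
    div_nonneg (by have := hcone j; linarith) (by linarith)
  constructor
  · intro i
    refine le_add_of_nonneg_right (le_ciInf fun j => ?_)
    exact add_nonneg (mul_nonneg (hcpos.le.trans (le_max_right _ _)) (hσ j)) (le_max_right _ _)
  · intro u hu j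
    set a := rowA P V x j with haj
    set σ := (entryB V v D x j - ⟪a, s⟫ - ε * ‖s‖) / (1 + ε) with hσj
    have hσ0 : 0 ≤ σ := hσ j
    have hσe : (1 + ε) * σ = entryB V v D x j - ⟪a, s⟫ - ε * ‖s‖ := by
      rw [hσj]; field_simp
    set w := u - s with hw
    -- For rows this close to `a`, the maximum with `cAbar` is the inner product itself and the `kφ`
    -- term vanishes.
    have hli : ∀ i, D.cAbar ≤ ⟪D.l i, a⟫ → ⟪D.l i, w⟫ ≤ ⟪D.l i, a⟫ * σ := by
      intro i hi
      have h1 : ⟪D.l i, u⟫ ≤ ⟪D.l i, s⟫ + ⨅ j : Fin nc,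
        (max ⟪D.l i, rowA P V x j⟫ D.cAbar *
          ((entryB V v D x j - ⟪rowA P V x j, s⟫ - ε * ‖s‖) / (1 + ε)) +
        max (D.kφ * (D.cAbar - ⟪D.l i, rowA P V x j⟫)) 0) := hu i
      have h2 := ciInf_le (f := fun j : Fin nc =>
        (max ⟪D.l i, rowA P V x j⟫ D.cAbar *
          ((entryB V v D x j - ⟪rowA P V x j, s⟫ - ε * ‖s‖) / (1 + ε)) +
        max (D.kφ * (D.cAbar - ⟪D.l i, rowA P V x j⟫)) 0)) (finite_range _).bddBelow j
      have h3 : max (D.kφ * (D.cAbar - ⟪D.l i, a⟫)) 0 = 0 :=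
        max_eq_right (mul_nonpos_of_nonneg_of_nonpos hD.kφ_nonneg (by linarith))
      simp only [← haj, ← hσj, max_eq_left hi, h3, add_zero] at h2
      rw [hw, inner_sub_right]
      linarith
    have hgoal : ⟪a, w⟫ + ε * ‖w‖ ≤ (1 + ε) * σ := by
      set e : Vec (n 2) := ‖w‖⁻¹ • w with he
      have hen : ‖e‖ ≤ 1 := by
        rw [he, norm_smul, norm_inv, norm_norm]
        exact inv_mul_le_one_of_le₀ le_rfl (norm_nonneg _)
      have hew : ⟪e, w⟫ = ‖w‖ := by
        rcases eq_or_ne w 0 with h0 | h0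
        · simp [h0]
        · rw [he, inner_smul_left, real_inner_self_eq_norm_sq, conj_trivial]
          have := norm_ne_zero_iff.2 h0
          field_simp
      set p := a + ε • e with hp
      have hpa : ‖p - a‖ ≤ ε := by
        rw [hp, add_sub_cancel_left, norm_smul, Real.norm_of_nonneg hε0]
        exact mul_le_of_le_one_right hε0 hen
      have hpang := angle_le_of_norm_sub_le (ha j) hpa hD.cbar_ge hD.cbar_lt_one
      have hp0 : p ≠ 0 := by
        intro h0
        rw [h0, zero_sub, norm_neg, ha] at hpa
        exact absurd (hpa.trans hD.cbar_ge) (not_le.2 hD.cbar_lt_one)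
      have hpn := norm_pos_iff.2 hp0
      obtain ⟨c, hc0, hc1, hc2⟩ := hD.basis.posComb (‖p‖⁻¹ • p) (norm_smul_inv_norm (𝕜 := ℝ) hp0)
      have hterm : ∀ i, c i * ⟪D.l i, w⟫ ≤ c i * (⟪D.l i, a⟫ * σ) := by
        intro i
        by_cases hi : ⟪D.l i, ‖p‖⁻¹ • p⟫ < D.cA
        · rw [hc1 i hi, zero_mul, zero_mul]
        · refine mul_le_mul_of_nonneg_left (hli i ?_) (hc0 i)
          have h1 : InnerProductGeometry.angle (D.l i) p ≤ Real.arccos D.cA := by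
            refine Real.arccos_le_arccos ?_
            rw [hD.basis.unit i, one_mul, div_eq_inv_mul]
            rw [inner_smul_right] at hi
            exact not_lt.1 hi
          -- Triangle inequality for angles: from l_i to p at most arccos cA, from p to a at most
          -- arccos √(1 - c̄²).
          have h2 := InnerProductGeometry.angle_le_angle_add_angle (D.l i) p a
          have h3 : InnerProductGeometry.angle (D.l i) a ≤
              Real.arccos √(1 - D.cbar ^ 2) + Real.arccos D.cA := by linarith
          have h4 := Real.cos_le_cos_of_nonneg_of_le_pi (InnerProductGeometry.angle_nonneg _ _)
            (by linarith [Real.pi_pos]) h3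
          rwa [InnerProductGeometry.cos_angle, hD.basis.unit i, ha, one_mul, div_one] at h4
      have hsum : ⟪‖p‖⁻¹ • p, w⟫ ≤ ⟪‖p‖⁻¹ • p, a⟫ * σ := by
        rw [hc2, sum_inner, sum_inner, Finset.sum_mul]
        refine Finset.sum_le_sum fun i _ => ?_
        rw [inner_smul_left, inner_smul_left, conj_trivial, mul_assoc]
        exact hterm i
      rw [inner_smul_left, inner_smul_left, conj_trivial, mul_assoc,
        mul_le_mul_iff_right₀ (inv_pos.2 hpn)] at hsum
      have h5 : ⟪p, w⟫ = ⟪a, w⟫ + ε * ‖w‖ := by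
        rw [hp, inner_add_left, inner_smul_left, hew, conj_trivial]
      have h6 : ⟪p, a⟫ ≤ 1 + ε := by
        rw [hp, inner_add_left, inner_smul_left, conj_trivial, real_inner_self_eq_norm_sq, ha]
        have := real_inner_le_norm e a
        rw [ha, mul_one] at this
        nlinarith
      rw [← h5]
      exact hsum.trans (mul_le_mul_of_nonneg_right h6 hσ0)
    have hnorm : ‖u‖ ≤ ‖w‖ + ‖s‖ := by simpa [hw] using norm_add_le (u - s) s
    have hin : ⟪a, u⟫ = ⟪a, w⟫ + ⟪a, s⟫ := by rw [hw, inner_sub_right]; ring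
    rw [hσe] at hgoal
    rw [hin]
    -- The slack was computed with ε|s| already subtracted, so |u| ≤ |w| + |s| returns from `w` to
    -- `u`.
    nlinarith [mul_le_mul_of_nonneg_left hnorm hε0]

theorem existsUnique_safetyLaw (hm : 1 ≤ m) (hnc : 1 ≤ nc)
    (hP : PlantBounds P glo ghi δbar fbar)
    (hV : CertificateAssumption X V v η) (hX : SegmentsCross X V v)
    (hD : SafetyConditions glo δbar fbar₁ γ₁₂ X V v D) (ρ₀ : Vec (n 1) → Vec (n 2))
    {x : Vec (n 1)} (hx : x ∈ X) :
    ∃! u, IsNearest (reshapedSet P glo δbar V v D x) (ρ₀ x) u :=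
  existsUnique_isNearest (convex_halfspaces _ _) (isClosed_halfspaces _ _)
    ⟨_, (reshapedSet_spec hm hnc hP hV hX hD hx).1⟩ _

theorem safetyLaw_mem_coneSet (hm : 1 ≤ m) (hnc : 1 ≤ nc)
    (hP : PlantBounds P glo ghi δbar fbar)
    (hV : CertificateAssumption X V v η) (hX : SegmentsCross X V v)
    (hD : SafetyConditions glo δbar fbar₁ γ₁₂ X V v D) (ρ₀ : Vec (n 1) → Vec (n 2))
    {x : Vec (n 1)} (hx : x ∈ X) :
    safetyLaw P glo δbar V v D ρ₀ x ∈ coneSet P glo δbar V v D x :=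
  (reshapedSet_spec hm hnc hP hV hX hD hx).2
    (isNearest_nearest (existsUnique_safetyLaw hm hnc hP hV hX hD ρ₀ hx).exists).1

/-- The safety law exceeds the nominal controller by at most a class `K` function of the
certificates. -/
theorem exists_bound_safetyLaw (hm : 1 ≤ m) (hnc : 1 ≤ nc)
    (hP : PlantBounds P glo ghi δbar fbar)
    (hV : CertificateAssumption X V v η) (hX : SegmentsCross X V v)
    (hD : SafetyConditions glo δbar fbar₁ γ₁₂ X V v D) (ρ₀ : Vec (n 1) → Vec (n 2)) :
    ∃ γ, IsClassK γ ∧ ∀ x ∈ X,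
      ‖safetyLaw P glo δbar V v D ρ₀ x‖ ≤ γ (maxV V x) + ‖ρ₀ x‖ := by
  have hglo : 0 < glo := lt_of_le_of_lt hP.δbar_nonneg hD.δbar_lt
  have hε' : 0 < 1 - δbar / glo := sub_pos.2 ((div_lt_one hglo).2 hD.δbar_lt)
  -- Truncation at 0 keeps the argument in the domain of α_j and makes each summand vanish at 0,
  -- since v_j > 0.
  set a : Fin nc → ℝ → ℝ := fun j s => D.αj j (max (s - v j) 0) / (1 - δbar / glo) with ha
  have hmem : ∀ j s, max (s - v j) 0 ∈ Ioi (-v j) := fun j s =>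
    lt_of_lt_of_le (neg_lt_zero.2 (hV.v_pos j)) (le_max_right _ _)
  have hmono : ∀ j, Monotone (a j) := fun j s t hst =>
    div_le_div_of_nonneg_right ((hD.αj_strictMonoOn j).monotoneOn (hmem j s) (hmem j t)
      (max_le_max_right _ (by linarith))) hε'.le
  have hcont : ∀ j, Continuous (a j) := fun j =>
    ((hD.αj_continuousOn j).comp_continuous (by fun_prop) (hmem j)).div_const _
  -- The added identity turns a sum that is only nondecreasing into a strictly increasing function.
  refine ⟨fun s => s + ∑ j, a j s, ⟨?_, ?_, ?_⟩, fun x hx => ?_⟩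
  · exact (continuous_id.add (continuous_finsetSum _ fun j _ => hcont j)).continuousOn
  · exact (strictMono_id.add_monotone fun s t hst =>
      Finset.sum_le_sum fun j _ => hmono j hst).strictMonoOn _
  · rw [zero_add]
    refine Finset.sum_eq_zero fun j _ => ?_
    simp only [ha]
    rw [max_eq_right (by linarith [hV.v_pos j]), hD.αj_zero (hV.v_pos j), zero_div]
  · obtain ⟨-, -, hsel⟩ := selection_spec hm hP hV hX hD hx
    have hnear := isNearest_nearest (existsUnique_safetyLaw hm hnc hP hV hX hD ρ₀ hx).exists
    replace hnear := (isNearest_iff (convex_halfspaces _ _) _ _).1 hnear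
    have h1 := norm_le_of_inner_nonpos (hnear.2 _ (reshapedSet_spec hm hnc hP hV hX hD hx).1)
    have h2 : ∀ j, max (D.αj j (V j x - v j)) 0 / (1 - δbar / glo) ≤ a j (maxV V x) := by
      intro j
      refine le_trans (div_le_div_of_nonneg_right (max_le ?_ ?_) hε'.le) (hmono j (le_maxV V x j))
      · exact (hD.αj_strictMonoOn j).monotoneOn (by simpa using hV.pos j hx) (hmem j _)
          (le_max_left _ _)
      · exact (hD.αj_zero (hV.v_pos j)).ge.trans ((hD.αj_strictMonoOn j).monotoneOn
          (neg_lt_zero.2 (hV.v_pos j)) (hmem j _) (le_max_right _ _))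
    have h3 := Finset.sum_le_sum fun j (_ : j ∈ Finset.univ) => h2 j
    have h4 : 0 ≤ maxV V x := (hV.pos ⟨0, hnc⟩ hx).le.trans (le_maxV V x _)
    change ‖safetyLaw P glo δbar V v D ρ₀ x‖ ≤ _ at h1
    linarith

end Programs

end Safety

/-! ### Right-hand speeds of curves -/

section Speed

variable {E F : Type*} [NormedAddCommGroup E] [NormedAddCommGroup F]

/-- The upper right-hand speed of the curve `y` at `t` is at most `L`. -/
def SpeedLE (y : ℝ → E) (t L : ℝ) : Prop :=
  ∀ r, L < r → ∀ᶠ t' in 𝓝[>] t, ‖y t' - y t‖ ≤ r * (t' - t)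

theorem SpeedLE.mono {y : ℝ → E} {t L L' : ℝ} (h : SpeedLE y t L) (hL : L ≤ L') :
    SpeedLE y t L' := fun r hr => h r (lt_of_le_of_lt hL hr)

theorem SpeedLE.sub {y z : ℝ → E} {t L L' : ℝ} (h : SpeedLE y t L) (h' : SpeedLE z t L') :
    SpeedLE (fun s => y s - z s) t (L + L') := by
  intro r hr
  filter_upwards [h (L + (r - L - L') / 2) (by linarith), h' (L' + (r - L - L') / 2) (by linarith)]
    with t' h1 h2
  have h3 : y t' - z t' - (y t - z t) = (y t' - y t) - (z t' - z t) := by abel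
  rw [h3]
  refine (norm_sub_le _ _).trans ((add_le_add h1 h2).trans_eq ?_)
  ring

theorem SpeedLE.tendsto {y : ℝ → E} {t L : ℝ} (h : SpeedLE y t L) :
    Tendsto y (𝓝[>] t) (𝓝 (y t)) := by
  rw [tendsto_iff_norm_sub_tendsto_zero]
  have h1 : Tendsto (fun t' => (L + 1) * (t' - t)) (𝓝[>] t) (𝓝 0) := by
    have : Tendsto (fun t' : ℝ => (L + 1) * (t' - t)) (𝓝 t) (𝓝 ((L + 1) * (t - t))) :=
      Continuous.tendsto (by fun_prop) t
    rw [sub_self, mul_zero] at this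
    exact this.mono_left nhdsWithin_le_nhds
  exact squeeze_zero' (Eventually.of_forall fun _ => norm_nonneg _) (h (L + 1) (by linarith)) h1

/-- A Lipschitz estimate based at the single point `y t`, with constants arbitrarily close to `k`,
suffices; no differentiability of `ρ` is needed. -/
theorem SpeedLE.comp {y : ℝ → E} {ρ : E → F} {t L k : ℝ} (hy : SpeedLE y t L)
    (hk : 0 ≤ k)
    (hρ : ∀ K, k < K → ∀ᶠ e in 𝓝 (y t), ‖ρ e - ρ (y t)‖ ≤ K * ‖e - y t‖) :
    SpeedLE (fun s => ρ (y s)) t (k * L) := by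
  intro r hr
  have h1 : Tendsto (fun ε : ℝ => (k + ε) * (L + ε)) (𝓝[>] 0) (𝓝 (k * L)) := by
    have : Tendsto (fun ε : ℝ => (k + ε) * (L + ε)) (𝓝 0) (𝓝 ((k + 0) * (L + 0))) :=
      Continuous.tendsto (by fun_prop) 0
    rw [add_zero, add_zero] at this
    exact this.mono_left nhdsWithin_le_nhds
  obtain ⟨ε, hε, hε0⟩ :=
    ((h1.eventually (gt_mem_nhds hr)).and self_mem_nhdsWithin).exists
  have hε0 : 0 < ε := hε0
  filter_upwards [hy (L + ε) (by linarith), hy.tendsto.eventually (hρ (k + ε) (by linarith)),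
    self_mem_nhdsWithin] with t' h2 h3 h4
  have h4 : 0 < t' - t := sub_pos.2 h4
  calc ‖ρ (y t') - ρ (y t)‖ ≤ (k + ε) * ((L + ε) * (t' - t)) :=
        h3.trans (mul_le_mul_of_nonneg_left h2 (by linarith))
    _ = (k + ε) * (L + ε) * (t' - t) := by ring
    _ ≤ r * (t' - t) := mul_le_mul_of_nonneg_right hε.le h4.le

theorem eventually_lt_of_hasDerivWithinAt_neg {φ : ℝ → ℝ} {t φ' : ℝ}
    (h : HasDerivWithinAt φ φ' (Ioi t) t) (hneg : φ' < 0) : ∀ᶠ t' in 𝓝[>] t, φ t' < φ t := by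
  filter_upwards [h.limsup_slope_le' self_notMem_Ioi hneg, self_mem_nhdsWithin] with t' h1 h2
  rw [slope_def_field, div_neg_iff] at h1
  have h2 : t < t' := h2
  rcases h1 with h1 | h1 <;> linarith

theorem hasDerivWithinAt_exp_decay (μ c t : ℝ) (s : Set ℝ) :
    HasDerivWithinAt (fun t' => Real.exp (-(μ * (t' - t))) * c) (-(μ * c)) s t := by
  have h1 : HasDerivAt (fun t' : ℝ => -(μ * (t' - t))) (-(μ * 1)) t :=
    (((hasDerivAt_id t).sub_const t).const_mul μ).neg
  have h2 := (h1.exp.mul_const c).hasDerivWithinAt (s := s)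
  simpa using h2

variable [NormedSpace ℝ E]

theorem speedLE_of_hasDerivWithinAt {y : ℝ → E} {y' : E} {t : ℝ}
    (h : HasDerivWithinAt y y' (Ioi t) t) : SpeedLE y t ‖y'‖ := by
  intro r hr
  filter_upwards [h.hasFDerivWithinAt.isLittleO.def (sub_pos.2 hr), self_mem_nhdsWithin]
    with t' h1 h2
  have h2 : 0 < t' - t := sub_pos.2 h2
  simp only [ContinuousLinearMap.toSpanSingleton_apply, Real.norm_of_nonneg h2.le] at h1
  have h3 := norm_add_le (y t' - y t - (t' - t) • y') ((t' - t) • y')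
  rw [sub_add_cancel, norm_smul, Real.norm_of_nonneg h2.le] at h3
  nlinarith

/-- The exponential starts at the same value with slope -μ φ(t); the strictly smaller right
derivative keeps φ below it for a short time. -/
theorem eventually_le_exp_decay {φ : ℝ → ℝ} {t φ' μ : ℝ}
    (h : HasDerivWithinAt φ φ' (Ioi t) t) (hneg : φ' < -(μ * φ t)) :
    ∀ᶠ t' in 𝓝[>] t, φ t' ≤ Real.exp (-(μ * (t' - t))) * φ t := by
  have h1 := h.sub (hasDerivWithinAt_exp_decay μ (φ t) t (Ioi t))
  filter_upwards [eventually_lt_of_hasDerivWithinAt_neg h1 (by linarith)] with t' h2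
  simp only [Pi.sub_apply, sub_self, mul_zero, neg_zero, Real.exp_zero, one_mul] at h2
  linarith

end Speed

/-- The curve `y` need not be differentiable. Freeze it at time `t`, differentiate |x - y(t)|, and
pay for the motion of `y` with the linear term r(t' - t), where r is slightly larger than the speed
bound. -/
theorem norm_sub_eventually_le_exp_decay {d : ℕ} {x y : ℝ → Vec d} {x' : Vec d} {t L μ : ℝ}
    (hx : HasDerivWithinAt x x' (Ioi t) t) (hy : SpeedLE y t L) (hne : x t - y t ≠ 0)
    (h : ⟪x t - y t, x'⟫ / ‖x t - y t‖ + L < -(μ * ‖x t - y t‖)) :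
    ∀ᶠ t' in 𝓝[>] t, ‖x t' - y t'‖ ≤ Real.exp (-(μ * (t' - t))) * ‖x t - y t‖ := by
  set e := x t - y t with he
  obtain ⟨r, hr1, hr2⟩ := exists_between (show L < -(μ * ‖e‖) - ⟪e, x'⟫ / ‖e‖ by linarith)
  have h1 : HasDerivWithinAt (fun s => ‖x s - y t‖) (⟪e, x'⟫ / ‖e‖) (Ioi t) t := by
    have h2 := (hx.sub_const (y t)).norm_sq
    have h3 := h2.sqrt (by
      simp only [← he]
      exact pow_ne_zero 2 (norm_ne_zero_iff.2 hne))
    simp only [Real.sqrt_sq (norm_nonneg _), ← he] at h3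
    convert h3 using 1
    have := norm_ne_zero_iff.2 hne
    field_simp
  have h2 : HasDerivWithinAt (fun s => r * (s - t)) r (Ioi t) t := by
    simpa using (((hasDerivAt_id t).sub_const t).const_mul r).hasDerivWithinAt (s := Ioi t)
  have h3 := (h1.add h2)
  have h4 := eventually_le_exp_decay (μ := μ) h3 (by simp only [Pi.add_apply, sub_self, mul_zero, add_zero, ← he]; linarith)
  filter_upwards [h4, hy r hr1] with t' h5 h6
  simp only [Pi.add_apply, sub_self, mul_zero, add_zero, ← he] at h5
  have h7 : ‖x t' - y t'‖ ≤ ‖x t' - y t‖ + ‖y t' - y t‖ := by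
    have := norm_sub_le (x t' - y t) (y t' - y t)
    rwa [sub_sub_sub_cancel_right] at this
  linarith

/-! ### The tracking laws -/

theorem norm_inv_norm_smul {d : ℕ} {p : Vec d} (hp : p ≠ 0) : ‖‖p‖⁻¹ • p‖ = 1 :=
  norm_smul_inv_norm (𝕜 := ℝ) hp

/-- After multiplication by |p||q| the two sides differ by (|p| - |q|)². As q → p this gives the
sharp Lipschitz constant 1/|p| of normalization. -/
theorem norm_normalize_sub_sq_le {d : ℕ} {p q : Vec d} (hp : p ≠ 0) (hq : q ≠ 0) :
    ‖‖q‖⁻¹ • q - ‖p‖⁻¹ • p‖ ^ 2 ≤ ‖q - p‖ ^ 2 / (‖p‖ * ‖q‖) := by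
  have hp' := norm_pos_iff.2 hp
  have hq' := norm_pos_iff.2 hq
  rw [le_div_iff₀ (mul_pos hp' hq'), norm_sub_sq_real, norm_sub_sq_real, norm_smul, norm_smul,
    inner_smul_left, inner_smul_right, norm_inv, norm_inv, norm_norm, norm_norm,
    inv_mul_cancel₀ hp'.ne', inv_mul_cancel₀ hq'.ne', conj_trivial]
  have : (1 ^ 2 - 2 * (‖q‖⁻¹ * (‖p‖⁻¹ * ⟪q, p⟫)) + 1 ^ 2) * (‖p‖ * ‖q‖) =
      2 * (‖p‖ * ‖q‖) - 2 * ⟪q, p⟫ := by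
    field_simp
    ring
  rw [this]
  nlinarith [sq_nonneg (‖p‖ - ‖q‖)]

section TrackingLaw

variable {P : Plant m n} {glo ghi δbar : ℝ} {fbar : ℕ → ℝ → ℝ} {κ : ℕ → ℝ → ℝ} {i : ℕ}

theorem trackingLaw_zero : trackingLaw P glo δbar κ i 0 = 0 := by
  simp [trackingLaw]

theorem trackingLaw_of_ne {e : Vec (n i)} (he : e ≠ 0) :
    trackingLaw P glo δbar κ i e = -((glo / (glo - δbar) * κ i ‖e‖) •
      (‖ContinuousLinearMap.adjoint (P.g i) e‖⁻¹ • ContinuousLinearMap.adjoint (P.g i) e)) := by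
  simp [trackingLaw, he]

theorem PlantBounds.adjoint_ne_zero (hP : PlantBounds P glo ghi δbar fbar) (hlt : δbar < glo)
    (hi : i ∈ Finset.Icc 1 m) {e : Vec (n i)} (he : e ≠ 0) :
    ContinuousLinearMap.adjoint (P.g i) e ≠ 0 := by
  intro h
  have h1 := hP.le_norm_adjoint hi e
  rw [h, norm_zero] at h1
  have h2 := norm_pos_iff.2 he
  have h3 := hP.δbar_nonneg
  nlinarith

theorem norm_trackingLaw_le (hP : PlantBounds P glo ghi δbar fbar) (hlt : δbar < glo)
    (hκ : ∀ s, 0 ≤ s → 0 ≤ κ i s) (e : Vec (n i)) :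
    ‖trackingLaw P glo δbar κ i e‖ ≤ glo / (glo - δbar) * κ i ‖e‖ := by
  have hC : 0 ≤ glo / (glo - δbar) := div_nonneg hP.glo_nonneg (sub_nonneg.2 hlt.le)
  rcases eq_or_ne e 0 with rfl | he
  · rw [trackingLaw_zero, norm_zero]
    exact mul_nonneg hC (hκ _ (norm_nonneg _))
  · rw [trackingLaw_of_ne he, norm_neg, norm_smul,
      Real.norm_of_nonneg (mul_nonneg hC (hκ _ (norm_nonneg _)))]
    refine mul_le_of_le_one_right (mul_nonneg hC (hκ _ (norm_nonneg _))) ?_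
    rw [norm_smul, norm_inv, norm_norm]
    exact inv_mul_le_one_of_le₀ le_rfl (norm_nonneg _)

/-- Away from 0, the increment of the law splits into a change of magnitude, controlled by κ_i', and
a change of direction, controlled by `ghi / (glo * s)` through the normalization estimate. At 0 only
the magnitude counts, and the term κ_i(s)/s covers it. -/
theorem trackingLaw_eventually_le (hP : PlantBounds P glo ghi δbar fbar) (hlt : δbar < glo)
    (hi : i ∈ Finset.Icc 1 m) (hκ : ∀ s, 0 < s → 0 < κ i s) (hκd : Differentiable ℝ (κ i))
    (hκ' : ∀ s, 0 ≤ deriv (κ i) s) {k : ℝ}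
    (hk : ∀ s, 0 < s → glo / (glo - δbar) * (ghi / glo * (κ i s / s) + deriv (κ i) s) ≤ k)
    (e : Vec (n i)) {K : ℝ} (hK : k < K) :
    ∀ᶠ e' in 𝓝 e, ‖trackingLaw P glo δbar κ i e' - trackingLaw P glo δbar κ i e‖ ≤
      K * ‖e' - e‖ := by
  have hglo : 0 < glo := lt_of_le_of_lt hP.δbar_nonneg hlt
  have hC : 0 < glo / (glo - δbar) := div_pos hglo (sub_pos.2 hlt)
  set C := glo / (glo - δbar) with hCdef
  rcases eq_or_ne e 0 with rfl | he
  · refine Eventually.of_forall fun e' => ?_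
    rw [trackingLaw_zero, sub_zero, sub_zero]
    rcases eq_or_ne e' 0 with rfl | he'
    · simp [trackingLaw_zero]
    have hpos := norm_pos_iff.2 he'
    rw [trackingLaw_of_ne he', norm_neg, norm_smul_of_nonneg (mul_nonneg hC.le (hκ _ hpos).le),
      norm_inv_norm_smul (hP.adjoint_ne_zero hlt hi he'), mul_one]
    -- Both constants bound |g_iᵀ e'| / |e'|, from below and from above.
    have h1 : 1 ≤ ghi / glo := by
      rw [le_div_iff₀ hglo, one_mul]
      exact le_of_mul_le_mul_right ((hP.le_norm_adjoint hi e').trans (hP.norm_adjoint_le hi e')) hpos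
    have h2 := hk ‖e'‖ hpos
    have h3 : κ i ‖e'‖ / ‖e'‖ ≤ ghi / glo * (κ i ‖e'‖ / ‖e'‖) + deriv (κ i) ‖e'‖ := by
      nlinarith [hκ' ‖e'‖, div_pos (hκ _ hpos) hpos]
    have h4 : C * (κ i ‖e'‖ / ‖e'‖) ≤ K :=
      (mul_le_mul_of_nonneg_left h3 hC.le).trans (h2.trans hK.le)
    calc C * κ i ‖e'‖ = C * (κ i ‖e'‖ / ‖e'‖) * ‖e'‖ := by field_simp
      _ ≤ K * ‖e'‖ := mul_le_mul_of_nonneg_right h4 hpos.le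
  · have hpos := norm_pos_iff.2 he
    have hκe := hκ _ hpos
    set s := ‖e‖ with hs
    -- One margin ε is spent on both rates, of κ_i and of the direction; this choice makes the total
    -- cost exactly K - k.
    set ε := (K - k) / (C * κ i s + C) with hε
    have hden : 0 < C * κ i s + C := add_pos (mul_pos hC hκe) hC
    have hε0 : 0 < ε := div_pos (sub_pos.2 hK) hden
    have hεe : ε * (C * κ i s + C) = K - k := div_mul_cancel₀ _ hden.ne'
    set q := ghi / (glo * s) + ε with hq
    have hq0 : 0 < q := add_pos_of_nonneg_of_pos
      (div_nonneg hP.ghi_nonneg (mul_pos hglo hpos).le) hε0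
    have hcond : ∀ᶠ e' : Vec (n i) in 𝓝 e, ghi ^ 2 / (glo ^ 2 * s * ‖e'‖) < q ^ 2 := by
      have h1 : ContinuousAt (fun e' : Vec (n i) => ghi ^ 2 / (glo ^ 2 * s * ‖e'‖)) e :=
        ContinuousAt.div (by fun_prop) (by fun_prop) (by positivity)
      refine h1.eventually (gt_mem_nhds ?_)
      have : ghi ^ 2 / (glo ^ 2 * s * s) = (ghi / (glo * s)) ^ 2 := by
        rw [div_pow]; congr 1; ring
      change ghi ^ 2 / (glo ^ 2 * s * s) < q ^ 2
      rw [this]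
      exact pow_lt_pow_left₀ (by linarith)
        (div_nonneg hP.ghi_nonneg (mul_pos hglo hpos).le) two_ne_zero
    have hκcond : ∀ᶠ e' : Vec (n i) in 𝓝 e,
        |κ i ‖e'‖ - κ i s| ≤ (deriv (κ i) s + ε) * ‖e' - e‖ := by
      have h1 := ((hκd s).hasDerivAt.hasFDerivAt.isLittleO.def hε0)
      have h2 : Tendsto (fun e' : Vec (n i) => ‖e'‖) (𝓝 e) (𝓝 s) := continuous_norm.tendsto e
      filter_upwards [h2.eventually h1] with e' h3
      simp only [ContinuousLinearMap.toSpanSingleton_apply, smul_eq_mul, Real.norm_eq_abs] at h3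
      have h4 : |‖e'‖ - s| ≤ ‖e' - e‖ := abs_norm_sub_norm_le e' e
      have h5 := abs_add_le (κ i ‖e'‖ - κ i s - (‖e'‖ - s) * deriv (κ i) s)
        ((‖e'‖ - s) * deriv (κ i) s)
      rw [sub_add_cancel, abs_mul, abs_of_nonneg (hκ' s)] at h5
      have h6 := mul_le_mul_of_nonneg_right h4 (hκ' s)
      have h7 := mul_le_mul_of_nonneg_left h4 hε0.le
      linarith
    filter_upwards [hcond, hκcond, isOpen_ne.mem_nhds he] with e' h1 h2 he'
    have hpos' := norm_pos_iff.2 he'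
    have hp := hP.adjoint_ne_zero hlt hi he
    have hp' := hP.adjoint_ne_zero hlt hi he'
    set p := ContinuousLinearMap.adjoint (P.g i) e with hpdef
    set p' := ContinuousLinearMap.adjoint (P.g i) e' with hpdef'
    have hψ : ‖‖p'‖⁻¹ • p' - ‖p‖⁻¹ • p‖ ≤ q * ‖e' - e‖ := by
      refine le_of_sq_le_sq ?_ (by positivity)
      have h3 : ‖p' - p‖ ≤ ghi * ‖e' - e‖ := by
        rw [hpdef, hpdef', ← map_sub]; exact hP.norm_adjoint_le hi _
      have h4 : glo ^ 2 * s * ‖e'‖ ≤ ‖p‖ * ‖p'‖ := by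
        have := mul_le_mul (hP.le_norm_adjoint hi e) (hP.le_norm_adjoint hi e')
          (by positivity) (norm_nonneg _)
        calc glo ^ 2 * s * ‖e'‖ = glo * ‖e‖ * (glo * ‖e'‖) := by rw [hs]; ring
          _ ≤ _ := this
      calc ‖‖p'‖⁻¹ • p' - ‖p‖⁻¹ • p‖ ^ 2 ≤ ‖p' - p‖ ^ 2 / (‖p‖ * ‖p'‖) :=
            norm_normalize_sub_sq_le hp hp'
        _ ≤ (ghi * ‖e' - e‖) ^ 2 / (glo ^ 2 * s * ‖e'‖) :=
            div_le_div₀ (by positivity) (pow_le_pow_left₀ (norm_nonneg _) h3 2) (by positivity) h4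
        _ = ghi ^ 2 / (glo ^ 2 * s * ‖e'‖) * ‖e' - e‖ ^ 2 := by ring
        _ ≤ q ^ 2 * ‖e' - e‖ ^ 2 := mul_le_mul_of_nonneg_right h1.le (sq_nonneg _)
        _ = (q * ‖e' - e‖) ^ 2 := by ring
    have hdecomp : trackingLaw P glo δbar κ i e' - trackingLaw P glo δbar κ i e =
        -((C * (κ i ‖e'‖ - κ i s)) • (‖p'‖⁻¹ • p') +
          (C * κ i s) • (‖p'‖⁻¹ • p' - ‖p‖⁻¹ • p)) := by
      rw [trackingLaw_of_ne he, trackingLaw_of_ne he', ← hpdef, ← hpdef', ← hCdef, ← hs]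
      module
    have hsum : ‖trackingLaw P glo δbar κ i e' - trackingLaw P glo δbar κ i e‖ ≤
        C * ((deriv (κ i) s + ε) * ‖e' - e‖) + C * κ i s * (q * ‖e' - e‖) := by
      rw [hdecomp, norm_neg]
      refine (norm_add_le _ _).trans (add_le_add ?_ ?_)
      · rw [norm_smul, norm_inv_norm_smul hp', mul_one, Real.norm_eq_abs, abs_mul,
          abs_of_pos hC]
        exact mul_le_mul_of_nonneg_left h2 hC.le
      · rw [norm_smul_of_nonneg (mul_pos hC hκe).le]
        exact mul_le_mul_of_nonneg_left hψ (mul_pos hC hκe).le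
    have h3 : C * (deriv (κ i) s + ε) + C * κ i s * q ≤ K := by
      have h4 := hk s hpos
      have h5 : C * κ i s * (ghi / (glo * s)) = C * (ghi / glo * (κ i s / s)) := by
        field_simp
      have h6 : C * (deriv (κ i) s + ε) + C * κ i s * q =
          C * (ghi / glo * (κ i s / s) + deriv (κ i) s) + ε * (C * κ i s + C) := by
        rw [hq, mul_add (C * κ i s), h5]; ring
      rw [h6, hεe]
      linarith
    calc _ ≤ _ := hsum
      _ = (C * (deriv (κ i) s + ε) + C * κ i s * q) * ‖e' - e‖ := by ring
      _ ≤ K * ‖e' - e‖ := mul_le_mul_of_nonneg_right h3 (norm_nonneg _)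

/-- The decrease of `|e|` along the `i`-th subsystem. -/
theorem tracking_decrease (hP : PlantBounds P glo ghi δbar fbar) (hlt : δbar < glo)
    (hi : i ∈ Finset.Icc 1 m) (hκ : ∀ s, 0 < s → 0 < κ i s) {e : Vec (n i)} (he : e ≠ 0)
    (e' : Vec (n (i + 1))) {A : Vec (n (i + 1)) →L[ℝ] Vec (n i)} (hA : ‖A‖ ≤ δbar)
    {F : Vec (n i)} {L S θ : ℝ} (hF : ‖F‖ + L ≤ S) (hS : 0 ≤ S) (hθ : 0 ≤ θ)
    (h : θ * ‖e‖ + (glo + δbar) / glo * ‖e'‖ + 1 / glo * S ≤ κ i ‖e‖) :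
    ⟪e, F + (P.g i + A) (trackingLaw P glo δbar κ i e + e')⟫ / ‖e‖ + L ≤ -(glo * θ * ‖e‖) := by
  have hδ := hP.δbar_nonneg
  have hglo : 0 < glo := lt_of_le_of_lt hδ hlt
  have hd : 0 < glo - δbar := sub_pos.2 hlt
  have hC : 0 < glo / (glo - δbar) := div_pos hglo hd
  have hpos := norm_pos_iff.2 he
  have hκe := hκ _ hpos
  have hp := hP.adjoint_ne_zero hlt hi he
  have hpn := norm_pos_iff.2 hp
  have hle := hP.le_norm_adjoint hi e
  set p := ContinuousLinearMap.adjoint (P.g i) e with hpdef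
  set r := trackingLaw P glo δbar κ i e with hr
  set w := glo / (glo - δbar) * κ i ‖e‖ with hw
  have hw0 : 0 < w := mul_pos hC hκe
  have hrn : ‖r‖ ≤ w := by
    rw [hr, trackingLaw_of_ne he, norm_neg, norm_smul_of_nonneg hw0.le,
      norm_inv_norm_smul hp, mul_one]
  have hpr : ⟪p, r⟫ = -(w * ‖p‖) := by
    rw [hr, trackingLaw_of_ne he, inner_neg_right, inner_smul_right, inner_smul_right,
      ← hpdef, ← hw, real_inner_self_eq_norm_sq]
    field_simp
  have hAx : ∀ y : Vec (n (i + 1)), ⟪e, A y⟫ ≤ ‖e‖ * (δbar * ‖y‖) := fun y =>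
    (real_inner_le_norm _ _).trans (mul_le_mul_of_nonneg_left
      ((A.le_opNorm y).trans (mul_le_mul_of_nonneg_right hA (norm_nonneg y))) hpos.le)
  have hin : ⟪e, F + (P.g i + A) (r + e')⟫ =
      ⟪e, F⟫ + ⟪p, r⟫ + ⟪p, e'⟫ + ⟪e, A r⟫ + ⟪e, A e'⟫ := by
    simp only [add_apply, map_add, inner_add_right, hpdef,
      ContinuousLinearMap.adjoint_inner_left]
    ring
  have h1 : ⟪e, F + (P.g i + A) (r + e')⟫ ≤
      ‖e‖ * ‖F‖ - w * ‖p‖ + ‖p‖ * ‖e'‖ + ‖e‖ * (δbar * w) + ‖e‖ * (δbar * ‖e'‖) := by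
    rw [hin, hpr]
    have h2 := hAx r
    have h3 := mul_le_mul_of_nonneg_left (mul_le_mul_of_nonneg_left hrn hδ) hpos.le
    linarith [real_inner_le_norm e F, real_inner_le_norm p e', hAx e']
  -- `G` is the effective input gain in the direction of `e`; the design only knows that it is at
  -- least `glo`.
  set G := ‖p‖ / ‖e‖ with hG
  have hGle : glo ≤ G := (le_div_iff₀ hpos).2 hle
  have hGp : ‖p‖ = G * ‖e‖ := (div_mul_cancel₀ _ hpos.ne').symm
  have h2 : ⟪e, F + (P.g i + A) (r + e')⟫ / ‖e‖ ≤
      ‖F‖ - w * (G - δbar) + (G + δbar) * ‖e'‖ := by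
    rw [div_le_iff₀ hpos]
    rw [hGp] at h1
    linarith
  -- A larger gain multiplies the damping by `lam`, while the effect of e' grows by at most that
  -- factor, since (G + δ)/(G - δ) decreases in G. The worst case is therefore G = glo.
  set lam := (G - δbar) / (glo - δbar) with hlam
  have hlam1 : 1 ≤ lam := (one_le_div hd).2 (by linarith)
  have h3 : w * (G - δbar) = lam * (glo * κ i ‖e‖) := by
    rw [hw, hlam]; ring
  have h4 : glo * θ * ‖e‖ + (glo + δbar) * ‖e'‖ + S ≤ glo * κ i ‖e‖ := by
    have := mul_le_mul_of_nonneg_left h hglo.le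
    refine le_trans (le_of_eq ?_) this
    field_simp
  have h5 : lam * (glo * θ * ‖e‖ + (glo + δbar) * ‖e'‖ + S) ≤ w * (G - δbar) := by
    rw [h3]; exact mul_le_mul_of_nonneg_left h4 (by linarith)
  have h6 : (G + δbar) * ‖e'‖ ≤ lam * ((glo + δbar) * ‖e'‖) := by
    rw [← mul_assoc]
    refine mul_le_mul_of_nonneg_right ?_ (norm_nonneg _)
    rw [hlam, div_mul_eq_mul_div, le_div_iff₀ hd]
    nlinarith [mul_nonneg hδ (sub_nonneg.2 hGle)]
  have h7 : S ≤ lam * S := le_mul_of_one_le_left hS hlam1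
  have h8 : glo * θ * ‖e‖ ≤ lam * (glo * θ * ‖e‖) :=
    le_mul_of_one_le_left (by positivity) hlam1
  linarith

end TrackingLaw

/-! ### Sums of gains -/

theorem sum_Icc_one_add_two (f : ℕ → ℝ) (p : ℕ) :
    ∑ l ∈ Finset.Icc 1 (p + 2), f l = f 1 + (f 2 + ∑ j ∈ Finset.Icc 2 (p + 1), f (j + 1)) := by
  induction p with
  | zero => simp [Finset.sum_Icc_succ_top]
  | succ p ih =>
    rw [Finset.sum_Icc_succ_top (by omega), ih, Finset.sum_Icc_succ_top (a := 2) (b := p + 1) (by omega)]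
    ring

theorem sum_Icc_one_add_one (f : ℕ → ℝ) (p : ℕ) :
    ∑ l ∈ Finset.Icc 1 (p + 1), f l = f 1 + ∑ j ∈ Finset.Icc 2 (p + 1), f j := by
  induction p with
  | zero => simp
  | succ p ih =>
    rw [Finset.sum_Icc_succ_top (by omega), ih, Finset.sum_Icc_succ_top (a := 2) (b := p + 1) (by omega)]
    ring

theorem add_sum_Icc_two_shift (f : ℕ → ℝ) (p : ℕ) :
    f 2 + ∑ j ∈ Finset.Icc 2 (p + 1), f (j + 1) = ∑ j ∈ Finset.Icc 2 (p + 1), f j + f (p + 2) := by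
  linarith [sum_Icc_one_add_two f p, sum_Icc_one_add_one f p,
    Finset.sum_Icc_succ_top (a := 1) (b := p + 1) (by omega) f]

theorem fin_sum_eq_sum_Icc (f : ℕ → ℝ) (i : ℕ) :
    ∑ k : Fin i, f (k.val + 1) = ∑ l ∈ Finset.Icc 1 i, f l := by
  rw [Fin.sum_univ_eq_sum_range (fun k => f (k + 1))]
  induction i with
  | zero => simp
  | succ i ih => rw [Finset.sum_range_succ, ih, Finset.sum_Icc_succ_top (by omega)]

theorem kbar_self (k : ℕ → ℝ) (i : ℕ) : kbar k i i = k i := by simp [kbar]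

theorem kbar_succ (k : ℕ → ℝ) {p i : ℕ} (hpi : p ≤ i) :
    kbar k p (i + 1) = k (i + 1) * kbar k p i := by
  rw [kbar, kbar, if_pos hpi, if_pos (by omega), Finset.prod_Icc_succ_top (by omega), mul_comm]

theorem kbar_nonneg {k : ℕ → ℝ} {p i : ℕ} (hk : ∀ j ∈ Finset.Icc p i, 0 ≤ k j) :
    0 ≤ kbar k p i := by
  unfold kbar
  split_ifs
  · exact Finset.prod_nonneg hk
  · exact le_rfl

theorem kbreve_succ_self (k : ℕ → ℝ) (i : ℕ) : kbreve k (i + 1) i = 1 := by simp [kbreve]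

theorem kbar_nonneg_of_one_le {k : ℕ → ℝ} {p i : ℕ} (hk : ∀ j ∈ Finset.Icc 1 i, 0 ≤ k j)
    (hp : 1 ≤ p) : 0 ≤ kbar k p i :=
  kbar_nonneg fun j hj => hk j (by simp only [Finset.mem_Icc] at hj ⊢; omega)

theorem kbreve_nonneg {k : ℕ → ℝ} {p i : ℕ} (hk : ∀ j ∈ Finset.Icc 1 i, 0 ≤ k j)
    (hp : 1 ≤ p) : 0 ≤ kbreve k p i :=
  add_nonneg zero_le_one (Finset.sum_nonneg fun j hj =>
    kbar_nonneg_of_one_le hk (by simp only [Finset.mem_Icc] at hj; omega))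

theorem kbreve_succ_le {k : ℕ → ℝ} {p i : ℕ} (hk : ∀ j ∈ Finset.Icc 1 i, 0 ≤ k j)
    (hp : 1 ≤ p) : kbreve k (p + 1) i ≤ kbreve k p i := by
  refine add_le_add_right (Finset.sum_le_sum_of_subset_of_nonneg
    (Finset.Icc_subset_Icc_left (Nat.le_succ p)) fun j hj _ => ?_) 1
  exact kbar_nonneg_of_one_le hk (by simp only [Finset.mem_Icc] at hj; omega)

/-- Speeds that are bounded through `φ` and `ξ`, weighted by the Lipschitz constants. -/
theorem sum_kbar_mul_le {k φ ξ s : ℕ → ℝ} {G : ℝ} {i : ℕ}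
    (hk : ∀ j ∈ Finset.Icc 1 (i - 1), 0 ≤ k j)
    (hs : ∀ j ∈ Finset.Icc 1 (i - 1), s j ≤ ∑ l ∈ Finset.Icc 1 j, φ l + G * ξ (j + 1)) :
    ∑ l ∈ Finset.Icc 1 i, φ l + ∑ j ∈ Finset.Icc 1 (i - 1), kbar k j (i - 1) * s j ≤
      ∑ l ∈ Finset.Icc 1 i, kbreve k l (i - 1) * φ l +
        G * ∑ j ∈ Finset.Icc 1 (i - 1), kbar k j (i - 1) * ξ (j + 1) := by
  have h1 : ∑ j ∈ Finset.Icc 1 (i - 1), kbar k j (i - 1) * s j ≤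
      ∑ j ∈ Finset.Icc 1 (i - 1),
        (kbar k j (i - 1) * ∑ l ∈ Finset.Icc 1 j, φ l + G * (kbar k j (i - 1) * ξ (j + 1))) := by
    refine Finset.sum_le_sum fun j hj => ?_
    have h0 : 0 ≤ kbar k j (i - 1) :=
      kbar_nonneg_of_one_le hk (Finset.mem_Icc.1 hj).1
    refine (mul_le_mul_of_nonneg_left (hs j hj) h0).trans_eq ?_
    ring
  -- Exchange of summation over pairs l ≤ j ≤ i - 1. For l = i the inner sum is empty, which leaves
  -- the weight 1.
  have h2 : ∑ j ∈ Finset.Icc 1 (i - 1), kbar k j (i - 1) * ∑ l ∈ Finset.Icc 1 j, φ l =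
      ∑ l ∈ Finset.Icc 1 i, (∑ j ∈ Finset.Icc l (i - 1), kbar k j (i - 1)) * φ l := by
    simp only [Finset.mul_sum, Finset.sum_mul]
    refine Finset.sum_comm' fun j l => ?_
    simp only [Finset.mem_Icc]
    omega
  rw [Finset.sum_add_distrib, h2, ← Finset.mul_sum] at h1
  have h3 : ∑ l ∈ Finset.Icc 1 i, kbreve k l (i - 1) * φ l = ∑ l ∈ Finset.Icc 1 i, φ l +
      ∑ l ∈ Finset.Icc 1 i, (∑ j ∈ Finset.Icc l (i - 1), kbar k j (i - 1)) * φ l := by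
    rw [← Finset.sum_add_distrib]
    refine Finset.sum_congr rfl fun l _ => ?_
    rw [kbreve]; ring
  linarith

/-- The total disturbance of the `i`-th tracking error is bounded by the gains. -/
theorem disturbance_le {glo ghi δbar ρbar : ℝ} {fbar : ℕ → ℝ → ℝ} {T : TrackingDesign} {i : ℕ}
    (hi : 2 ≤ i) (hG : 0 ≤ ghi + δbar) (hk : ∀ j ∈ Finset.Icc 1 (i - 1), 0 ≤ T.k j)
    (hf : ∀ j ∈ Finset.Icc 2 i, IsClassKOrZero (fbar j)) {y ξ s : ℕ → ℝ} (hy : ∀ j, 0 ≤ y j)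
    (hξ0 : ∀ j, 0 ≤ ξ j) (hρ : 0 ≤ ρbar) (hγ : 0 ≤ T.γV (y 1))
    (hκ : ∀ j ∈ Finset.Icc 2 (i - 1), 0 ≤ glo / (glo - δbar) * T.κ j (y j))
    (h1 : fbar 1 (ξ 1) ≤ T.cx₁) (h2 : ξ 2 ≤ y 2 + T.γV (y 1) + ρbar)
    (hξ : ∀ j ∈ Finset.Icc 2 (i - 1), ξ (j + 1) ≤ y (j + 1) + glo / (glo - δbar) * T.κ j (y j))
    (hs : ∀ j ∈ Finset.Icc 1 (i - 1), s j ≤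
      ∑ l ∈ Finset.Icc 1 j, fbar l (ξ l) + (ghi + δbar) * ξ (j + 1)) :
    ∑ l ∈ Finset.Icc 1 i, fbar l (ξ l) + ∑ j ∈ Finset.Icc 1 (i - 1), kbar T.k j (i - 1) * s j ≤
      gainX₁ T i T.cx₁ + gainRho₀ ghi δbar fbar T i ρbar +
        ∑ j ∈ Finset.Icc 1 (i - 1), gain glo ghi δbar fbar T i j (y j) +
        gainDiag ghi δbar fbar T i (y i) := by
  obtain ⟨p, rfl⟩ := Nat.exists_eq_add_of_le' hi
  refine (sum_kbar_mul_le hk hs).trans ?_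
  simp only [show p + 2 - 1 = p + 1 by omega] at *
  set G := ghi + δbar with hGdef
  set I := Finset.Icc 2 (p + 1) with hI
  have hkb : ∀ j, 1 ≤ j → 0 ≤ kbreve T.k j (p + 1) := fun j hj => kbreve_nonneg hk hj
  have hka : ∀ j, 1 ≤ j → 0 ≤ kbar T.k j (p + 1) := fun j hj => kbar_nonneg_of_one_le hk hj
  have hfi : ∀ j ∈ I, IsClassKOrZero (fbar (j + 1)) := fun j hj => hf _ (by
    simp only [hI, Finset.mem_Icc] at hj ⊢; omega)
  set w : ℕ → ℝ := fun j => glo / (glo - δbar) * T.κ j (y j) with hw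
  have hφ2 : fbar 2 (ξ 2) ≤ fbar 2 (2 * y 2) + (fbar 2 (4 * T.γV (y 1)) + fbar 2 (4 * ρbar)) :=
    (hf 2 (by simp)).le_four_mul (hξ0 2) (hy 2) hγ hρ h2
  have hφ : ∀ j ∈ I, fbar (j + 1) (ξ (j + 1)) ≤
      fbar (j + 1) (2 * y (j + 1)) + fbar (j + 1) (2 * w j) := fun j hj =>
    (hfi j hj).le_two_mul (hξ0 _) (hy _) (hκ j hj) (hξ j hj)
  have hfw : ∀ j ∈ I, 0 ≤ fbar (j + 1) (2 * w j) := fun j hj =>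
    (hfi j hj).nonneg (mul_nonneg zero_le_two (hκ j hj))
  have hI1 : ∀ j ∈ I, 1 ≤ j := fun j hj => by simp only [hI, Finset.mem_Icc] at hj; omega
  -- In the κ_j terms the weight is raised from index j + 1 to j, the one that occurs in α_{i,j}.
  have e1 : ∑ j ∈ I, kbreve T.k (j + 1) (p + 1) * fbar (j + 1) (ξ (j + 1)) ≤
      ∑ j ∈ I, kbreve T.k (j + 1) (p + 1) * fbar (j + 1) (2 * y (j + 1)) +
        ∑ j ∈ I, kbreve T.k j (p + 1) * fbar (j + 1) (2 * w j) := by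
    rw [← Finset.sum_add_distrib]
    refine Finset.sum_le_sum fun j hj => ?_
    have e := mul_le_mul_of_nonneg_left (hφ j hj) (hkb (j + 1) (by omega))
    have e' := mul_le_mul_of_nonneg_right (kbreve_succ_le hk (hI1 j hj)) (hfw j hj)
    linarith
  have e2 : ∑ j ∈ I, kbar T.k j (p + 1) * ξ (j + 1) ≤
      ∑ j ∈ I, kbar T.k j (p + 1) * y (j + 1) + ∑ j ∈ I, kbar T.k j (p + 1) * w j := by
    rw [← Finset.sum_add_distrib]
    refine Finset.sum_le_sum fun j hj => ?_
    have e := mul_le_mul_of_nonneg_left (hξ j hj) (hka j (hI1 j hj))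
    linarith
  -- The terms in y_{j+1} are collected under the index j + 1; the last of them has index i, weight
  -- 1 or k_{i-1}, and goes into `gainDiag`.
  have e3 := add_sum_Icc_two_shift (fun j => kbreve T.k j (p + 1) * fbar j (2 * y j)) p
  have e4 := add_sum_Icc_two_shift (fun j => kbar T.k (j - 1) (p + 1) * y j) p
  simp only [kbreve_succ_self, show 2 - 1 = 1 from rfl, show p + 2 - 1 = p + 1 by omega, kbar_self,
    add_tsub_cancel_right, one_mul, ← hI] at e3 e4
  have e5 : ∑ j ∈ Finset.Icc 1 (p + 1), gain glo ghi δbar fbar T (p + 2) j (y j) =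
      (kbreve T.k 2 (p + 1) * fbar 2 (4 * T.γV (y 1)) + kbar T.k 1 (p + 1) * G * T.γV (y 1)) +
      (∑ j ∈ I, kbreve T.k j (p + 1) * fbar j (2 * y j) +
        ∑ j ∈ I, kbreve T.k j (p + 1) * fbar (j + 1) (2 * w j) +
        G * (∑ j ∈ I, kbar T.k j (p + 1) * w j + ∑ j ∈ I, kbar T.k (j - 1) (p + 1) * y j)) := by
    rw [sum_Icc_one_add_one, ← Finset.sum_add_distrib, ← Finset.sum_add_distrib, Finset.mul_sum,
      ← Finset.sum_add_distrib]
    congr 1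
    refine Finset.sum_congr rfl fun j hj => ?_
    have hj1 : j ≠ 1 := by simp only [hI, Finset.mem_Icc] at hj; omega
    rw [gain, if_neg hj1, hw, hGdef, show p + 2 - 1 = p + 1 by omega]
    have c1 : glo * T.κ j (y j) / (glo - δbar) = glo / (glo - δbar) * T.κ j (y j) := by ring
    have c2 : 2 * glo * T.κ j (y j) / (glo - δbar) = 2 * (glo / (glo - δbar) * T.κ j (y j)) := by
      ring
    rw [c1, c2]
  rw [e5, sum_Icc_one_add_two, sum_Icc_one_add_one (fun j => kbar T.k j (p + 1) * ξ (j + 1)),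
    ← hI, gainX₁, gainRho₀, gainDiag, show p + 2 - 1 = p + 1 by omega]
  have f1 := mul_le_mul_of_nonneg_left h1 (hkb 1 le_rfl)
  have f2 := mul_le_mul_of_nonneg_left hφ2 (hkb 2 (by omega))
  have f3 := mul_le_mul_of_nonneg_left h2 (hka 1 le_rfl)
  have f4 := mul_le_mul_of_nonneg_left (add_le_add f3 e2) hG
  have e6 : G * (kbar T.k 1 (p + 1) * (y 2 + T.γV (y 1) + ρbar) +
      (∑ j ∈ I, kbar T.k j (p + 1) * y (j + 1) + ∑ j ∈ I, kbar T.k j (p + 1) * w j)) =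
      G * (kbar T.k 1 (p + 1) * y 2 + ∑ j ∈ I, kbar T.k j (p + 1) * y (j + 1)) +
      G * (kbar T.k 1 (p + 1) * (T.γV (y 1) + ρbar) + ∑ j ∈ I, kbar T.k j (p + 1) * w j) := by
    ring
  rw [e6, e4] at f4
  simp only [show (1 : ℕ) + 1 = 2 from rfl]
  linarith

/-! ### The decrease of the certificates -/

/-- Multiply the robust constraint by |g_1ᵀ∇V_j|: its ε-term absorbs the uncertainty acting on the
safety law, and the condition on α_j absorbs the drift and the tracking error. What remains is -θ
V_j times |g_1ᵀ∇V_j| ≥ η glo. -/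
theorem certificate_decrease (hm : 1 ≤ m) (hnc : 1 ≤ nc) {P : Plant m n} {glo ghi δbar : ℝ}
    {fbar : ℕ → ℝ → ℝ} {γ₁₂ : ℝ → ℝ} {X : Set (Vec (n 1))} {V : Fin nc → Vec (n 1) → ℝ}
    {v : Fin nc → ℝ} {η : ℝ} {D : SafetyDesign nc nl (n 2)}
    (hP : PlantBounds P glo ghi δbar fbar)
    (hV : CertificateAssumption X V v η) (hX : SegmentsCross X V v)
    (hD : SafetyConditions glo δbar (fbar 1) γ₁₂ X V v D) (ρ₀ : Vec (n 1) → Vec (n 2))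
    {x : Vec (n 1)} (hx : x ∈ X) {j : Fin nc} (hj : D.c j ≤ V j x) {e : Vec (n 2)}
    (he : γ₁₂ ‖e‖ ≤ V j x) {A : Vec (n 2) →L[ℝ] Vec (n 1)} (hA : ‖A‖ ≤ δbar)
    {F : Vec (n 1)} (hF : ‖F‖ ≤ fbar 1 ‖x‖) :
    ⟪gradient (V j) x, F + (P.g 1 + A) (safetyLaw P glo δbar V v D ρ₀ x + e)⟫ ≤
      -(η * glo * D.θ * V j x) := by
  have hδ := hP.δbar_nonneg
  have hglo : 0 < glo := lt_of_le_of_lt hδ hD.δbar_lt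
  have h1m : 1 ∈ Finset.Icc 1 m := by simp [hm]
  have hVpos := hV.pos j hx
  have hvj := hV.v_pos j
  have hcj := hD.c_gt j
  have hcpos : 0 < D.c j := hvj.trans hcj
  have hf0 : 0 ≤ fbar 1 ‖x‖ := (hP.fbar_class 1 h1m).nonneg (norm_nonneg x)
  have hε0 : 0 ≤ δbar / glo := div_nonneg hδ hglo.le
  have key : D.θ * V j x + (1 + δbar / glo) * ‖e‖ + 1 / glo * fbar 1 ‖x‖ ≤
      D.αj j (V j x - v j) := by
    have h1 := hD.αj_ge j x hx hj
    have h2 : ENNReal.ofReal ‖e‖ ≤ inv γ₁₂ (ENNReal.ofReal (V j x)) :=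
      le_compInv (h := fun a => a) (norm_nonneg e) he
    have h3 : ENNReal.ofReal (D.θ * V j x + (1 + δbar / glo) * ‖e‖ + 1 / glo * fbar 1 ‖x‖) ≤
        ENNReal.ofReal (D.αj j ((D.c j - v j) / D.c j * V j x)) := by
      refine le_trans ?_ h1
      have hθV : 0 ≤ D.θ * V j x := (mul_pos hD.θ_pos hVpos).le
      rw [ENNReal.ofReal_add (by positivity) (by positivity),
        ENNReal.ofReal_add (by positivity) (by positivity),
        ENNReal.ofReal_mul (by positivity : 0 ≤ 1 + δbar / glo)]
      gcongr
    have hθV : 0 < D.θ * V j x := mul_pos hD.θ_pos hVpos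
    have hsum : 0 < D.θ * V j x + (1 + δbar / glo) * ‖e‖ + 1 / glo * fbar 1 ‖x‖ := by positivity
    have h4 : D.θ * V j x + (1 + δbar / glo) * ‖e‖ + 1 / glo * fbar 1 ‖x‖ ≤
        D.αj j ((D.c j - v j) / D.c j * V j x) := by
      rcases ENNReal.ofReal_le_ofReal_iff'.1 h3 with h | h
      · exact h
      · linarith
    refine h4.trans ((hD.αj_strictMonoOn j).monotoneOn ?_ (by simpa using hVpos) ?_)
    · have : 0 ≤ (D.c j - v j) / D.c j * V j x :=
        mul_nonneg (div_nonneg (by linarith) hcpos.le) hVpos.le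
      exact lt_of_lt_of_le (neg_lt_zero.2 hvj) this
    · have : (D.c j - v j) / D.c j * V j x = V j x - v j * (V j x / D.c j) := by
        field_simp
      rw [this]
      have h5 : 1 ≤ V j x / D.c j := (one_le_div hcpos).2 hj
      nlinarith
  have hcone : ⟪rowA P V x j, safetyLaw P glo δbar V v D ρ₀ x⟫ +
      δbar / glo * ‖safetyLaw P glo δbar V v D ρ₀ x‖ ≤ -D.αj j (V j x - v j) :=
    safetyLaw_mem_coneSet hm hnc hP hV hX hD ρ₀ hx j
  set u := safetyLaw P glo δbar V v D ρ₀ x with hu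
  set d := gradient (V j) x with hd
  have hd0 : d ≠ 0 := hV.grad_ne_zero j x hx
  have hdn := norm_pos_iff.2 hd0
  have hp := hP.adjoint_ne_zero hD.δbar_lt h1m hd0
  have hle := hP.le_norm_adjoint h1m d
  set p := ContinuousLinearMap.adjoint (P.g 1) d with hpdef
  have hpn := norm_pos_iff.2 hp
  have hrow : ⟪p, u⟫ = ‖p‖ * ⟪rowA P V x j, u⟫ := by
    rw [rowA, ← hd, ← hpdef, inner_smul_left, conj_trivial, mul_inv_cancel_left₀ hpn.ne']
  have hAx : ∀ y : Vec (n 2), ⟪d, A y⟫ ≤ ‖d‖ * (δbar * ‖y‖) := fun y =>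
    (real_inner_le_norm _ _).trans (mul_le_mul_of_nonneg_left
      ((A.le_opNorm y).trans (mul_le_mul_of_nonneg_right hA (norm_nonneg y))) hdn.le)
  have hin : ⟪d, F + (P.g 1 + A) (u + e)⟫ = ⟪d, F⟫ + ⟪p, u⟫ + ⟪p, e⟫ + ⟪d, A u⟫ + ⟪d, A e⟫ := by
    simp only [add_apply, map_add, inner_add_right, hpdef,
      ContinuousLinearMap.adjoint_inner_left]
    ring
  have hdp : ‖d‖ ≤ ‖p‖ / glo := by rw [le_div_iff₀ hglo]; linarith
  have b1 : ⟪d, F⟫ ≤ ‖p‖ / glo * fbar 1 ‖x‖ :=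
    (real_inner_le_norm _ _).trans (mul_le_mul hdp hF (norm_nonneg _) (by positivity))
  have b2 : ∀ y : Vec (n 2), ⟪d, A y⟫ ≤ ‖p‖ / glo * (δbar * ‖y‖) := fun y =>
    (hAx y).trans (mul_le_mul_of_nonneg_right hdp (by positivity))
  have b3 : ⟪d, F + (P.g 1 + A) (u + e)⟫ ≤ ‖p‖ * (-(D.θ * V j x)) := by
    rw [hin, hrow]
    have c1 := mul_le_mul_of_nonneg_left hcone hpn.le
    have c2 := mul_le_mul_of_nonneg_left key hpn.le
    have c3 := real_inner_le_norm p e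
    have c4 := b2 u
    have c5 := b2 e
    have c6 : ‖p‖ / glo * fbar 1 ‖x‖ = ‖p‖ * (1 / glo * fbar 1 ‖x‖) := by ring
    have c7 : ∀ r : ℝ, ‖p‖ / glo * (δbar * r) = ‖p‖ * (δbar / glo * r) := fun r => by ring
    rw [c7] at c4 c5
    rw [c6] at b1
    linarith
  have hη : η ≤ ‖d‖ := hV.le_grad j x hx (by linarith)
  have hηp : η * glo ≤ ‖p‖ := by nlinarith
  have hθV : 0 < D.θ * V j x := mul_pos hD.θ_pos hVpos
  nlinarith

/-! ### Closed-loop trajectories -/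

theorem continuousAt_of_eventually_le {E F : Type*} [NormedAddCommGroup E] [NormedAddCommGroup F]
    {ρ : E → F} {x : E} {K : ℝ} (h : ∀ᶠ y in 𝓝 x, ‖ρ y - ρ x‖ ≤ K * ‖y - x‖) :
    ContinuousAt ρ x := by
  rw [ContinuousAt, tendsto_iff_norm_sub_tendsto_zero]
  have h1 : Tendsto (fun y => K * ‖y - x‖) (𝓝 x) (𝓝 0) := by
    have : Tendsto (fun y => K * ‖y - x‖) (𝓝 x) (𝓝 (K * ‖x - x‖)) :=
      Continuous.tendsto (by fun_prop) x
    rwa [sub_self, norm_zero, mul_zero] at this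
  exact squeeze_zero' (Eventually.of_forall fun _ => norm_nonneg _) h h1

theorem virtualInput_succ (ρ₁ : Vec (n 1) → Vec (n 2)) (ρ : ∀ i, Vec (n i) → Vec (n (i + 1)))
    (x : ∀ i, Vec (n i)) {i : ℕ} (hi : 2 ≤ i) :
    virtualInput ρ₁ ρ x (i + 1) = ρ i (x i - virtualInput ρ₁ ρ x i) := by
  obtain ⟨k, rfl⟩ := Nat.exists_eq_add_of_le' hi
  rfl

theorem virtualInput_two (ρ₁ : Vec (n 1) → Vec (n 2)) (ρ : ∀ i, Vec (n i) → Vec (n (i + 1)))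
    (x : ∀ i, Vec (n i)) : virtualInput ρ₁ ρ x 2 = ρ₁ (x 1) := rfl

/-- The right-hand side of the `i`-th subsystem along `x`. -/
def velocity (P : Plant m n) (x : ∀ i, ℝ → Vec (n i)) (i : ℕ) (t : ℝ) : Vec (n i) :=
  P.f i (trunc (fun k => x k t) i) +
    (P.g i + P.δ i (trunc (fun k => x k t) i)) (x (i + 1) t)

section Solution

variable {P : Plant m n} {X : Set (Vec (n 1))} {ρ₁ : Vec (n 1) → Vec (n 2)}
  {ρ : ∀ i, Vec (n i) → Vec (n (i + 1))} {I : Set ℝ} {x : ∀ i, ℝ → Vec (n i)} {k : ℕ → ℝ} {τ : ℝ}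

theorem IsClosedLoopSolution.Icc_subset (h : IsClosedLoopSolution P X ρ₁ ρ I x) (hτ : τ ∈ I) :
    Icc 0 τ ⊆ I :=
  h.ordConnected.out h.zero_mem hτ

theorem IsClosedLoopSolution.continuousOn (h : IsClosedLoopSolution P X ρ₁ ρ I x) (hτ : τ ∈ I)
    {i : ℕ} (hi : i ∈ Finset.Icc 1 m) : ContinuousOn (x i) (Icc 0 τ) := by
  have h0 : (0 : ℝ) ≤ τ := h.nonneg hτ
  have h1 := intervalIntegral.continuousOn_primitive_interval'
    (h.integrable i hi τ hτ) left_mem_uIcc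
  rw [uIcc_of_le h0] at h1
  exact (continuousOn_const.add h1).congr fun t ht => h.eq_integral i hi t (h.Icc_subset hτ ht)

theorem IsClosedLoopSolution.continuousOn_virtualInput (h : IsClosedLoopSolution P X ρ₁ ρ I x)
    (hm : 1 ≤ m) (hτ : τ ∈ I) (hρ₁ : ∀ y ∈ X, ContinuousAt ρ₁ y)
    (hρ : ∀ i ∈ Finset.Icc 2 m, Continuous (ρ i)) {i : ℕ} (hi : 2 ≤ i) (him : i ≤ m + 1) :
    ContinuousOn (fun t => virtualInput ρ₁ ρ (fun i => x i t) i) (Icc 0 τ) := by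
  induction i, hi using Nat.le_induction with
  | base =>
    simp only [virtualInput_two]
    intro t ht
    exact (hρ₁ _ (h.mem t (h.Icc_subset hτ ht))).comp_continuousWithinAt
      (h.continuousOn hτ (by simp [hm]) t ht)
  | succ i hi ih =>
    simp only [virtualInput_succ ρ₁ ρ _ hi]
    exact (hρ i (by simp; omega)).comp_continuousOn
      ((h.continuousOn hτ (by simp; omega)).sub (ih (by omega)))

theorem IsClosedLoopSolution.continuousOn_of_le (h : IsClosedLoopSolution P X ρ₁ ρ I x)
    (hm : 1 ≤ m) (hτ : τ ∈ I) (hρ₁ : ∀ y ∈ X, ContinuousAt ρ₁ y)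
    (hρ : ∀ i ∈ Finset.Icc 2 m, Continuous (ρ i)) {i : ℕ} (hi : 1 ≤ i) (him : i ≤ m + 1) :
    ContinuousOn (x i) (Icc 0 τ) := by
  rcases Nat.lt_or_ge m i with hmi | hmi
  · obtain rfl : i = m + 1 := by omega
    exact (h.continuousOn_virtualInput hm hτ hρ₁ hρ (by omega) le_rfl).congr fun t ht =>
      h.input t (h.Icc_subset hτ ht)
  · exact h.continuousOn hτ (by simp; omega)

theorem IsClosedLoopSolution.continuousOn_velocity (h : IsClosedLoopSolution P X ρ₁ ρ I x)
    (hm : 1 ≤ m) (hτ : τ ∈ I) (hρ₁ : ∀ y ∈ X, ContinuousAt ρ₁ y)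
    (hρ : ∀ i ∈ Finset.Icc 2 m, Continuous (ρ i)) {i : ℕ} (hi : i ∈ Finset.Icc 1 m) :
    ContinuousOn (velocity P x i) (Icc 0 τ) := by
  have hi' := Finset.mem_Icc.1 hi
  have h1 : ContinuousOn (fun t => trunc (fun k => x k t) i) (Icc 0 τ) :=
    continuousOn_pi.2 fun k => h.continuousOn hτ (by simp; omega)
  exact ((P.f_lip i hi).continuous.comp_continuousOn h1).add
    ((continuousOn_const.add ((P.δ_lip i hi).continuous.comp_continuousOn h1)).clm_apply
      (h.continuousOn_of_le hm hτ hρ₁ hρ (by omega) (by omega)))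

/-- Along a solution the closed-loop right-hand side is continuous, so the integral equation gives a
right derivative at every time before τ, not only at almost every time. -/
theorem IsClosedLoopSolution.hasDerivWithinAt (h : IsClosedLoopSolution P X ρ₁ ρ I x)
    (hm : 1 ≤ m) (hτ : τ ∈ I) (hρ₁ : ∀ y ∈ X, ContinuousAt ρ₁ y)
    (hρ : ∀ i ∈ Finset.Icc 2 m, Continuous (ρ i)) {i : ℕ} (hi : i ∈ Finset.Icc 1 m) {t : ℝ}
    (ht : t ∈ Ico 0 τ) : HasDerivWithinAt (x i) (velocity P x i t) (Ioi t) t := by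
  have hmem : Icc 0 τ ∈ 𝓝[>] t := mem_of_superset (Ioo_mem_nhdsGT ht.2)
    fun u hu => ⟨ht.1.trans hu.1.le, hu.2.le⟩
  have htI : t ∈ Icc 0 τ := ⟨ht.1, ht.2.le⟩
  have hc := h.continuousOn_velocity hm hτ hρ₁ hρ hi
  have hc' : ContinuousWithinAt (velocity P x i) (Ioi t) t := (hc t htI).mono_of_mem_nhdsWithin hmem
  have hmeas : StronglyMeasurableAtFilter (velocity P x i) (𝓝[>] t) :=
    ⟨Icc 0 τ, hmem, hc.aestronglyMeasurable measurableSet_Icc⟩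
  have h1 : HasDerivWithinAt (fun u => ∫ s in (0 : ℝ)..u, velocity P x i s) (velocity P x i t)
      (Ioi t) t :=
    (intervalIntegral.integral_hasDerivWithinAt_right (s := Ici t) (t := Ioi t)
      (h.integrable i hi t (h.Icc_subset hτ htI)) hmeas hc').mono Ioi_subset_Ici_self
  refine (h1.const_add (x i 0)).congr_of_eventuallyEq ?_
    (h.eq_integral i hi t (h.Icc_subset hτ htI))
  filter_upwards [hmem] with u hu using h.eq_integral i hi u (h.Icc_subset hτ hu)

/-- The speed of x*_{i+1} is at most k_i times the sum of |ẋ_i| and the speed of x*_i; unrolling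
this recursion produces the products k_j ⋯ k_{i-1}. -/
theorem IsClosedLoopSolution.speedLE_virtualInput (h : IsClosedLoopSolution P X ρ₁ ρ I x)
    (hm : 1 ≤ m) (hτ : τ ∈ I)
    (hρ₁ : ∀ y ∈ X, ∀ K, k 1 < K → ∀ᶠ z in 𝓝 y, ‖ρ₁ z - ρ₁ y‖ ≤ K * ‖z - y‖)
    (hρ : ∀ i ∈ Finset.Icc 2 m, ∀ y, ∀ K, k i < K → ∀ᶠ z in 𝓝 y, ‖ρ i z - ρ i y‖ ≤ K * ‖z - y‖)
    (hk : ∀ i ∈ Finset.Icc 1 m, 0 ≤ k i) {t : ℝ} (ht : t ∈ Ico 0 τ) {i : ℕ} (hi : 2 ≤ i)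
    (him : i ≤ m + 1) :
    SpeedLE (fun s => virtualInput ρ₁ ρ (fun i => x i s) i) t
      (∑ j ∈ Finset.Icc 1 (i - 1), kbar k j (i - 1) * ‖velocity P x j t‖) := by
  have hc₁ : ∀ y ∈ X, ContinuousAt ρ₁ y := fun y hy =>
    continuousAt_of_eventually_le (hρ₁ y hy (k 1 + 1) (by linarith))
  have hc : ∀ i ∈ Finset.Icc 2 m, Continuous (ρ i) := fun i hi =>
    continuous_iff_continuousAt.2 fun y =>
      continuousAt_of_eventually_le (hρ i hi y (k i + 1) (by linarith))
  induction i, hi using Nat.le_induction with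
  | base =>
    have h1 : 1 ∈ Finset.Icc 1 m := by simp [hm]
    have h2 := speedLE_of_hasDerivWithinAt (h.hasDerivWithinAt hm hτ hc₁ hc h1 ht)
    have h3 := h2.comp (hk 1 h1)
      (hρ₁ (x 1 t) (h.mem t (h.Icc_subset hτ ⟨ht.1, ht.2.le⟩)))
    simpa [kbar_self, virtualInput_two] using h3
  | succ i hi ih =>
    have h1 : i ∈ Finset.Icc 1 m := by simp; omega
    have h2 := speedLE_of_hasDerivWithinAt (h.hasDerivWithinAt hm hτ hc₁ hc h1 ht)
    have h3 := (h2.sub (ih (by omega))).comp (hk i h1) (hρ i (by simp; omega) _)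
    simp only [virtualInput_succ ρ₁ ρ _ hi]
    refine h3.mono (le_of_eq ?_)
    obtain ⟨p, rfl⟩ : ∃ p, i = p + 1 := ⟨i - 1, by omega⟩
    rw [show p + 1 + 1 - 1 = p + 1 by omega, show p + 1 - 1 = p by omega,
      Finset.sum_Icc_succ_top (by omega), kbar_self, mul_add, Finset.mul_sum, add_comm]
    congr 1
    refine Finset.sum_congr rfl fun j hj => ?_
    rw [kbar_succ k (Finset.mem_Icc.1 hj).2, mul_assoc]

end Solution

/-! ### Properties of the tracking parameters -/

section Conditions

variable {glo ghi δbar ρbar θ : ℝ} {fbar : ℕ → ℝ → ℝ} {T : TrackingDesign} {d d' : ℕ}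
  {X : Set (Vec d)} {Vmax : Vec d → ℝ} {ρ₁ : Vec d → Vec d'} {i : ℕ}

theorem TrackingConditions.κ_zero (hT : TrackingConditions glo ghi δbar fbar T m X Vmax ρ₁ ρbar θ)
    (hi : i ∈ Finset.Icc 2 m) : T.κ i 0 = 0 := by
  have := hT.κ_odd i hi 0
  rw [neg_zero] at this
  linarith

theorem TrackingConditions.κ_pos (hT : TrackingConditions glo ghi δbar fbar T m X Vmax ρ₁ ρbar θ)
    (hi : i ∈ Finset.Icc 2 m) {s : ℝ} (hs : 0 < s) : 0 < T.κ i s :=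
  hT.κ_zero hi ▸ hT.κ_strictMono i hi hs

theorem TrackingConditions.κ_nonneg
    (hT : TrackingConditions glo ghi δbar fbar T m X Vmax ρ₁ ρbar θ)
    (hi : i ∈ Finset.Icc 2 m) {s : ℝ} (hs : 0 ≤ s) : 0 ≤ T.κ i s :=
  (hT.κ_zero hi).symm.le.trans ((hT.κ_strictMono i hi).monotone hs)

theorem TrackingConditions.deriv_κ_nonneg
    (hT : TrackingConditions glo ghi δbar fbar T m X Vmax ρ₁ ρbar θ)
    (hi : i ∈ Finset.Icc 2 m) (s : ℝ) : 0 ≤ deriv (T.κ i) s :=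
  (hT.κ_strictMono i hi).monotone.deriv_nonneg

theorem TrackingConditions.isClassK_κ
    (hT : TrackingConditions glo ghi δbar fbar T m X Vmax ρ₁ ρbar θ)
    (hi : i ∈ Finset.Icc 2 m) : IsClassK (T.κ i) where
  continuousOn := (hT.κ_contDiff i hi).continuous.continuousOn
  strictMonoOn := (hT.κ_strictMono i hi).strictMonoOn _
  map_zero := hT.κ_zero hi

theorem TrackingConditions.k_nonneg
    (hT : TrackingConditions glo ghi δbar fbar T m X Vmax ρ₁ ρbar θ) (hlt : δbar < glo)
    (hglo : 0 < glo) (hghi : 0 ≤ ghi) (hi : i ∈ Finset.Icc 1 m) : 0 ≤ T.k i := by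
  rcases eq_or_ne i 1 with rfl | h1
  · exact hT.k₁_pos.le
  · have hi2 : i ∈ Finset.Icc 2 m := by simp only [Finset.mem_Icc] at hi ⊢; omega
    refine le_trans ?_ (hT.k_ge i hi2 1 one_pos)
    have h1 := hT.κ_pos hi2 one_pos
    have h2 := hT.deriv_κ_nonneg hi2 1
    have h3 := sub_pos.2 hlt
    positivity

theorem TrackingConditions.ρ₁_eventually_le
    (hT : TrackingConditions glo ghi δbar fbar T m X Vmax ρ₁ ρbar θ) (hX : IsOpen X) {y : Vec d}
    (hy : y ∈ X) {K : ℝ} (hK : T.k 1 < K) : ∀ᶠ z in 𝓝 y, ‖ρ₁ z - ρ₁ y‖ ≤ K * ‖z - y‖ := by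
  obtain ⟨U, hU, h⟩ := hT.k₁_lip y hy
  rw [hX.nhdsWithin_eq hy] at hU
  filter_upwards [hU] with z hz
  exact (h z hz y (mem_of_mem_nhds hU)).trans
    (mul_le_mul_of_nonneg_right hK.le (norm_nonneg _))

theorem ofReal_sum_le {ι : Type*} (s : Finset ι) (f : ι → ℝ) :
    ENNReal.ofReal (∑ i ∈ s, f i) ≤ ∑ i ∈ s, ENNReal.ofReal (f i) := by
  classical
  induction s using Finset.induction_on with
  | empty => simp
  | insert a s ha ih =>
    rw [Finset.sum_insert ha, Finset.sum_insert ha]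
    exact ENNReal.ofReal_add_le.trans (by gcongr)

/-- Where `y i` dominates, each argument is admissible in the supremum that defines its generalized
inverse, so the design inequality becomes one between real numbers. -/
theorem TrackingConditions.κ_ge_real
    (hT : TrackingConditions glo ghi δbar fbar T m X Vmax ρ₁ ρbar θ) (hglo : 0 < glo)
    (hδ : 0 ≤ δbar) (hρ : 0 ≤ ρbar) (hi : i ∈ Finset.Icc 2 m) {y : ℕ → ℝ} (hy : ∀ j, 0 ≤ y j)
    (hpos : 0 < y i) (h1 : T.γ i (i + 1) (y (i + 1)) ≤ y i) (h2 : T.γx₁ i T.cx₁ ≤ y i)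
    (h3 : T.γρ₀ i ρbar ≤ y i) (h4 : ∀ j ∈ Finset.Icc 1 (i - 1), T.γ i j (y j) ≤ y i) :
    θ * y i + (glo + δbar) / glo * y (i + 1) + 1 / glo *
      (gainX₁ T i T.cx₁ + gainRho₀ ghi δbar fbar T i ρbar +
        ∑ j ∈ Finset.Icc 1 (i - 1), gain glo ghi δbar fbar T i j (y j) +
        gainDiag ghi δbar fbar T i (y i)) ≤ T.κ i (y i) := by
  have h5 := hT.κ_ge i hi (y i) hpos.le
  have e1 : ENNReal.ofReal (y (i + 1)) ≤ inv (T.γ i (i + 1)) (ENNReal.ofReal (y i)) :=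
    le_compInv (h := fun a => a) (hy _) h1
  have e2 := le_compInv (h := gainX₁ T i) hT.cx₁_nonneg h2
  have e3 := le_compInv (h := gainRho₀ ghi δbar fbar T i) hρ h3
  have e4 := Finset.sum_le_sum fun j hj =>
    le_compInv (h := gain glo ghi δbar fbar T i j) (hy j) (h4 j hj)
  have e5 : ENNReal.ofReal (θ * y i + (glo + δbar) / glo * y (i + 1) + 1 / glo *
      (gainX₁ T i T.cx₁ + gainRho₀ ghi δbar fbar T i ρbar +
        ∑ j ∈ Finset.Icc 1 (i - 1), gain glo ghi δbar fbar T i j (y j) +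
        gainDiag ghi δbar fbar T i (y i))) ≤ ENNReal.ofReal (T.κ i (y i)) := by
    refine le_trans ?_ h5
    refine ENNReal.ofReal_add_le.trans (add_le_add (ENNReal.ofReal_add_le.trans
      (add_le_add le_rfl ?_)) ?_)
    · rw [ENNReal.ofReal_mul (by positivity)]
      gcongr
    · rw [ENNReal.ofReal_mul (by positivity)]
      refine mul_le_mul_right (ENNReal.ofReal_add_le.trans (add_le_add_left
        (ENNReal.ofReal_add_le.trans (add_le_add (ENNReal.ofReal_add_le.trans
          (add_le_add e2 e3)) ((ofReal_sum_le _ _).trans e4))) _)) _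
  exact (ENNReal.ofReal_le_ofReal_iff (hT.κ_pos hi hpos).le).1 e5

end Conditions

/-! ### Decay along trajectories -/

/-- `max_j V_j(x_1)` for the index `1`, and the size of the tracking error `x_i - x*_i` for the
other ones. -/
def errorSize (V : Fin nc → Vec (n 1) → ℝ) (ρ₁ : Vec (n 1) → Vec (n 2))
    (ρ : ∀ i, Vec (n i) → Vec (n (i + 1))) (x : ∀ i, Vec (n i)) (i : ℕ) : ℝ :=
  if i = 1 then maxV V (x 1) else ‖x i - virtualInput ρ₁ ρ x i‖

section ErrorSize

variable (V : Fin nc → Vec (n 1) → ℝ) (ρ₁ : Vec (n 1) → Vec (n 2))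
  (ρ : ∀ i, Vec (n i) → Vec (n (i + 1))) (x : ∀ i, Vec (n i))

theorem errorSize_one : errorSize V ρ₁ ρ x 1 = maxV V (x 1) := if_pos rfl

theorem errorSize_of_two_le {i : ℕ} (hi : 2 ≤ i) :
    errorSize V ρ₁ ρ x i = ‖x i - virtualInput ρ₁ ρ x i‖ := if_neg (by omega)

theorem errorSize_two : errorSize V ρ₁ ρ x 2 = ‖x 2 - ρ₁ (x 1)‖ := if_neg (by omega)

theorem errorSize_succ {i : ℕ} (hi : 2 ≤ i) :
    errorSize V ρ₁ ρ x (i + 1) = ‖x (i + 1) - ρ i (x i - virtualInput ρ₁ ρ x i)‖ := by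
  rw [errorSize_of_two_le _ _ _ _ (by omega), virtualInput_succ ρ₁ ρ x hi]

theorem errorSize_nonneg (h : 0 ≤ maxV V (x 1)) (i : ℕ) : 0 ≤ errorSize V ρ₁ ρ x i := by
  unfold errorSize
  split_ifs
  · exact h
  · exact norm_nonneg _

end ErrorSize

section Decay

variable {P : Plant m n} {glo ghi δbar ρbar : ℝ} {fbar : ℕ → ℝ → ℝ} {γ₁₂ : ℝ → ℝ}
  {X : Set (Vec (n 1))} {V : Fin nc → Vec (n 1) → ℝ} {v : Fin nc → ℝ} {η : ℝ}
  {D : SafetyDesign nc nl (n 2)} {ρ₀ : Vec (n 1) → Vec (n 2)} {T : TrackingDesign}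
  {I : Set ℝ} {x : ∀ i, ℝ → Vec (n i)} {τ : ℝ}

theorem norm_state_two_le (hT : TrackingConditions glo ghi δbar fbar T m X (maxV V)
      (safetyLaw P glo δbar V v D ρ₀) ρbar D.θ) (ρ : ∀ i, Vec (n i) → Vec (n (i + 1)))
    {z : ∀ i, Vec (n i)} (hz : z 1 ∈ X) :
    ‖z 2‖ ≤ errorSize V (safetyLaw P glo δbar V v D ρ₀) ρ z 2 +
      T.γV (errorSize V (safetyLaw P glo δbar V v D ρ₀) ρ z 1) + ρbar := by
  rw [errorSize_two, errorSize_one]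
  have h1 := hT.γV_bound _ hz
  have h2 := norm_add_le (z 2 - safetyLaw P glo δbar V v D ρ₀ (z 1))
    (safetyLaw P glo δbar V v D ρ₀ (z 1))
  rw [sub_add_cancel] at h2
  linarith

theorem norm_state_succ_le (hP : PlantBounds P glo ghi δbar fbar) (hlt : δbar < glo)
    {Vmax : Vec (n 1) → ℝ} {ρ₁ : Vec (n 1) → Vec (n 2)} {θ : ℝ}
    (hT : TrackingConditions glo ghi δbar fbar T m X Vmax ρ₁ ρbar θ) (z : ∀ i, Vec (n i)) {j : ℕ}
    (hj : j ∈ Finset.Icc 2 m) :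
    ‖z (j + 1)‖ ≤ errorSize V ρ₁ (trackingLaw P glo δbar T.κ) z (j + 1) +
      glo / (glo - δbar) * T.κ j (errorSize V ρ₁ (trackingLaw P glo δbar T.κ) z j) := by
  have hj2 : 2 ≤ j := (Finset.mem_Icc.1 hj).1
  rw [errorSize_succ _ _ _ _ hj2, errorSize_of_two_le _ _ _ _ hj2]
  have h1 := norm_trackingLaw_le (P := P) hP hlt (fun s hs => hT.κ_nonneg hj hs)
    (z j - virtualInput ρ₁ (trackingLaw P glo δbar T.κ) z j)
  have h2 := norm_add_le (z (j + 1) - trackingLaw P glo δbar T.κ j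
    (z j - virtualInput ρ₁ (trackingLaw P glo δbar T.κ) z j))
    (trackingLaw P glo δbar T.κ j (z j - virtualInput ρ₁ (trackingLaw P glo δbar T.κ) z j))
  rw [sub_add_cancel] at h2
  linarith

theorem norm_f_le (hP : PlantBounds P glo ghi δbar fbar) {i : ℕ} (hi : i ∈ Finset.Icc 1 m)
    (z : ∀ i, Vec (n i)) : ‖P.f i (trunc z i)‖ ≤ ∑ l ∈ Finset.Icc 1 i, fbar l ‖z l‖ :=
  (hP.f_le i hi _).trans_eq (fin_sum_eq_sum_Icc (fun l => fbar l ‖z l‖) i)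

theorem norm_velocity_le (hP : PlantBounds P glo ghi δbar fbar) {i : ℕ} (hi : i ∈ Finset.Icc 1 m)
    (x : ∀ i, ℝ → Vec (n i)) (t : ℝ) : ‖velocity P x i t‖ ≤
      ∑ l ∈ Finset.Icc 1 i, fbar l ‖x l t‖ + (ghi + δbar) * ‖x (i + 1) t‖ := by
  refine (norm_add_le _ _).trans (add_le_add (norm_f_le hP hi fun k => x k t) ?_)
  refine (ContinuousLinearMap.le_opNorm _ _).trans (mul_le_mul_of_nonneg_right ?_ (norm_nonneg _))
  exact (norm_add_le _ _).trans (add_le_add (hP.g_le i hi) (hP.δ_le i hi _))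

theorem trackingLaw_eventually_le' (hP : PlantBounds P glo ghi δbar fbar) (hlt : δbar < glo)
    {Vmax : Vec (n 1) → ℝ} {ρ₁ : Vec (n 1) → Vec (n 2)} {θ : ℝ}
    (hT : TrackingConditions glo ghi δbar fbar T m X Vmax ρ₁ ρbar θ) {i : ℕ}
    (hi : i ∈ Finset.Icc 2 m) (e : Vec (n i)) {K : ℝ} (hK : T.k i < K) :
    ∀ᶠ z in 𝓝 e, ‖trackingLaw P glo δbar T.κ i z - trackingLaw P glo δbar T.κ i e‖ ≤
      K * ‖z - e‖ :=
  trackingLaw_eventually_le hP hlt (by simp only [Finset.mem_Icc] at hi ⊢; omega)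
    (fun _ hs => hT.κ_pos hi hs) ((hT.κ_contDiff i hi).differentiable one_ne_zero)
    (hT.deriv_κ_nonneg hi) (hT.k_ge i hi) e hK

/-- The certificates decay where they dominate. -/
theorem certificate_step (hm : 1 ≤ m) (hnc : 1 ≤ nc) (hP : PlantBounds P glo ghi δbar fbar)
    (hV : CertificateAssumption X V v η) (hX : SegmentsCross X V v)
    (hD : SafetyConditions glo δbar (fbar 1) γ₁₂ X V v D) {t : ℝ} (hx : x 1 t ∈ X)
    (hderiv : HasDerivWithinAt (x 1) (velocity P x 1 t) (Ioi t) t)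
    (hc : ∀ j, D.c j ≤ maxV V (x 1 t))
    (he : γ₁₂ ‖x 2 t - safetyLaw P glo δbar V v D ρ₀ (x 1 t)‖ ≤ maxV V (x 1 t)) {μ : ℝ}
    (hμ : μ < η * glo * D.θ) :
    ∀ᶠ t' in 𝓝[>] t, maxV V (x 1 t') ≤ Real.exp (-(μ * (t' - t))) * maxV V (x 1 t) := by
  have h1 : ∀ j, ∀ᶠ t' in 𝓝[>] t,
      V j (x 1 t') ≤ Real.exp (-(μ * (t' - t))) * maxV V (x 1 t) := by
    intro j
    have hd : HasDerivWithinAt (fun s => V j (x 1 s)) ⟪gradient (V j) (x 1 t), velocity P x 1 t⟫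
        (Ioi t) t := by
      have := (hV.differentiableAt j hx).hasGradientAt.hasFDerivAt.comp_hasDerivWithinAt t hderiv
      simpa [Function.comp_def] using this
    -- A certificate attaining the maximum decays by `certificate_decrease`; any other is strictly
    -- below and stays so for a short time.
    rcases eq_or_lt_of_le (le_maxV V (x 1 t) j) with heq | hlt
    · rw [← heq] at he ⊢
      refine eventually_le_exp_decay hd ?_
      have hF : ‖P.f 1 (trunc (fun k => x k t) 1)‖ ≤ fbar 1 ‖x 1 t‖ := by
        simpa using norm_f_le hP (i := 1) (by simp [hm]) fun k => x k t
      have h2 := certificate_decrease hm hnc hP hV hX hD ρ₀ hx (heq ▸ hc j) he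
        (hP.δ_le 1 (by simp [hm]) (trunc (fun k => x k t) 1)) hF
      rw [add_sub_cancel] at h2
      have h3 := mul_lt_mul_of_pos_right hμ (hV.pos j hx)
      exact lt_of_le_of_lt h2 (neg_lt_neg h3)
    · have h2 : ContinuousWithinAt
          (fun t' => Real.exp (-(μ * (t' - t))) * maxV V (x 1 t)) (Ioi t) t :=
        (hasDerivWithinAt_exp_decay μ _ t _).continuousWithinAt
      filter_upwards [hd.continuousWithinAt.eventually_lt h2 (by simpa using hlt)] with t' h using h.le
  filter_upwards [eventually_all.2 h1] with t' h using maxV_le hnc h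

/-- The tracking errors decay where they dominate. -/
theorem tracking_step (hm : 1 ≤ m) (hnc : 1 ≤ nc) (hP : PlantBounds P glo ghi δbar fbar)
    (hV : CertificateAssumption X V v η)
    (hD : SafetyConditions glo δbar (fbar 1) γ₁₂ X V v D)
    (hρbar : 0 ≤ ρbar)
    (hT : TrackingConditions glo ghi δbar fbar T m X (maxV V)
      (safetyLaw P glo δbar V v D ρ₀) ρbar D.θ)
    (h : IsClosedLoopSolution P X (safetyLaw P glo δbar V v D ρ₀)
      (trackingLaw P glo δbar T.κ) I x) (hτ : τ ∈ I) {t : ℝ} (ht : t ∈ Ico 0 τ)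
    {y : ℕ → ℝ} (hy : y = errorSize V (safetyLaw P glo δbar V v D ρ₀)
      (trackingLaw P glo δbar T.κ) fun i => x i t)
    {i : ℕ} (hi : i ∈ Finset.Icc 2 m) (hpos : 0 < y i)
    (h1 : T.γ i (i + 1) (y (i + 1)) ≤ y i) (h2 : T.γx₁ i T.cx₁ ≤ y i)
    (h3 : T.γρ₀ i ρbar ≤ y i) (h4 : ∀ j ∈ Finset.Icc 1 (i - 1), T.γ i j (y j) ≤ y i) {μ : ℝ}
    (hμ : μ < glo * D.θ) :
    ∀ᶠ t' in 𝓝[>] t, errorSize V (safetyLaw P glo δbar V v D ρ₀)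
      (trackingLaw P glo δbar T.κ) (fun i => x i t') i ≤ Real.exp (-(μ * (t' - t))) * y i := by
  have hδ := hP.δbar_nonneg
  have hlt := hD.δbar_lt
  have hglo : 0 < glo := lt_of_le_of_lt hδ hlt
  have hC : 0 ≤ glo / (glo - δbar) := div_nonneg hglo.le (sub_nonneg.2 hlt.le)
  have hi' := Finset.mem_Icc.1 hi
  have hi1 : i ∈ Finset.Icc 1 m := by simp only [Finset.mem_Icc]; omega
  have hxX : x 1 t ∈ X := h.mem t (h.Icc_subset hτ ⟨ht.1, ht.2.le⟩)
  have hmax : 0 ≤ maxV V (x 1 t) := (hV.pos ⟨0, hnc⟩ hxX).le.trans (le_maxV V _ _)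
  set ρ₁ := safetyLaw P glo δbar V v D ρ₀ with hρ₁
  set ρ := trackingLaw P glo δbar T.κ with hρ
  have hy0 : ∀ j, 0 ≤ y j := fun j => hy ▸ errorSize_nonneg V ρ₁ ρ (fun i => x i t) hmax j
  have hL₁ : ∀ z ∈ X, ∀ K, T.k 1 < K → ∀ᶠ w in 𝓝 z, ‖ρ₁ w - ρ₁ z‖ ≤ K * ‖w - z‖ :=
    fun z hz K hK => hT.ρ₁_eventually_le hV.X_open hz hK
  have hL : ∀ i ∈ Finset.Icc 2 m, ∀ z, ∀ K, T.k i < K →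
      ∀ᶠ w in 𝓝 z, ‖ρ i w - ρ i z‖ ≤ K * ‖w - z‖ := fun i hi z K hK =>
    trackingLaw_eventually_le' hP hlt hT hi z hK
  have hk : ∀ i ∈ Finset.Icc 1 m, 0 ≤ T.k i := fun i hi =>
    hT.k_nonneg hlt hglo hP.ghi_nonneg hi
  have hspeed := h.speedLE_virtualInput hm hτ hL₁ hL hk ht hi'.1 (by omega)
  have hderiv := h.hasDerivWithinAt hm hτ
    (fun z hz => continuousAt_of_eventually_le (hL₁ z hz (T.k 1 + 1) (by linarith)))
    (fun i hi => continuous_iff_continuousAt.2 fun z =>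
      continuousAt_of_eventually_le (hL i hi z (T.k i + 1) (by linarith))) hi1 ht
  have hdist := disturbance_le (glo := glo) (ghi := ghi) (δbar := δbar) (ρbar := ρbar)
    (fbar := fbar) (T := T) (y := y) (ξ := fun j => ‖x j t‖) (s := fun j => ‖velocity P x j t‖)
    hi'.1 (add_nonneg hP.ghi_nonneg hδ)
    (fun j hj => hk j (by simp only [Finset.mem_Icc] at hj ⊢; omega))
    (fun j hj => hP.fbar_class j (by simp only [Finset.mem_Icc] at hj ⊢; omega))
    hy0 (fun j => norm_nonneg _) hρbar (hT.γV_class.nonneg (hy0 1))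
    (fun j hj => mul_nonneg hC (hT.κ_nonneg (by simp only [Finset.mem_Icc] at hj ⊢; omega) (hy0 j)))
    (hT.fbar₁_le _ hxX) (by rw [hy]; exact norm_state_two_le hT ρ (z := fun i => x i t) hxX)
    (fun j hj => by
      rw [hy]
      exact norm_state_succ_le hP hlt hT (fun i => x i t)
        (by simp only [Finset.mem_Icc] at hj ⊢; omega))
    (fun j hj => norm_velocity_le hP (by simp only [Finset.mem_Icc] at hj ⊢; omega) x t)
  have hκ := hT.κ_ge_real hglo hδ hρbar hi hy0 hpos h1 h2 h3 h4
  set S := gainX₁ T i T.cx₁ + gainRho₀ ghi δbar fbar T i ρbar +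
        ∑ j ∈ Finset.Icc 1 (i - 1), gain glo ghi δbar fbar T i j (y j) +
        gainDiag ghi δbar fbar T i (y i) with hS
  set L := ∑ j ∈ Finset.Icc 1 (i - 1), kbar T.k j (i - 1) * ‖velocity P x j t‖ with hLdef
  have hL0 : 0 ≤ L := Finset.sum_nonneg fun j hj => mul_nonneg
    (kbar_nonneg_of_one_le (fun j hj => hk j (by simp only [Finset.mem_Icc] at hj ⊢; omega))
      (Finset.mem_Icc.1 hj).1) (norm_nonneg _)
  have hFS : ‖P.f i (trunc (fun k => x k t) i)‖ + L ≤ S :=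
    (add_le_add_left (norm_f_le hP hi1 fun k => x k t) _).trans hdist
  set e := x i t - virtualInput ρ₁ ρ (fun i => x i t) i with he
  have hye : y i = ‖e‖ := by rw [hy, errorSize_of_two_le _ _ _ _ hi'.1]
  have hye' : y (i + 1) = ‖x (i + 1) t - ρ i e‖ := by rw [hy, errorSize_succ _ _ _ _ hi'.1]
  have hene : e ≠ 0 := by
    rw [hye] at hpos
    exact norm_pos_iff.1 hpos
  rw [hye, hye'] at hκ
  have hdec := tracking_decrease hP hlt hi1 (fun s hs => hT.κ_pos hi hs) hene
    (x (i + 1) t - ρ i e) (hP.δ_le i hi1 (trunc (fun k => x k t) i)) hFS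
    ((add_nonneg (norm_nonneg _) hL0).trans hFS) hD.θ_pos.le hκ
  rw [← hρ, add_sub_cancel] at hdec
  have hfin := norm_sub_eventually_le_exp_decay (μ := μ) hderiv hspeed hene (by
    refine lt_of_le_of_lt hdec (neg_lt_neg ?_)
    exact mul_lt_mul_of_pos_right hμ (norm_pos_iff.2 hene))
  filter_upwards [hfin] with t' h5
  rw [errorSize_of_two_le _ _ _ _ hi'.1, hye]
  exact h5

/-- The composite bound on the certificates and on all tracking errors. -/
theorem errorSize_le (hm : 1 ≤ m) (hnc : 1 ≤ nc) (hP : PlantBounds P glo ghi δbar fbar)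
    (hV : CertificateAssumption X V v η) (hX : SegmentsCross X V v)
    (hD : SafetyConditions glo δbar (fbar 1) (T.γ 1 2) X V v D) (hρbar : 0 ≤ ρbar)
    (hT : TrackingConditions glo ghi δbar fbar T m X (maxV V)
      (safetyLaw P glo δbar V v D ρ₀) ρbar D.θ)
    (hsg : SmallGain T m)
    (h : IsClosedLoopSolution P X (safetyLaw P glo δbar V v D ρ₀)
      (trackingLaw P glo δbar T.κ) I x) (hτ : τ ∈ I)
    {G : ℕ → ℝ≥0 ≃o ℝ≥0} (hG : ∀ i s, G i s ≤ s)
    (hGγ : ∀ i, 1 ≤ i → i + 1 ≤ m → ∀ s : ℝ≥0, T.γ i (i + 1) s ≤ G i s)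
    {Ψ : ℝ≥0 ≃o ℝ≥0} (hΨ : ∀ b, Ψ b = ∏ i ∈ Finset.Icc 1 m, (chainIso G i).symm b)
    {μ : ℝ} (hμ : 0 ≤ μ) (hμ₁ : μ < η * glo * D.θ) (hμ₂ : μ < glo * D.θ) {c r : ℝ≥0}
    (hc : ∀ j, D.c j ≤ c) (hc₁ : ∀ i ∈ Finset.Icc 2 m, T.γx₁ i T.cx₁ ≤ c)
    (hc₂ : ∀ i ∈ Finset.Icc 2 m, T.γρ₀ i ρbar ≤ c)
    (hr : ∀ i ∈ Finset.Icc 1 m, errorSize V (safetyLaw P glo δbar V v D ρ₀)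
      (trackingLaw P glo δbar T.κ) (fun i => x i 0) i ≤ r) :
    ∀ t ∈ Icc 0 τ, ∀ i ∈ Finset.Icc 1 m, errorSize V (safetyLaw P glo δbar V v D ρ₀)
      (trackingLaw P glo δbar T.κ) (fun i => x i t) i ≤
      (chainIso G i).symm (max (envelope Ψ μ r t) c) := by
  have hlt := hD.δbar_lt
  have hglo : 0 < glo := lt_of_le_of_lt hP.δbar_nonneg hlt
  have hcpos : 0 < c := by
    have := hc ⟨0, hnc⟩
    have h1 := hD.c_gt ⟨0, hnc⟩
    have h2 := hV.v_pos ⟨0, hnc⟩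
    rw [← NNReal.coe_pos]
    linarith
  set ρ₁ := safetyLaw P glo δbar V v D ρ₀ with hρ₁
  set ρ := trackingLaw P glo δbar T.κ with hρ
  have hL₁ : ∀ z ∈ X, ContinuousAt ρ₁ z := fun z hz =>
    continuousAt_of_eventually_le
      (hT.ρ₁_eventually_le hV.X_open hz (show T.k 1 < T.k 1 + 1 by linarith))
  have hL : ∀ i ∈ Finset.Icc 2 m, Continuous (ρ i) := fun i hi =>
    continuous_iff_continuousAt.2 fun z => continuousAt_of_eventually_le
      (trackingLaw_eventually_le' hP hlt hT hi z (show T.k i < T.k i + 1 by linarith))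
  have hsymm : ∀ i b, b ≤ (chainIso G i).symm b := fun i b => by
    simpa using chainIso_le hG i ((chainIso G i).symm b)
  have hsymm_mono : ∀ {i j} b, i ≤ j → (chainIso G i).symm b ≤ (chainIso G j).symm b := by
    intro i j b hij
    rw [OrderIso.symm_apply_le]
    have := chainIso_antitone hG ((chainIso G j).symm b) hij
    rwa [OrderIso.apply_symm_apply] at this
  refine le_bound_of_decay (μ := μ)
    (M := fun i t => ((chainIso G i).symm (max (envelope Ψ μ r t) c) : ℝ)) ?_ ?_ ?_ ?_ ?_
  · intro i hi
    have hi' := Finset.mem_Icc.1 hi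
    rcases eq_or_ne i 1 with rfl | hi1
    · simp only [errorSize_one]
      exact (continuousOn_maxV hnc hV).comp (h.continuousOn hτ hi) fun t ht =>
        h.mem t (h.Icc_subset hτ ht)
    · simp only [errorSize_of_two_le V ρ₁ ρ _ (show 2 ≤ i by omega)]
      exact ((h.continuousOn hτ hi).sub
        (h.continuousOn_virtualInput hm hτ hL₁ hL (by omega) (by omega))).norm
  · intro i hi
    have h1 : Continuous fun t => envelope Ψ μ r t :=
      (continuous_envelope Ψ μ).comp (continuous_const.prodMk continuous_id)
    exact NNReal.continuous_coe.comp
      ((chainIso G i).symm.continuous.comp (h1.max continuous_const))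
  · intro i hi t t' htt
    have hq : (Real.exp (-(μ * (t' - t)))).toNNReal ≤ 1 := by
      rw [Real.toNNReal_le_one, Real.exp_le_one_iff]
      have := mul_nonneg hμ (sub_nonneg.2 htt)
      linarith
    have h1 : (Real.exp (-(μ * (t' - t)))).toNNReal *
        (chainIso G i).symm (max (envelope Ψ μ r t) c) ≤
        (chainIso G i).symm (max (envelope Ψ μ r t') c) := by
      -- The maximum splits into the envelope part, which obeys `envelope_factor`, and a constant
      -- part, for which the decay factor at most 1 suffices.
      rw [(chainIso G i).symm.monotone.map_max, (chainIso G i).symm.monotone.map_max, mul_max]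
      exact max_le_max (envelope_factor hΨ hμ r htt hi) (mul_le_of_le_one_left zero_le hq)
    have h2 := NNReal.coe_le_coe.2 h1
    rwa [NNReal.coe_mul, Real.coe_toNNReal _ (Real.exp_pos _).le] at h2
  · intro i hi
    refine (hr i hi).trans (NNReal.coe_le_coe.2 ?_)
    rw [envelope_zero]
    exact (le_max_left _ _).trans (hsymm i _)
  · intro t ht hle i hi heq
    set b := max (envelope Ψ μ r t) c with hb
    have hcb : c ≤ b := le_max_right _ _
    have hxX : x 1 t ∈ X := h.mem t (h.Icc_subset hτ ⟨ht.1, ht.2.le⟩)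
    have hmax : 0 ≤ maxV V (x 1 t) := (hV.pos ⟨0, hnc⟩ hxX).le.trans (le_maxV V _ _)
    set y := errorSize V ρ₁ ρ (fun i => x i t) with hy
    have hy0 : ∀ j, 0 ≤ y j := errorSize_nonneg V ρ₁ ρ (fun i => x i t) hmax
    have hi' := Finset.mem_Icc.1 hi
    have hci : (c : ℝ) ≤ y i := heq ▸ NNReal.coe_le_coe.2 (hcb.trans (hsymm i b))
    -- From y_{i+1} ≤ σ_{i+1}⁻¹(b) and σ_{i+1} = σ_i ∘ G_i follows G_i(y_{i+1}) ≤ σ_i⁻¹(b) = y_i.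
    have hnext : T.γ i (i + 1) (y (i + 1)) ≤ y i := by
      rcases Nat.lt_or_ge i m with him | him
      · obtain ⟨q, hq⟩ : ∃ q : ℝ≥0, (q : ℝ) = y (i + 1) := ⟨(y (i + 1)).toNNReal,
          Real.coe_toNNReal _ (hy0 _)⟩
        have h1 := hle (i + 1) (by simp only [Finset.mem_Icc]; omega)
        rw [← hq, NNReal.coe_le_coe, OrderIso.le_symm_apply, chainIso_succ G hi'.1,
          ← OrderIso.le_symm_apply] at h1
        rw [← hq, heq]
        exact (hGγ i hi'.1 him q).trans (NNReal.coe_le_coe.2 h1)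
      -- The last subsystem has no successor: x_{m+1} is the input, which equals x*_{m+1}.
      · obtain rfl : i = m := le_antisymm hi'.2 him
        have h1 : y (i + 1) = 0 := by
          rw [hy, errorSize_of_two_le _ _ _ _ (by omega), ← h.input t
            (h.Icc_subset hτ ⟨ht.1, ht.2.le⟩), sub_self, norm_zero]
        have h2 : T.γ i (i + 1) 0 = 0 := by
          rcases eq_or_ne i 1 with rfl | hi1
          · exact hD.γ₁₂_class.map_zero
          · exact (hT.γ_class i (by simp only [Finset.mem_Icc]; omega) (i + 1)
              (by simp only [Finset.mem_Icc]; omega) (by omega)).map_zero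
        rw [h1, h2]
        exact hy0 i
    rcases eq_or_ne i 1 with rfl | hi1
    · have h1 : y 1 = maxV V (x 1 t) := errorSize_one _ _ _ _
      have h2 : y 2 = ‖x 2 t - ρ₁ (x 1 t)‖ := errorSize_two _ _ _ _
      have h3 : T.γ 1 2 (y 2) ≤ y 1 := hnext
      simp only [errorSize_one]
      rw [h1] at hci h3
      rw [h2] at h3
      exact certificate_step hm hnc hP hV hX hD hxX (h.hasDerivWithinAt hm hτ hL₁ hL hi ht)
        (fun j => (hc j).trans hci) h3 hμ₁
    · have hi2 : i ∈ Finset.Icc 2 m := by simp only [Finset.mem_Icc]; omega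
      refine tracking_step hm hnc hP hV hD hρbar hT h hτ ht hy hi2 ?_ hnext
        ((hc₁ i hi2).trans hci) ((hc₂ i hi2).trans hci) (fun j hj => ?_) hμ₂
      · exact lt_of_lt_of_le (NNReal.coe_pos.2 hcpos) hci
      · have hj' := Finset.mem_Icc.1 hj
        have hjm : j ∈ Finset.Icc 1 m := by simp only [Finset.mem_Icc]; omega
        have h1 : T.γ i j (y j) ≤ y j := by
          rcases eq_or_lt_of_le (hy0 j) with h0 | h0
          · rw [← h0, (hT.γ_class i hi2 j (by simp only [Finset.mem_Icc]; omega)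
              (by omega)).map_zero]
          · exact (hsg.γ_lt i hi2 j hjm (by omega) (by omega) _ h0).le
        refine h1.trans ((hle j hjm).trans (heq ▸ NNReal.coe_le_coe.2 ?_))
        exact hsymm_mono b (by omega)

end Decay

/-! ### The safety objective -/

theorem le_initialSize_maxV (m : ℕ) (Vmax : Vec (n 1) → ℝ) (ρ₀ : Vec (n 1) → Vec (n 2))
    (z : ∀ i, Vec (n i)) : Vmax (z 1) ≤ initialSize m Vmax ρ₀ z :=
  (le_max_left _ _).trans (le_max_left _ _)

theorem le_initialSize_nominal (m : ℕ) (Vmax : Vec (n 1) → ℝ) (ρ₀ : Vec (n 1) → Vec (n 2))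
    (z : ∀ i, Vec (n i)) : ‖ρ₀ (z 1)‖ ≤ initialSize m Vmax ρ₀ z :=
  (le_max_right _ _).trans (le_max_left _ _)

theorem le_initialSize_norm {m : ℕ} (Vmax : Vec (n 1) → ℝ) (ρ₀ : Vec (n 1) → Vec (n 2))
    (z : ∀ i, Vec (n i)) {i : ℕ} (hi : i ∈ Finset.Icc 2 m) :
    ‖z i‖ ≤ initialSize m Vmax ρ₀ z :=
  le_trans (NNReal.coe_le_coe.2 (Finset.le_sup (f := fun i => ‖z i‖₊) hi)) (le_max_right _ _)

section Objective

variable {P : Plant m n} {glo ghi δbar ρbar : ℝ} {fbar : ℕ → ℝ → ℝ}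
  {X : Set (Vec (n 1))} {V : Fin nc → Vec (n 1) → ℝ} {v : Fin nc → ℝ} {η : ℝ}
  {D : SafetyDesign nc nl (n 2)} {ρ₀ : Vec (n 1) → Vec (n 2)} {T : TrackingDesign}

/-- The initial errors are bounded by a class `K` function of the initial size. -/
theorem exists_bound_initial (hm : 1 ≤ m) (hnc : 1 ≤ nc) (hP : PlantBounds P glo ghi δbar fbar)
    (hV : CertificateAssumption X V v η) (hX : SegmentsCross X V v)
    (hD : SafetyConditions glo δbar (fbar 1) (T.γ 1 2) X V v D)
    (hT : TrackingConditions glo ghi δbar fbar T m X (maxV V)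
      (safetyLaw P glo δbar V v D ρ₀) ρbar D.θ) :
    ∃ R, IsClassK R ∧ ∀ z : ∀ i, Vec (n i), z 1 ∈ X → ∀ i ∈ Finset.Icc 1 m,
      errorSize V (safetyLaw P glo δbar V v D ρ₀) (trackingLaw P glo δbar T.κ) z i ≤
        R (initialSize m (maxV V) ρ₀ z) := by
  have hlt := hD.δbar_lt
  have hglo : 0 < glo := lt_of_le_of_lt hP.δbar_nonneg hlt
  have hC : 0 < glo / (glo - δbar) := div_pos hglo (sub_pos.2 hlt)
  have hmax : ∀ z : ∀ i, Vec (n i), z 1 ∈ X → 0 ≤ maxV V (z 1) := fun z hz =>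
    (hV.pos ⟨0, hnc⟩ hz).le.trans (le_maxV V _ _)
  suffices h : ∀ k, 1 ≤ k → k ≤ m →
      ∃ R, IsClassK R ∧ ∀ z : ∀ i, Vec (n i), z 1 ∈ X → ∀ i ∈ Finset.Icc 1 k,
      errorSize V (safetyLaw P glo δbar V v D ρ₀) (trackingLaw P glo δbar T.κ) z i ≤
        R (initialSize m (maxV V) ρ₀ z) from h m hm le_rfl
  intro k hk
  induction k, hk using Nat.le_induction with
  | base =>
    refine fun _ => ⟨fun s => s, isClassK_id, fun z _ i hi => ?_⟩
    obtain rfl : i = 1 := by simpa using hi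
    rw [errorSize_one]
    exact le_initialSize_maxV m (maxV V) ρ₀ z
  | succ k hk ih =>
    intro hkm
    obtain ⟨R, hR, hRb⟩ := ih (by omega)
    suffices hnew : ∃ R', IsClassK R' ∧ ∀ z : ∀ i, Vec (n i), z 1 ∈ X →
        errorSize V (safetyLaw P glo δbar V v D ρ₀) (trackingLaw P glo δbar T.κ) z (k + 1) ≤
        R' (initialSize m (maxV V) ρ₀ z) by
      obtain ⟨R', hR', hb'⟩ := hnew
      refine ⟨fun s => R s + R' s, hR.add hR', fun z hz i hi => ?_⟩
      have h0 : 0 ≤ initialSize m (maxV V) ρ₀ z :=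
        (hmax z hz).trans (le_initialSize_maxV m (maxV V) ρ₀ z)
      have h1 := hR.nonneg h0
      have h2 := hR'.nonneg h0
      have hi' := Finset.mem_Icc.1 hi
      rcases eq_or_ne i (k + 1) with rfl | hik
      · linarith [hb' z hz]
      · linarith [hRb z hz i (by simp only [Finset.mem_Icc]; omega)]
    have hk1 : k + 1 ∈ Finset.Icc 2 m := by simp only [Finset.mem_Icc]; omega
    rcases eq_or_ne k 1 with rfl | hk2
    -- The bound with |ρ₀(x_1)| is needed here, not the one with `ρbar`: a class K function must
    -- vanish at 0, and |ρ₀(x_1(0))| is part of the initial size.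
    · obtain ⟨γ, hγ, hγb⟩ := exists_bound_safetyLaw hm hnc hP hV hX hD ρ₀
      refine ⟨fun s => s + (γ s + s), isClassK_id.add (hγ.add isClassK_id), fun z hz => ?_⟩
      rw [errorSize_two]
      have h1 := hγb _ hz
      have h2 := norm_sub_le (z 2) (safetyLaw P glo δbar V v D ρ₀ (z 1))
      have h3 := hγ.mono (hmax z hz) (le_initialSize_maxV m (maxV V) ρ₀ z)
      have h4 := le_initialSize_nominal m (maxV V) ρ₀ z
      have h5 := le_initialSize_norm (maxV V) ρ₀ z hk1
      linarith
    · have hk3 : k ∈ Finset.Icc 2 m := by simp only [Finset.mem_Icc]; omega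
      have hκ := hT.isClassK_κ hk3
      refine ⟨fun s => s + glo / (glo - δbar) * T.κ k (R s),
        isClassK_id.add ((hκ.comp hR).const_mul hC), fun z hz => ?_⟩
      rw [errorSize_succ _ _ _ _ (by omega)]
      have h1 := norm_trackingLaw_le (P := P) hP hlt (fun s hs => hT.κ_nonneg hk3 hs)
        (z k - virtualInput (safetyLaw P glo δbar V v D ρ₀) (trackingLaw P glo δbar T.κ) z k)
      have h2 := norm_sub_le (z (k + 1)) (trackingLaw P glo δbar T.κ k
        (z k - virtualInput (safetyLaw P glo δbar V v D ρ₀) (trackingLaw P glo δbar T.κ) z k))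
      have h3 := hRb z hz k (by simp only [Finset.mem_Icc]; omega)
      rw [errorSize_of_two_le _ _ _ _ (by omega)] at h3
      have h4 := mul_le_mul_of_nonneg_left (hκ.mono (norm_nonneg _) h3) hC.le
      have h5 := le_initialSize_norm (maxV V) ρ₀ z hk1
      linarith

/-! ### Gain chains and the ultimate bounds -/

theorem exists_orderIso_gains (hγ : IsClassK (T.γ 1 2)) {Vmax : Vec (n 1) → ℝ}
    {ρ₁ : Vec (n 1) → Vec (n 2)} {θ : ℝ}
    (hT : TrackingConditions glo ghi δbar fbar T m X Vmax ρ₁ ρbar θ) (hsg : SmallGain T m) :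
    ∃ G : ℕ → ℝ≥0 ≃o ℝ≥0, (∀ i s, G i s ≤ s) ∧
      ∀ i, 1 ≤ i → i + 1 ≤ m → ∀ s : ℝ≥0, T.γ i (i + 1) s ≤ G i s := by
  have h : ∀ i, ∃ e : ℝ≥0 ≃o ℝ≥0, (∀ s, e s ≤ s) ∧
      (1 ≤ i → i + 1 ≤ m → ∀ s : ℝ≥0, T.γ i (i + 1) s ≤ e s) := by
    intro i
    by_cases hi : 1 ≤ i ∧ i + 1 ≤ m
    · have h1 : IsClassKOrZero (T.γ i (i + 1)) ∧ ∀ s, 0 < s → T.γ i (i + 1) s < s := by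
        rcases eq_or_ne i 1 with rfl | hi1
        · exact ⟨Or.inl hγ, hsg.γ₁₂_lt hi.2⟩
        · have hi2 : i ∈ Finset.Icc 2 m := by simp only [Finset.mem_Icc]; omega
          exact ⟨hT.γ_class i hi2 _ (by simp only [Finset.mem_Icc]; omega) (by omega),
            hsg.γ_lt i hi2 _ (by simp only [Finset.mem_Icc]; omega) (by omega) le_rfl⟩
      obtain ⟨e, he1, he2⟩ := exists_orderIso_gain h1.1 h1.2
      exact ⟨e, he1, fun _ _ => he2⟩
    · exact ⟨OrderIso.refl _, fun s => le_rfl, fun h1 h2 => absurd ⟨h1, h2⟩ hi⟩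
  choose G hG1 hG2 using h
  exact ⟨G, hG1, hG2⟩

/-- The enlarged gains serve the trajectory estimate, whereas the final constants use the original
ones. This comparison makes the points σ_i⁻¹(C) admissible in the generalized inverses of the
original chain. -/
theorem gammaChain_le_chainIso {γ : ℕ → ℕ → ℝ → ℝ} {G : ℕ → ℝ≥0 ≃o ℝ≥0}
    (hγ : ∀ i, 1 ≤ i → i + 1 ≤ m → ∀ s : ℝ≥0, 0 ≤ γ i (i + 1) s ∧ γ i (i + 1) s ≤ G i s)
    {i : ℕ} (hi : 1 ≤ i) (him : i ≤ m) (s : ℝ≥0) : gammaChain γ i s ≤ chainIso G i s := by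
  induction i, hi using Nat.le_induction generalizing s with
  | base => exact le_rfl
  | succ i hi ih =>
    obtain ⟨h1, h2⟩ := hγ i hi him s
    have h3 : gammaChain γ (i + 1) s = gammaChain γ i (γ i (i + 1) s) := by
      obtain ⟨p, rfl⟩ := Nat.exists_eq_add_of_le' hi
      rfl
    obtain ⟨q, hq⟩ : ∃ q : ℝ≥0, (q : ℝ) = γ i (i + 1) s := ⟨_, Real.coe_toNNReal _ h1⟩
    rw [h3, ← hq, chainIso_succ G hi]
    rw [← hq, NNReal.coe_le_coe] at h2
    exact (ih (by omega) q).trans (NNReal.coe_le_coe.2 ((chainIso G i).monotone h2))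

theorem inv_ge_of_lt {γ : ℝ → ℝ} (h0 : γ 0 = 0) (hγ : ∀ s, 0 < s → γ s < s) {M : ℝ}
    (hM : 0 ≤ M) : ENNReal.ofReal M ≤ inv γ (ENNReal.ofReal M) := by
  refine le_compInv (h := fun a => a) hM ?_
  rcases eq_or_lt_of_le hM with h | h
  · rw [← h, h0]
  · exact (hγ M h).le

/-- Because γ_{1,2} lies below the identity, its inverse lies above it, so the constant also
dominates the gain values inside the inverses. -/
theorem finalC_spec {c : Fin nc → ℝ} {C : ℝ≥0} (hC : finalC T m c ρbar = C)
    (h0 : T.γ 1 2 0 = 0) (hsg : SmallGain T m) :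
    (∀ j, c j ≤ C) ∧ (∀ i ∈ Finset.Icc 2 m, T.γx₁ i T.cx₁ ≤ C) ∧
      ∀ i ∈ Finset.Icc 2 m, T.γρ₀ i ρbar ≤ C := by
  have key : ∀ a : ℝ, ENNReal.ofReal a ≤ C → a ≤ C := fun a ha => by
    rw [← ENNReal.ofReal_coe_nnreal] at ha
    exact (ENNReal.ofReal_le_ofReal_iff C.2).1 ha
  have key' : ∀ i ∈ Finset.Icc 2 m, ∀ a : ℝ, ∀ s : ℝ≥0∞, ENNReal.ofReal a ≤ s →
      inv (T.γ 1 2) s ≤ C → a ≤ C := by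
    intro i hi a s ha hs
    rcases le_total a 0 with h | h
    · exact h.trans C.2
    · refine key a ((inv_ge_of_lt h0 (hsg.γ₁₂_lt ?_) h).trans ((compInv_mono _ _ ha).trans hs))
      simp only [Finset.mem_Icc] at hi
      omega
  refine ⟨fun j => key _ ?_, fun i hi => key' i hi _ _
    (Finset.le_sup (f := fun i => ENNReal.ofReal (T.γx₁ i T.cx₁)) hi) ?_,
    fun i hi => key' i hi _ _
    (Finset.le_sup (f := fun i => ENNReal.ofReal (T.γρ₀ i ρbar)) hi) ?_⟩
  · rw [← hC]
    exact (Finset.le_sup (f := fun j => ENNReal.ofReal (c j)) (Finset.mem_univ j)).trans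
      (le_max_left _ _)
  · rw [← hC]
    exact (le_max_left _ _).trans (le_max_right _ _)
  · rw [← hC]
    exact (le_max_right _ _).trans (le_max_right _ _)

theorem finalCi_eq_top {c : Fin nc → ℝ} (hC : finalC T m c ρbar = ⊤) (i : ℕ) :
    finalCi glo δbar T m c ρbar i = ⊤ := by
  rw [finalCi, hC, inv_top, ENNReal.mul_top (by norm_num), max_eq_left le_top, max_eq_right le_top]

/-- A sum of three terms is at most three times the largest, which explains the factors 3 in the
constant. -/
theorem ofReal_le_finalCi_two {c : Fin nc → ℝ} {C : ℝ≥0} (hC : finalC T m c ρbar = C) {i : ℕ}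
    {a b : ℝ} (hb0 : 0 ≤ b) (hb : T.γ 1 2 b ≤ C) (ha : a ≤ b + T.γV C + ρbar) :
    ENNReal.ofReal a ≤ finalCi glo δbar T m c ρbar i := by
  have h1 : 3 * ENNReal.ofReal (T.γV C) ≤ finalCi glo δbar T m c ρbar i := by
    refine le_trans ?_ (le_max_left _ _)
    rw [hC, ← ENNReal.ofReal_coe_nnreal]
    exact mul_le_mul_right (le_compInv (h := T.γV) (γ := fun a => a) C.2 le_rfl) _
  have h2 : 3 * ENNReal.ofReal b ≤ finalCi glo δbar T m c ρbar i := by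
    refine le_trans ?_ ((le_max_left _ _).trans (le_max_right _ _))
    rw [hC, ← ENNReal.ofReal_coe_nnreal]
    exact mul_le_mul_right (le_compInv (h := fun a => a) hb0 hb) _
  have h3 : 3 * ENNReal.ofReal ρbar ≤ finalCi glo δbar T m c ρbar i :=
    (le_max_left _ _).trans ((le_max_right _ _).trans (le_max_right _ _))
  have key : ∀ q : ℝ, a ≤ 3 * q → 3 * ENNReal.ofReal q ≤ finalCi glo δbar T m c ρbar i →
      ENNReal.ofReal a ≤ finalCi glo δbar T m c ρbar i := fun q hq h => by
    refine le_trans ?_ h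
    rw [← ENNReal.ofReal_ofNat 3, ← ENNReal.ofReal_mul (by norm_num)]
    exact ENNReal.ofReal_le_ofReal hq
  rcases le_total b (T.γV C) with h | h
  · rcases le_total (T.γV C) ρbar with h' | h'
    · exact key ρbar (by linarith) h3
    · exact key _ (by linarith) h1
  · rcases le_total b ρbar with h' | h'
    · exact key ρbar (by linarith) h3
    · exact key b (by linarith) h2

theorem three_mul_le_finalCi {c : Fin nc → ℝ} {i : ℕ} {a : ℝ} (ha : a ≤ 3 * ρbar) :
    ENNReal.ofReal a ≤ finalCi glo δbar T m c ρbar i := by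
  refine le_trans ?_ ((le_max_left _ _).trans ((le_max_right _ _).trans (le_max_right _ _)))
  rw [← ENNReal.ofReal_ofNat 3, ← ENNReal.ofReal_mul (by norm_num)]
  exact ENNReal.ofReal_le_ofReal ha

theorem ofReal_le_finalCi {c : Fin nc → ℝ} {C : ℝ≥0} (hC : finalC T m c ρbar = C) {i : ℕ}
    (hi : 3 ≤ i) {a b b' : ℝ} (hg : 0 ≤ glo / (glo - δbar)) (hb0 : 0 ≤ b)
    (hb : gammaChain T.γ i b ≤ C) (hb0' : 0 ≤ b') (hb' : gammaChain T.γ (i - 1) b' ≤ C)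
    (ha : a ≤ b + glo / (glo - δbar) * T.κ (i - 1) b') :
    ENNReal.ofReal a ≤ finalCi glo δbar T m c ρbar i := by
  have h1 : 2 * max (ENNReal.ofReal (glo / (glo - δbar) * T.κ (i - 1) b')) (ENNReal.ofReal b) ≤
      finalCi glo δbar T m c ρbar i := by
    refine le_trans ?_ ((le_max_right _ _).trans ((le_max_right _ _).trans (le_max_right _ _)))
    refine mul_le_mul_right (le_trans (max_le_max ?_ ?_)
      (Finset.le_sup (f := fun j => max (ENNReal.ofReal (glo / (glo - δbar)) *
        compInv (T.κ (j - 1)) (gammaChain T.γ (j - 1)) (finalC T m c ρbar))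
        (inv (gammaChain T.γ j) (finalC T m c ρbar))) (Finset.mem_Icc.2 ⟨hi, le_rfl⟩))) _
    · rw [hC, ← ENNReal.ofReal_coe_nnreal, ENNReal.ofReal_mul hg]
      exact mul_le_mul_right (le_compInv hb0' hb') _
    · rw [hC, ← ENNReal.ofReal_coe_nnreal]
      exact le_compInv (h := fun a => a) hb0 hb
  refine le_trans ?_ h1
  rcases le_total b (glo / (glo - δbar) * T.κ (i - 1) b') with h | h
  · refine le_trans ?_ (mul_le_mul_right (le_max_left _ _) _)
    rw [← ENNReal.ofReal_ofNat 2, ← ENNReal.ofReal_mul (by norm_num)]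
    exact ENNReal.ofReal_le_ofReal (by linarith)
  · refine le_trans ?_ (mul_le_mul_right (le_max_right _ _) _)
    rw [← ENNReal.ofReal_ofNat 2, ← ENNReal.ofReal_mul (by norm_num)]
    exact ENNReal.ofReal_le_ofReal (by linarith)

theorem safetyObjective_of_finalC_eq_top {ρ₁ : Vec (n 1) → Vec (n 2)}
    {ρ : ∀ i, Vec (n i) → Vec (n (i + 1))} {Vmax : Vec (n 1) → ℝ} {c : Fin nc → ℝ}
    (hC : finalC T m c ρbar = ⊤) :
    SafetyObjective P X Vmax ρ₀ ρ₁ ρ (finalC T m c ρbar) (finalCi glo δbar T m c ρbar) := by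
  have hKL := isClassKL_envelope (OrderIso.refl _) one_pos isClassK_id
  refine ⟨_, fun _ => _, hKL, fun _ _ => hKL, fun I x h t ht => ⟨h.mem t ht, ?_, fun i _ => ?_⟩⟩
  · rw [hC]; exact le_max_of_le_right le_top
  · rw [finalCi_eq_top hC]; exact le_max_of_le_right le_top

theorem safetyObjective (hm : 1 ≤ m) (hnc : 1 ≤ nc) (hP : PlantBounds P glo ghi δbar fbar)
    (hV : CertificateAssumption X V v η) (hX : SegmentsCross X V v)
    (hD : SafetyConditions glo δbar (fbar 1) (T.γ 1 2) X V v D) (hρbar : 0 ≤ ρbar)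
    (hT : TrackingConditions glo ghi δbar fbar T m X (maxV V)
      (safetyLaw P glo δbar V v D ρ₀) ρbar D.θ)
    (hsg : SmallGain T m) :
    SafetyObjective P X (maxV V) ρ₀ (safetyLaw P glo δbar V v D ρ₀)
      (trackingLaw P glo δbar T.κ) (finalC T m D.c ρbar) (finalCi glo δbar T m D.c ρbar) := by
  by_cases hCtop : finalC T m D.c ρbar = ⊤
  · exact safetyObjective_of_finalC_eq_top hCtop
  obtain ⟨C, hC⟩ : ∃ C : ℝ≥0, finalC T m D.c ρbar = C :=
    ⟨_, (ENNReal.coe_toNNReal hCtop).symm⟩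
  obtain ⟨hc, hc₁, hc₂⟩ := finalC_spec hC hD.γ₁₂_class.map_zero hsg
  have hlt := hD.δbar_lt
  have hglo : 0 < glo := lt_of_le_of_lt hP.δbar_nonneg hlt
  have hg : 0 < glo / (glo - δbar) := div_pos hglo (sub_pos.2 hlt)
  obtain ⟨R, hR, hRb⟩ := exists_bound_initial hm hnc hP hV hX hD hT
  obtain ⟨G, hG, hGγ⟩ := exists_orderIso_gains hD.γ₁₂_class hT hsg
  obtain ⟨Ψ, hΨ⟩ := exists_gauge m hm (chainIso G) (chainIso_le hG)
  have hη := hV.η_pos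
  have hθ := hD.θ_pos
  obtain ⟨μ, hμ0, hμ⟩ := exists_between
    (show 0 < min (η * glo * D.θ) (glo * D.θ) from lt_min (by positivity) (by positivity))
  have hβ := isClassKL_envelope Ψ hμ0 hR
  set β : ℝ → ℝ → ℝ := fun s t => (envelope Ψ μ (R s).toNNReal t : ℝ) with hβdef
  -- These class K functions turn the envelope for the errors into one for the states. In `h₂` the
  -- factor 3 leaves room for the constant ρbar, which is charged either to the KL term or to the
  -- ultimate bound.
  set h₂ : ℝ → ℝ := fun s => 3 * ((((chainIso G 2).symm s.toNNReal : ℝ≥0) : ℝ) + T.γV s) with hh₂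
  set h₃ : ℕ → ℝ → ℝ := fun i s => 2 * ((((chainIso G i).symm s.toNNReal : ℝ≥0) : ℝ) +
    glo / (glo - δbar) * T.κ (i - 1) ((chainIso G (i - 1)).symm s.toNNReal : ℝ≥0)) with hh₃
  have hK₂ : IsClassK h₂ :=
    ((isClassK_orderIso (chainIso G 2).symm).add hT.γV_class).const_mul (by norm_num)
  have hK₃ : ∀ i ∈ Finset.Icc 3 m, IsClassK (h₃ i) := fun i hi =>
    ((isClassK_orderIso (chainIso G i).symm).add (((hT.isClassK_κ (i := i - 1) (by
      simp only [Finset.mem_Icc] at hi ⊢; omega)).comp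
      (isClassK_orderIso (chainIso G (i - 1)).symm)).const_mul hg)).const_mul (by norm_num)
  have hchain : ∀ i, 1 ≤ i → i ≤ m → gammaChain T.γ i ((chainIso G i).symm C : ℝ≥0) ≤ C := by
    intro i hi him
    refine (gammaChain_le_chainIso (fun i hi him s => ⟨?_, hGγ i hi him s⟩) hi him _).trans_eq
      (by rw [OrderIso.apply_symm_apply])
    rcases eq_or_ne i 1 with rfl | hi1
    · exact hD.γ₁₂_class.nonneg s.2
    · exact (hT.γ_class i (by simp only [Finset.mem_Icc]; omega) _
        (by simp only [Finset.mem_Icc]; omega) (by omega)).nonneg s.2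
  refine ⟨β, fun i => if i = 2 then fun s t => h₂ (β s t) else fun s t => h₃ i (β s t), hβ,
    fun i hi => ?_, fun I x h t ht => ?_⟩
  · dsimp only
    split_ifs with hi2
    · exact IsClassKL.comp_left hK₂ hβ
    · exact IsClassKL.comp_left (hK₃ i (by simp only [Finset.mem_Icc] at hi ⊢; omega)) hβ
  have hx0 : x 1 0 ∈ X := h.mem 0 h.zero_mem
  set s₀ := initialSize m (maxV V) ρ₀ fun i => x i 0 with hs₀
  have hs₀0 : 0 ≤ s₀ := ((hV.pos ⟨0, hnc⟩ hx0).le.trans (le_maxV V _ _)).trans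
    (le_initialSize_maxV m (maxV V) ρ₀ fun i => x i 0)
  have hbound := errorSize_le hm hnc hP hV hX hD hρbar hT hsg h ht hG hGγ hΨ hμ0.le
    (hμ.trans_le (min_le_left _ _)) (hμ.trans_le (min_le_right _ _)) (c := C)
    (r := (R s₀).toNNReal) hc hc₁ hc₂
    (fun i hi => (hRb (fun i => x i 0) hx0 i hi).trans (Real.le_coe_toNNReal _)) t
    ⟨h.nonneg ht, le_rfl⟩
  set B := envelope Ψ μ (R s₀).toNNReal t with hB
  have hβB : β s₀ t = B := rfl
  have hxX := h.mem t ht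
  have hmax : 0 ≤ maxV V (x 1 t) := (hV.pos ⟨0, hnc⟩ hxX).le.trans (le_maxV V _ _)
  set y := errorSize V (safetyLaw P glo δbar V v D ρ₀) (trackingLaw P glo δbar T.κ)
    fun i => x i t with hy
  have hy0 : ∀ j, 0 ≤ y j := errorSize_nonneg _ _ _ _ hmax
  have hy1 : y 1 ≤ (max B C : ℝ≥0) := hbound 1 (by simp [hm])
  refine ⟨hxX, ?_, fun i hi => ?_⟩
  · rw [hC, hβB, ENNReal.ofReal_coe_nnreal, ← ENNReal.coe_max]
    have h1 : y 1 = maxV V (x 1 t) := errorSize_one _ _ _ _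
    rw [← h1, ← ENNReal.ofReal_coe_nnreal]
    exact ENNReal.ofReal_le_ofReal hy1
  · beta_reduce
    have hi' := Finset.mem_Icc.1 hi
    have hyi := hbound i (by simp only [Finset.mem_Icc]; omega)
    rcases eq_or_ne i 2 with rfl | hi2
    · have h1 : ‖x 2 t‖ ≤ y 2 + T.γV (y 1) + ρbar :=
        norm_state_two_le hT (trackingLaw P glo δbar T.κ) (z := fun i => x i t) hxX
      have h2 := hT.γV_class.mono (hy0 1) hy1
      rw [if_pos rfl, hβB]
      -- While the envelope exceeds C, the KL function carries the bound, apart from the case where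
      -- ρbar dominates; afterwards the final constant does.
      rcases le_total C B with hCB | hBC
      · rw [max_eq_left hCB] at hyi h2
        have h3 : ‖x 2 t‖ ≤ h₂ B / 3 + ρbar := by
          simp only [hh₂, Real.toNNReal_coe]
          linarith
        rcases le_total (h₂ B / 3) ρbar with h4 | h4
        · exact le_max_of_le_right (three_mul_le_finalCi (by linarith))
        · exact le_max_of_le_left (ENNReal.ofReal_le_ofReal (by linarith))
      · rw [max_eq_right hBC] at hyi h2
        refine le_max_of_le_right (ofReal_le_finalCi_two hC (NNReal.coe_nonneg _)
          (hchain 2 (by omega) hi'.2) ?_)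
        linarith
    · rw [if_neg hi2, hβB]
      have him : i - 1 ∈ Finset.Icc 2 m := by simp only [Finset.mem_Icc]; omega
      have h1 : ‖x i t‖ ≤ y i + glo / (glo - δbar) * T.κ (i - 1) (y (i - 1)) := by
        have := norm_state_succ_le (V := V) hP hlt hT (fun i => x i t) him
        obtain ⟨p, rfl⟩ : ∃ p, i = p + 1 := ⟨i - 1, by omega⟩
        exact this
      have hyi' := hbound (i - 1) (by simp only [Finset.mem_Icc]; omega)
      have h2 := mul_le_mul_of_nonneg_left
        ((hT.κ_strictMono (i - 1) him).monotone hyi') hg.le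
      rcases le_total C B with hCB | hBC
      · rw [max_eq_left hCB] at hyi h2
        refine le_max_of_le_left (ENNReal.ofReal_le_ofReal ?_)
        simp only [hh₃, Real.toNNReal_coe]
        linarith [norm_nonneg (x i t)]
      · rw [max_eq_right hBC] at hyi h2
        refine le_max_of_le_right (ofReal_le_finalCi hC (by omega) hg.le (NNReal.coe_nonneg _)
          (hchain i (by omega) hi'.2) (NNReal.coe_nonneg _)
          (hchain (i - 1) (by omega) (by omega)) ?_)
        linarith

/-! ### Finiteness of the constants -/

theorem finalC_lt_top {c : Fin nc → ℝ} (hγ : Tendsto (T.γ 1 2) atTop atTop) :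
    finalC T m c ρbar < ⊤ := by
  have h1 : MonotoneOn (fun a : ℝ => a) (Ici 0) := monotone_id.monotoneOn _
  refine max_lt ?_ (max_lt (compInv_lt_top h1 hγ ?_) (compInv_lt_top h1 hγ ?_))
  all_goals exact (Finset.sup_lt_iff ENNReal.zero_lt_top).2 fun _ _ => ENNReal.ofReal_lt_top

/-- The finite value κ_i(s) bounds a positive multiple of γ_{i,i+1}⁻¹(s), so this inverse is finite
for every s, which forces the gain to be unbounded. -/
theorem tendsto_gain_succ {Vmax : Vec (n 1) → ℝ} {ρ₁ : Vec (n 1) → Vec (n 2)} {θ : ℝ}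
    (hT : TrackingConditions glo ghi δbar fbar T m X Vmax ρ₁ ρbar θ) (hglo : 0 < glo)
    (hδ : 0 ≤ δbar) {i : ℕ} (hi : i ∈ Finset.Icc 2 m) : Tendsto (T.γ i (i + 1)) atTop atTop := by
  refine tendsto_atTop_of_inv_lt_top fun s hs => ?_
  have h1 : ENNReal.ofReal ((glo + δbar) / glo) * inv (T.γ i (i + 1)) (ENNReal.ofReal s) ≤
      ENNReal.ofReal (T.κ i s) :=
    (le_add_self.trans le_self_add).trans (hT.κ_ge i hi s hs)
  have h2 : 0 < (glo + δbar) / glo := by positivity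
  by_contra hcon
  rw [not_lt, top_le_iff] at hcon
  rw [hcon, ENNReal.mul_top (ENNReal.ofReal_pos.2 h2).ne', top_le_iff] at h1
  exact ENNReal.ofReal_ne_top h1

theorem tendsto_gammaChain {γ : ℕ → ℕ → ℝ → ℝ}
    (hγ : ∀ i, 1 ≤ i → i + 1 ≤ m → Tendsto (γ i (i + 1)) atTop atTop) {i : ℕ} (hi : 1 ≤ i)
    (him : i ≤ m) : Tendsto (gammaChain γ i) atTop atTop := by
  induction i, hi using Nat.le_induction with
  | base => exact tendsto_id
  | succ i hi ih =>
    have h3 : gammaChain γ (i + 1) = gammaChain γ i ∘ γ i (i + 1) := by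
      obtain ⟨p, rfl⟩ := Nat.exists_eq_add_of_le' hi
      rfl
    rw [h3]
    exact (ih (by omega)).comp (hγ i hi him)

theorem finalCi_lt_top {Vmax : Vec (n 1) → ℝ} {ρ₁ : Vec (n 1) → Vec (n 2)} {θ : ℝ}
    (hT : TrackingConditions glo ghi δbar fbar T m X Vmax ρ₁ ρbar θ) (hglo : 0 < glo)
    (hδ : 0 ≤ δbar) {c : Fin nc → ℝ} (hγ : Tendsto (T.γ 1 2) atTop atTop) {i : ℕ}
    (hi : i ∈ Finset.Icc 2 m) : finalCi glo δbar T m c ρbar i < ⊤ := by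
  have hC : finalC T m c ρbar < ⊤ := finalC_lt_top hγ
  have h1 : MonotoneOn (fun a : ℝ => a) (Ici 0) := monotone_id.monotoneOn _
  have hchain : ∀ j, 1 ≤ j → j ≤ m → Tendsto (gammaChain T.γ j) atTop atTop := fun j hj hjm =>
    tendsto_gammaChain (fun i hi him => by
      rcases eq_or_ne i 1 with rfl | hi1
      · exact hγ
      · exact tendsto_gain_succ hT hglo hδ (by simp only [Finset.mem_Icc]; omega)) hj hjm
  refine max_lt (ENNReal.mul_lt_top (by norm_num) (compInv_lt_top
    hT.γV_class.strictMonoOn.monotoneOn tendsto_id hC))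
    (max_lt (ENNReal.mul_lt_top (by norm_num) (compInv_lt_top h1 hγ hC))
    (max_lt (ENNReal.mul_lt_top (by norm_num) ENNReal.ofReal_lt_top)
    (ENNReal.mul_lt_top (by norm_num) ((Finset.sup_lt_iff ENNReal.zero_lt_top).2 fun j hj => ?_))))
  have hj' : 3 ≤ j ∧ j ≤ m := by simp only [Finset.mem_Icc] at hi hj; omega
  exact max_lt (ENNReal.mul_lt_top ENNReal.ofReal_lt_top (compInv_lt_top
    ((hT.κ_strictMono (j - 1) (by simp only [Finset.mem_Icc]; omega)).monotone.monotoneOn _)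
    (hchain (j - 1) (by omega) (by omega)) hC))
    (compInv_lt_top h1 (hchain j (by omega) hj'.2) hC)

end Objective

end CascadeSafety

end

/-! ### Assembly of the theorem -/

theorem mainTheorem4 (m : ℕ) (hm : 1 ≤ m) (n : ℕ → ℕ) (nc nl : ℕ) (hnc : 1 ≤ nc)
    (P : CascadeSafety.Plant m n) (glo ghi δbar : ℝ) (fbar : ℕ → ℝ → ℝ)
    (hP : CascadeSafety.PlantBounds P glo ghi δbar fbar)
    (X : Set (CascadeSafety.Vec (n 1))) (V : Fin nc → CascadeSafety.Vec (n 1) → ℝ)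
    (v : Fin nc → ℝ) (η : ℝ) (hV : CascadeSafety.CertificateAssumption X V v η)
    (hX : CascadeSafety.SegmentsCross X V v)
    (ρ₀ : CascadeSafety.Vec (n 1) → CascadeSafety.Vec (n 2)) (ρbar : ℝ)
    (hρ₀ : CascadeSafety.NominalAssumption ρ₀ ρbar)
    (D : CascadeSafety.SafetyDesign nc nl (n 2)) (γ₁₂ : ℝ → ℝ)
    (hD : CascadeSafety.SafetyConditions glo δbar (fbar 1) γ₁₂ X V v D) :
    -- the QP problems that define the selection and the law `ρ_1` are uniquely solvable
    (∀ x ∈ X,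
      (∃! u, CascadeSafety.IsNearest (CascadeSafety.selectionSet P glo δbar V v D x) 0 u) ∧
      CascadeSafety.selection P glo δbar V v D x ∈ CascadeSafety.coneSet P glo δbar V v D x ∧
      ∃! u, CascadeSafety.IsNearest (CascadeSafety.reshapedSet P glo δbar V v D x) (ρ₀ x) u) ∧
    -- a function `γ_{x₂*,V}` as required of the tracking parameters exists
    (∃ γV, CascadeSafety.IsClassK γV ∧ ∀ x ∈ X,
      ‖CascadeSafety.safetyLaw P glo δbar V v D ρ₀ x‖ ≤ γV (CascadeSafety.maxV V x) + ρbar) ∧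
    -- the safety objective is achieved
    ∀ T : CascadeSafety.TrackingDesign, T.γ 1 2 = γ₁₂ →
      CascadeSafety.TrackingConditions glo ghi δbar fbar T m X (CascadeSafety.maxV V)
        (CascadeSafety.safetyLaw P glo δbar V v D ρ₀) ρbar D.θ →
      CascadeSafety.SmallGain T m →
      CascadeSafety.SafetyObjective P X (CascadeSafety.maxV V) ρ₀
        (CascadeSafety.safetyLaw P glo δbar V v D ρ₀)
        (CascadeSafety.trackingLaw P glo δbar T.κ)
        (CascadeSafety.finalC T m D.c ρbar)
        (CascadeSafety.finalCi glo δbar T m D.c ρbar) ∧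
      (Tendsto γ₁₂ atTop atTop →
        CascadeSafety.finalC T m D.c ρbar < ⊤ ∧
        ∀ i ∈ Finset.Icc 2 m, CascadeSafety.finalCi glo δbar T m D.c ρbar i < ⊤) := by
  refine ⟨fun x hx => ?_, ?_, ?_⟩
  · obtain ⟨h1, h2, -⟩ := CascadeSafety.selection_spec hm hP hV hX hD hx
    exact ⟨h1, h2, CascadeSafety.existsUnique_safetyLaw hm hnc hP hV hX hD ρ₀ hx⟩
  · obtain ⟨γ, hγ, h⟩ := CascadeSafety.exists_bound_safetyLaw hm hnc hP hV hX hD ρ₀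
    exact ⟨γ, hγ, fun x hx => (h x hx).trans (by linarith [hρ₀.bound x])⟩
  · rintro T rfl hT hsg
    refine ⟨CascadeSafety.safetyObjective hm hnc hP hV hX hD hρ₀.ρbar_pos.le hT hsg,
      fun hγ => ⟨CascadeSafety.finalC_lt_top hγ, fun i hi => ?_⟩⟩
    exact CascadeSafety.finalCi_lt_top hT (lt_of_le_of_lt hP.δbar_nonneg hD.δbar_lt)
      hP.δbar_nonneg hγ hi
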